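/- **Setting.** Let $W=(W^1,W^2)$ be a standard planar Brownian motion (two independent real Brownian motions), regarded as $\mathbb{C}$-valued and extended by $W(t)=0$ for $t\le 0$, and let $$f(p,\tau)=\mathbb{E}_{Z_\tau}W(p-Z_\tau),\qquad Z_\tau\sim N(0,\tau),\quad \tau>0,$$ where the expectation is over $Z_\tau$ only, for a fixed realisation of $W$. A *singularity* of a curve $\gamma:\mathbb{R}\to\mathbb{C}$ is a point $t_0$ with $\gamma'(t_0)=0$. It is a *cusp singularity* if $\gamma$ is analytic near $t_0$ and there is $c\in\mathbb{C}$, $|c|=1$, such that, for $t$ near $t_0$, $c(\gamma(t)-\gamma(t_0))$ has real part $\sum_{i\ge2}a_i(t-t_0)^i$ and imaginary part $\sum_{i\ge3}b_i(t-t_0)^i$ with $a_2\ne0$, $b_3\neq0$; the coordinates given by $z\mapsto c(z-\gamma(t_0))$ are then called *natural coordinates* at $t_0$. Let $\mathcal{M}$ be the set of continuous curves $g:[a,b]\to\mathbb{C}$, $a<b$, with the metric $d(g,h)=\inf\{\|\lambda_1-\lambda_2\|_\infty+\|g\circ\lambda_1-h\circ\lambda_2\|_\infty\}$ over homeomorphisms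 $\lambda_1,\lambda_2$ of $[0,1]$ onto the domains of $g$ and $h$ respectively. A *loop* of $\gamma$ is a restriction $\gamma|_{[a,b]}$, $a<b$, with $\gamma(a)=\gamma(b)$ and $\gamma$ injective on $[a,b)$; it is a loop *in* an interval $I$ if $[a,b]\subseteq I$. A *loop evolution* of $f$ on $[T_1,T_2)$ is a continuous map $L:[T_1,T_2)\to\mathcal{M}$ such that $L(\tau)=f(\cdot,\tau)|_{[a_\tau,b_\tau]}$ is a loop for every $\tau$. If $L$ is a loop evolution on $[T_1,T)$, its initial loop *dies at* $(p,T)$ if $T$ is the supremum of all $T_2>T_1$ for which there is a loop evolution of $f$ on $[T_1,T_2)$ starting from $L(T_1)$, and $a_\tau\to p$, $b_\tau-a_\tau\to0$ as $\tau\uparrow T$. **Theorem.** There is a constant $M>0$ such that, with probability one, the following holds for all $p_0>0$, $\tau_0>0$ such that $p_0$ is a singularity of $f(\cdot,\tau_0)$. The point $p_0$ is a cusp singularity of $f(\cdot,\tau_0)$, and there is $\delta\in(0,\tau_0)$ such that: 1. For every $\tau\in[\tau_0-\delta,\tau_0)$ there is a compact interval $I_\tau\subset(0,\infty)$ with $p_0$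 in its interior in which $f(\cdot,\tau)$ has a unique loop $L(\tau)=f(\cdot,\tau)|_{[a_\tau,b_\tau]}$. The intervals $I_\tau$ are decreasing in $\tau$ and both their end points tend to $p_0$ as $\tau\uparrow\tau_0$. The map $L:[\tau_0-\delta,\tau_0)\to\mathcal{M}$ is a loop evolution of $f$ (starting from $L(\tau_0-\delta)$), and the loop $L(\tau_0-\delta)$ dies at $(p_0,\tau_0)$. 2. In any natural coordinates of $f(\cdot,\tau_0)$ at $p_0$, with constant $c$ and coefficients $a_i,b_i$, write $c\,(f(p_0+q,\tau)-f(p_0,\tau_0))=f^1(q,\tau)+\mathrm{i}f^2(q,\tau)$. For every $s\in(0,\delta]$ the curve $$\hat f_s(P)=\left(s^{-1}f^1(\sqrt{s}P,\tau_0-s),\ s^{-3/2}f^2(\sqrt{s}P,\tau_0-s)\right)$$ has a unique loop $\hat L_s$ in $[-M,M]$, and as $s\downarrow0$, $\hat L_s$ converges in $(\mathcal{M},d)$ to $\hat L_0=\hat g|_{[-\sqrt3,\sqrt3]}$, which is the unique loop of the curve $\hat g(P)=(a_2(P^2-1),\,b_3(P^3-3P))$ on $\mathbb{R}$. -/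

import Mathlib

open MeasureTheory ProbabilityTheory Set Filter
open scoped NNReal Topology unitInterval

noncomputable section

namespace CongaLoop

/-! ### The particle-path curves -/

/-- The planar path with coordinates `w₁`, `w₂`, extended by `0` to nonpositive times. -/
def extendedPath (w₁ w₂ : ℝ≥0 → ℝ) (t : ℝ) : ℂ :=
  if 0 < t then ⟨w₁ t.toNNReal, w₂ t.toNNReal⟩ else 0

/-- The heat extension `f(p, τ) = E W(p - Z)`, with `Z` a centred normal variable of variance `τ`
and the path `W = (w₁, w₂)` held fixed. -/
def heatExtension (w₁ w₂ : ℝ≥0 → ℝ) (p τ : ℝ) : ℂ :=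
  ∫ z, extendedPath w₁ w₂ (p - z) ∂(gaussianReal 0 τ.toNNReal)

/-! ### Singularities and natural coordinates -/

/-- The curve `γ` has zero velocity at `t₀`. -/
def IsSingularity (γ : ℝ → ℂ) (t₀ : ℝ) : Prop := HasDerivAt γ 0 t₀

/-- The rigid motion `z ↦ c * (z - γ t₀)`, with `|c| = 1`, is a natural coordinate frame of `γ` based
at `t₀`: in it the two coordinates of `γ` are, near `t₀`, the sums of the power series
`∑_{i ≥ 2} a i * (t - t₀) ^ i` and `∑_{i ≥ 3} b i * (t - t₀) ^ i`, with `a 2 ≠ 0` and `b 3 ≠ 0`. -/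
structure IsNaturalFrame (γ : ℝ → ℂ) (t₀ : ℝ) (c : ℂ) (a b : ℕ → ℝ) : Prop where
  norm_eq_one : ‖c‖ = 1
  a_low : ∀ i < 2, a i = 0
  b_low : ∀ i < 3, b i = 0
  a_two : a 2 ≠ 0
  b_three : b 3 ≠ 0
  expansion : ∃ r > 0, ∀ t, |t - t₀| ≤ r →
    HasSum (fun i => a i * (t - t₀) ^ i) (c * (γ t - γ t₀)).re ∧
    HasSum (fun i => b i * (t - t₀) ^ i) (c * (γ t - γ t₀)).im

/-- A cusp singularity: the curve is analytic near `t₀` and has a natural coordinate frame there. -/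
structure IsCuspSingularity (γ : ℝ → ℂ) (t₀ : ℝ) : Prop where
  isSingularity : IsSingularity γ t₀
  analyticAt : AnalyticAt ℝ γ t₀
  exists_frame : ∃ c a b, IsNaturalFrame γ t₀ c a b

/-! ### The metric space of curves on compact intervals -/

/-- A continuous curve `[left, right] → ℂ` on a nondegenerate compact interval. -/
structure Curve where
  left : ℝ
  right : ℝ
  left_lt_right : left < right
  toFun : C(Icc left right, ℂ)

namespace Curve

/-- A homeomorphism `[0, 1] → [a, b]`, as a real-valued function. -/
def param {a b : ℝ} (l : I ≃ₜ Icc a b) : C(I, ℝ) := ⟨fun t => (l t : ℝ), by fun_prop⟩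

/-- The curve `L` reparametrised by a homeomorphism of `[0, 1]` with its interval. -/
def reparam (L : Curve) (l : I ≃ₜ Icc L.left L.right) : C(I, ℂ) :=
  ⟨fun t => L.toFun (l t), by fun_prop⟩

/-- `‖λ₁ - λ₂‖ + ‖K ∘ λ₁ - L ∘ λ₂‖`, in sup norms on `[0, 1]`. -/
def cost (K L : Curve) (l : (I ≃ₜ Icc K.left K.right) × (I ≃ₜ Icc L.left L.right)) : ℝ :=
  ‖param l.1 - param l.2‖ + ‖K.reparam l.1 - L.reparam l.2‖

/-- The distance `d(K, L)`: the infimum of the cost over all pairs of homeomorphisms. -/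
def d (K L : Curve) : ℝ := ⨅ l, cost K L l

lemma cost_nonneg (K L : Curve) (l) : 0 ≤ cost K L l := by unfold cost; positivity

lemma d_le (K L : Curve) (l) : d K L ≤ cost K L l :=
  ciInf_le ⟨0, by rintro _ ⟨l, rfl⟩; exact cost_nonneg K L l⟩ l

instance (L : Curve) : Nonempty (I ≃ₜ Icc L.left L.right) :=
  ⟨(iccHomeoI L.left L.right L.left_lt_right).symm⟩

lemma d_nonneg (K L : Curve) : 0 ≤ d K L := le_ciInf (cost_nonneg K L)

lemma d_self (L : Curve) : d L L = 0 := by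
  obtain ⟨l⟩ : Nonempty (I ≃ₜ Icc L.left L.right) := inferInstance
  exact le_antisymm ((d_le L L (l, l)).trans (by simp [cost])) (d_nonneg L L)

lemma d_comm_le (K L : Curve) : d K L ≤ d L K := by
  refine le_ciInf fun l => (d_le K L (l.2, l.1)).trans (le_of_eq ?_)
  simp only [cost]
  rw [norm_sub_rev, norm_sub_rev (K.reparam l.2)]

lemma norm_comp_le {E : Type*} [NormedAddCommGroup E] (g : C(I, E)) (h : C(I, I)) :
    ‖g.comp h‖ ≤ ‖g‖ :=
  (ContinuousMap.norm_le _ (norm_nonneg _)).2 fun t => g.norm_coe_le_norm (h t)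

lemma cost_comp_le (K L : Curve) (l : (I ≃ₜ Icc K.left K.right) × (I ≃ₜ Icc L.left L.right))
    (h : I ≃ₜ I) : cost K L (h.trans l.1, h.trans l.2) ≤ cost K L l :=
  add_le_add (norm_comp_le (param l.1 - param l.2) ⟨h, h.continuous⟩)
    (norm_comp_le (K.reparam l.1 - L.reparam l.2) ⟨h, h.continuous⟩)

lemma d_triangle (J K L : Curve) : d J L ≤ d J K + d K L := by
  refine le_ciInf_add_ciInf fun l m => ?_
  have h₁ := cost_comp_le K L m (l.2.trans m.1.symm)
  have e : (l.2.trans m.1.symm).trans m.1 = l.2 := by ext t; simp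
  rw [e] at h₁
  refine (d_le J L (l.1, (l.2.trans m.1.symm).trans m.2)).trans
    (le_trans ?_ (add_le_add le_rfl h₁))
  simp only [cost]
  have t₁ := norm_sub_le_norm_sub_add_norm_sub (param l.1) (param l.2)
    (param ((l.2.trans m.1.symm).trans m.2))
  have t₂ := norm_sub_le_norm_sub_add_norm_sub (J.reparam l.1) (K.reparam l.2)
    (L.reparam ((l.2.trans m.1.symm).trans m.2))
  linarith

instance : PseudoMetricSpace Curve where
  dist := d
  dist_self := d_self
  dist_comm K L := le_antisymm (d_comm_le K L) (d_comm_le L K)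
  dist_triangle := d_triangle

end Curve

/-! ### Loops and their evolution -/

/-- `L` is a loop of `γ`: the restriction of `γ` to `[L.left, L.right]`, with equal values at the two
end points and injective on `[L.left, L.right)`. -/
structure IsLoopOf (γ : ℝ → ℂ) (L : Curve) : Prop where
  restriction : ∀ x, L.toFun x = γ x
  closed : γ L.left = γ L.right
  injOn : InjOn γ (Ico L.left L.right)

/-- `L` is a loop of `γ` in the set `S`, and the only one. -/
structure IsUniqueLoopIn (γ : ℝ → ℂ) (S : Set ℝ) (L : Curve) : Prop where
  isLoop : IsLoopOf γ L
  subset : Icc L.left L.right ⊆ S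
  unique : ∀ L', IsLoopOf γ L' → Icc L'.left L'.right ⊆ S → L' = L

/-- `L` is a loop evolution of `f` on `[T₁, T₂)`. -/
structure IsLoopEvolution (f : ℝ → ℝ → ℂ) (T₁ T₂ : ℝ) (L : ℝ → Curve) : Prop where
  continuousOn : ContinuousOn L (Ico T₁ T₂)
  isLoop : ∀ t ∈ Ico T₁ T₂, IsLoopOf (fun p => f p t) (L t)

/-- The loop `L₀`, present at time `T₁`, vanishes after time `T`. -/
def VanishesAfter (f : ℝ → ℝ → ℂ) (T₁ : ℝ) (L₀ : Curve) (T : ℝ) : Prop :=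
  IsLUB {T₂ | T₁ < T₂ ∧ ∃ L, IsLoopEvolution f T₁ T₂ L ∧ L T₁ = L₀} T

/-- `L` is a loop evolution of `f` on `[T₁, T)`, and its initial loop dies at `(p, T)`. -/
structure DiesAt (f : ℝ → ℝ → ℂ) (T₁ : ℝ) (L : ℝ → Curve) (p T : ℝ) : Prop where
  evolution : IsLoopEvolution f T₁ T L
  vanishes : VanishesAfter f T₁ (L T₁) T
  left_tendsto : Tendsto (fun t => (L t).left) (𝓝[<] T) (𝓝 p)
  length_tendsto : Tendsto (fun t => (L t).right - (L t).left) (𝓝[<] T) (𝓝 0)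

/-! ### The rescaling and the limiting loop -/

/-- The rescaled curve `P ↦ (s⁻¹ f¹(√s P, τ₀ - s), s^(-3/2) f²(√s P, τ₀ - s))`, where `f¹`, `f²` are
the coordinates of `f` after the rigid motion `z ↦ c * (z - f p₀ τ₀)` and the space variable is
measured from `p₀`. -/
def rescaled (f : ℝ → ℝ → ℂ) (c : ℂ) (p₀ τ₀ s P : ℝ) : ℂ :=
  let z := c * (f (p₀ + √s * P) (τ₀ - s) - f p₀ τ₀)
  ⟨s⁻¹ * z.re, s ^ (-(3 / 2) : ℝ) * z.im⟩

/-- The curve `P ↦ (a (P² - 1), b (P³ - 3 P))`. -/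
def limitCurve (a b P : ℝ) : ℂ := ⟨a * (P ^ 2 - 1), b * (P ^ 3 - 3 * P)⟩

lemma continuous_limitCurve (a b : ℝ) : Continuous (limitCurve a b) :=
  Complex.equivRealProdCLM.symm.continuous.comp
    (f := fun P : ℝ => (a * (P ^ 2 - 1), b * (P ^ 3 - 3 * P))) (by fun_prop)

/-- The restriction of `limitCurve a b` to `[-√3, √3]`. -/
def limitLoop (a b : ℝ) : Curve where
  left := -√3
  right := √3
  left_lt_right := neg_lt_self (by positivity)
  toFun := ⟨fun P => limitCurve a b P, (continuous_limitCurve a b).comp continuous_subtype_val⟩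

end CongaLoop

end

/-!
The heat extension `f` of a path of moderate growth is smooth for positive times, and its space
derivatives are integrals of the path against derivatives of the heat kernel. If `p₀` is a
singularity of `f(·, τ₀)`, a Taylor expansion along `(p₀ + εP, τ₀ - ε²)`, where the heat equation
trades one time derivative for two space derivatives, yields Hermite polynomials: up to scaling by
`ε²` and `ε³`, the two coordinates tend in `C¹` to multiples of `P² - 1` and `P³ - 3P`. A small
`C¹` perturbation of the curve `(P² - 1, P³ - 3P)` has exactly one self-intersection on
`[-2, 2]`, so `f(·, τ)` has exactly one loop in an interval shrinking to `p₀` as `τ ↑ τ₀`.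

The expansion needs the second and third derivatives of `f(·, τ₀)` at `p₀` to be linearly
independent over `ℝ`. That this holds at all singularities simultaneously is a transversality
argument. Adding to the path a combination of three ramps with coefficients `g ∈ ℂ³` moves the
first three derivatives by an invertible matrix applied to `g`, so the set of `g` for which some
`(p, τ)` is degenerate is the image, under a differentiable map, of a set of parameters of smaller
dimension, hence null. Brownian motion is a process perturbed in this way, where `g` is made of
three of its increments, hence Gaussian, and the process is independent of `g`.
-/

namespace CongaLoop

/-! ### The heat kernel and its space derivatives -/

/-- The `j`-th space derivative, at `x`, of the density of a centred normal variable of variance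
`τ`. It is defined by the three-term recurrence of the Hermite polynomials. -/
noncomputable def heatKernel : ℕ → ℝ → ℝ → ℝ
  | 0, x, τ => (√(2 * Real.pi * τ))⁻¹ * Real.exp (-x ^ 2 / (2 * τ))
  | 1, x, τ => -(x * heatKernel 0 x τ) / τ
  | j + 2, x, τ => -(x * heatKernel (j + 1) x τ + (j + 1) * heatKernel j x τ) / τ

lemma heatKernel_zero (x τ : ℝ) :
    heatKernel 0 x τ = (√(2 * Real.pi * τ))⁻¹ * Real.exp (-x ^ 2 / (2 * τ)) := by
  rw [heatKernel]

lemma heatKernel_one (x τ : ℝ) : heatKernel 1 x τ = -(x * heatKernel 0 x τ) / τ := by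
  simp only [heatKernel]

lemma heatKernel_add_two (j : ℕ) (x τ : ℝ) :
    heatKernel (j + 2) x τ = -(x * heatKernel (j + 1) x τ + (j + 1) * heatKernel j x τ) / τ := by
  rw [heatKernel]

lemma heatKernel_zero_pos (x : ℝ) {τ : ℝ} (hτ : 0 < τ) : 0 < heatKernel 0 x τ := by
  rw [heatKernel_zero]; positivity

lemma heatKernel_zero_eq_gaussianPDFReal (x : ℝ) {τ : ℝ} (hτ : 0 < τ) :
    heatKernel 0 x τ = gaussianPDFReal 0 τ.toNNReal x := by
  simp [heatKernel_zero, gaussianPDFReal, hτ.le]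

/-- The linear form `(x, τ) ↦ x a + τ b`, with values in a vector space: the derivative of a
function of space and time with partial derivatives `a` and `b`. -/
noncomputable def partials {E : Type*} [NormedAddCommGroup E] [NormedSpace ℝ E] (a b : E) :
    ℝ × ℝ →L[ℝ] E :=
  (ContinuousLinearMap.fst ℝ ℝ ℝ).smulRight a + (ContinuousLinearMap.snd ℝ ℝ ℝ).smulRight b

@[simp]
lemma partials_apply {E : Type*} [NormedAddCommGroup E] [NormedSpace ℝ E] (a b : E) (v : ℝ × ℝ) :
    partials a b v = v.1 • a + v.2 • b := rfl

lemma hasDerivAt_inv_sqrt_two_pi_mul {τ : ℝ} (hτ : 0 < τ) :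
    HasDerivAt (fun τ => (√(2 * Real.pi * τ))⁻¹) (-(√(2 * Real.pi * τ))⁻¹ / (2 * τ)) τ := by
  have hsq : √(2 * Real.pi * τ) ^ 2 = 2 * Real.pi * τ := Real.sq_sqrt (by positivity)
  refine ((((hasDerivAt_id τ).const_mul (2 * Real.pi)).sqrt
    (by simp [Real.pi_ne_zero, hτ.ne'])).inv (by positivity)).congr_deriv ?_
  simp only [id_eq, hsq]
  field_simp

lemma hasFDerivAt_heatKernel_zero (x : ℝ) {τ : ℝ} (hτ : 0 < τ) :
    HasFDerivAt (fun q : ℝ × ℝ => heatKernel 0 q.1 q.2)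
      (partials (heatKernel 1 x τ) (heatKernel 2 x τ / 2)) (x, τ) := by
  have hx := hasFDerivAt_fst (𝕜 := ℝ) (p := (x, τ))
  have ht := hasFDerivAt_snd (𝕜 := ℝ) (p := (x, τ))
  have hinv := (hasDerivAt_inv hτ.ne').comp_hasFDerivAt (x, τ) ht
  have hnorm := (hasDerivAt_inv_sqrt_two_pi_mul hτ).comp_hasFDerivAt (x, τ) ht
  have hexp := ((hx.pow 2).neg.mul (hinv.const_mul 2⁻¹)).exp
  refine ((hnorm.mul hexp).congr_of_eventuallyEq (.of_forall fun q => ?_)).congr_fderiv ?_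
  · simp [heatKernel, div_eq_mul_inv, mul_comm]
  · refine ContinuousLinearMap.ext fun v => ?_
    simp only [heatKernel, partials_apply, Function.comp_apply, Pi.mul_apply, Pi.neg_apply,
      add_apply, neg_apply, smul_apply, ContinuousLinearMap.coe_fst', ContinuousLinearMap.coe_snd',
      smul_eq_mul, nsmul_eq_mul, Nat.cast_ofNat, Nat.cast_zero, Nat.add_one_sub_one, pow_one]
    field_simp
    ring

lemma hasFDerivAt_heatKernel (j : ℕ) (x : ℝ) {τ : ℝ} (hτ : 0 < τ) :
    HasFDerivAt (fun q : ℝ × ℝ => heatKernel j q.1 q.2)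
      (partials (heatKernel (j + 1) x τ) (heatKernel (j + 2) x τ / 2)) (x, τ) := by
  have hx := hasFDerivAt_fst (𝕜 := ℝ) (p := (x, τ))
  have hinv := (hasDerivAt_inv hτ.ne').comp_hasFDerivAt (x, τ)
    (hasFDerivAt_snd (𝕜 := ℝ) (p := (x, τ)))
  induction j using Nat.twoStepInduction with
  | zero => exact hasFDerivAt_heatKernel_zero x hτ
  | one =>
    simp only [heatKernel_one, div_eq_mul_inv]
    refine ((hx.mul (hasFDerivAt_heatKernel_zero x hτ)).neg.mul hinv).congr_fderiv ?_
    refine ContinuousLinearMap.ext fun v => ?_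
    simp only [heatKernel, partials_apply, Function.comp_apply, Pi.mul_apply, Pi.neg_apply,
      add_apply, neg_apply, smul_apply, ContinuousLinearMap.coe_fst', ContinuousLinearMap.coe_snd',
      smul_eq_mul, Nat.cast_zero, Nat.cast_one]
    field_simp
    ring
  | more j ih₀ ih₁ =>
    simp only [heatKernel_add_two j, div_eq_mul_inv]
    refine (((hx.mul ih₁).add (ih₀.const_mul (j + 1 : ℝ))).neg.mul hinv).congr_fderiv ?_
    refine ContinuousLinearMap.ext fun v => ?_
    simp only [heatKernel_add_two, partials_apply, Function.comp_apply, Pi.mul_apply, Pi.neg_apply,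
      Pi.add_apply, add_apply, neg_apply, smul_apply, ContinuousLinearMap.coe_fst',
      ContinuousLinearMap.coe_snd', smul_eq_mul, Nat.cast_add, Nat.cast_one]
    field_simp
    ring

lemma hasDerivAt_heatKernel (j : ℕ) (x : ℝ) {τ : ℝ} (hτ : 0 < τ) :
    HasDerivAt (heatKernel j · τ) (heatKernel (j + 1) x τ) x :=
  ((hasFDerivAt_heatKernel j x hτ).comp_hasDerivAt (f := fun x => (x, τ)) x
    ((hasDerivAt_id x).prodMk (hasDerivAt_const x τ))).congr_deriv (by simp)

lemma continuous_heatKernel (j : ℕ) {τ : ℝ} (hτ : 0 < τ) : Continuous (heatKernel j · τ) :=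
  continuous_iff_continuousAt.2 fun x => (hasDerivAt_heatKernel j x hτ).continuousAt

lemma abs_heatKernel_zero_le {m T : ℝ} (hm : 0 < m) (rate : ℝ) {τ : ℝ} (hτ : τ ∈ Icc m T) (x : ℝ) :
    |heatKernel 0 x τ| ≤
      (√(2 * Real.pi * m))⁻¹ * Real.exp (rate ^ 2 * T / 2) * Real.exp (-rate * |x|) := by
  have hτ₀ : 0 < τ := hm.trans_le hτ.1
  rw [abs_of_pos (heatKernel_zero_pos x hτ₀), heatKernel_zero,
    mul_assoc (_⁻¹) (Real.exp _), ← Real.exp_add]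
  have hT : 0 < T := hτ₀.trans_le hτ.2
  gcongr
  · exact hτ.1
  · calc -x ^ 2 / (2 * τ) ≤ -x ^ 2 / (2 * T) := by
          rw [neg_div, neg_div, neg_le_neg_iff]
          gcongr
          exact hτ.2
      _ = rate ^ 2 * T / 2 + -rate * |x| - (|x| - rate * T) ^ 2 / (2 * T) := by
          rw [← sq_abs x]; field_simp; ring
      _ ≤ rate ^ 2 * T / 2 + -rate * |x| := sub_le_self _ (by positivity)

lemma abs_mul_le_mul_exp {C rate x y : ℝ} (h : |y| ≤ C * Real.exp (-(rate + 1) * |x|)) :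
    |x * y| ≤ C * Real.exp (-rate * |x|) := by
  rw [abs_mul, show -rate * |x| = |x| + -(rate + 1) * |x| by ring, Real.exp_add, mul_left_comm]
  have hexp : |x| ≤ Real.exp |x| := (Real.add_one_le_exp _).trans' (by linarith)
  exact mul_le_mul hexp h (abs_nonneg _) (Real.exp_pos _).le

lemma exists_abs_heatKernel_le {m : ℝ} (hm : 0 < m) (T : ℝ) (j : ℕ) (rate : ℝ) :
    ∃ C, ∀ τ ∈ Icc m T, ∀ x, |heatKernel j x τ| ≤ C * Real.exp (-rate * |x|) := by
  have div_bound {C y e τ : ℝ} (hτ : τ ∈ Icc m T) (h : |y| ≤ C * e) : |-y / τ| ≤ C / m * e := by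
    rw [abs_div, abs_neg, abs_of_pos (hm.trans_le hτ.1), div_mul_eq_mul_div]
    exact div_le_div₀ ((abs_nonneg _).trans h) h hm hτ.1
  induction j using Nat.twoStepInduction generalizing rate with
  | zero => exact ⟨_, fun τ hτ x => abs_heatKernel_zero_le hm rate hτ x⟩
  | one =>
    simp only [heatKernel_one]
    exact ⟨_, fun τ hτ x =>
      div_bound hτ (abs_mul_le_mul_exp (abs_heatKernel_zero_le hm (rate + 1) hτ x))⟩
  | more j ih₀ ih₁ =>
    obtain ⟨C, hC⟩ := ih₀ rate
    obtain ⟨D, hD⟩ := ih₁ (rate + 1)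
    refine ⟨(D + (j + 1) * C) / m, fun τ hτ x => ?_⟩
    rw [heatKernel_add_two]
    refine div_bound hτ ((abs_add_le _ _).trans ?_)
    rw [add_mul D, mul_assoc, abs_mul (_ + 1 : ℝ), abs_of_pos (by positivity : (0 : ℝ) < j + 1)]
    exact add_le_add (abs_mul_le_mul_exp (hD τ hτ x))
      (mul_le_mul_of_nonneg_left (hC τ hτ x) (by positivity))

lemma exists_abs_heatKernel_sub_le {m : ℝ} (hm : 0 < m) (T R : ℝ) (j : ℕ) :
    ∃ C, ∀ τ ∈ Icc m T, ∀ p, |p| ≤ R → ∀ t,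
      |heatKernel j (p - t) τ| ≤ C * Real.exp (-|t|) := by
  obtain ⟨C, hC⟩ := exists_abs_heatKernel_le hm T j 1
  refine ⟨C * Real.exp R, fun τ hτ p hp t => (hC τ hτ (p - t)).trans ?_⟩
  have hC₀ : 0 ≤ C := by simpa using (abs_nonneg _).trans (hC τ hτ 0)
  rw [mul_assoc, ← Real.exp_add]
  gcongr
  have := abs_sub_abs_le_abs_sub t p
  rw [abs_sub_comm] at this
  linarith

/-! ### Heat extensions of tempered paths -/

variable {E : Type*} [NormedAddCommGroup E] [NormedSpace ℝ E]

/-- A path that is integrable against the weight `exp (-|t|)`, so that it can be convolved with all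
the heat kernels. -/
def Tempered (w : ℝ → E) : Prop := Integrable fun t => Real.exp (-|t|) • w t

/-- The `j`-th space derivative of the heat extension of the path `w`. -/
noncomputable def jet (w : ℝ → E) (j : ℕ) (p τ : ℝ) : E := ∫ t, heatKernel j (p - t) τ • w t

namespace Tempered

variable {w v : ℝ → E}

protected lemma aestronglyMeasurable (h : Tempered w) : AEStronglyMeasurable w := by
  have hexp : Continuous fun t : ℝ => Real.exp |t| := by fun_prop
  refine (hexp.aestronglyMeasurable.smul h.1).congr (.of_forall fun t => ?_)
  rw [Pi.smul_apply', smul_smul, ← Real.exp_add, add_neg_cancel, Real.exp_zero, one_smul]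

protected lemma add (hw : Tempered w) (hv : Tempered v) : Tempered fun t => w t + v t :=
  (Integrable.add hw hv).congr (.of_forall fun _ => (smul_add _ _ _).symm)

protected lemma sum {ι : Type*} {s : Finset ι} {w : ι → ℝ → E} (h : ∀ i ∈ s, Tempered (w i)) :
    Tempered fun t => ∑ i ∈ s, w i t := by
  simpa only [Tempered, Finset.smul_sum] using integrable_finsetSum s h

protected lemma smul_const {r : ℝ → ℝ} (h : Tempered r) (g : E) : Tempered fun t => r t • g := by
  simpa only [Tempered, smul_assoc] using Integrable.smul_const h g

protected lemma clm_comp {F : Type*} [NormedAddCommGroup F] [NormedSpace ℝ F] (h : Tempered w)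
    (L : E →L[ℝ] F) : Tempered fun t => L (w t) := by
  simpa only [Tempered, map_smul] using L.integrable_comp h

lemma integrable_heatKernel_smul (h : Tempered w) (j : ℕ) (p : ℝ) {τ : ℝ} (hτ : 0 < τ) :
    Integrable fun t => heatKernel j (p - t) τ • w t := by
  obtain ⟨C, hC⟩ := exists_abs_heatKernel_sub_le hτ τ |p| j
  have hK : Continuous fun t => heatKernel j (p - t) τ :=
    (continuous_heatKernel j hτ).comp (continuous_const.sub continuous_id)
  refine (h.norm.const_mul C).mono' (hK.aestronglyMeasurable.smul h.aestronglyMeasurable)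
    (.of_forall fun t => ?_)
  rw [norm_smul, norm_smul, Real.norm_of_nonneg (Real.exp_pos _).le, ← mul_assoc]
  gcongr
  exact hC τ ⟨le_rfl, le_rfl⟩ p le_rfl t

end Tempered

section Linearity

variable {w v : ℝ → E} {τ : ℝ}

lemma jet_add (hw : Tempered w) (hv : Tempered v) (j : ℕ) (p : ℝ) (hτ : 0 < τ) :
    jet (fun t => w t + v t) j p τ = jet w j p τ + jet v j p τ := by
  simp only [jet, smul_add]
  exact integral_add (hw.integrable_heatKernel_smul j p hτ) (hv.integrable_heatKernel_smul j p hτ)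

lemma jet_sum {ι : Type*} {s : Finset ι} {w : ι → ℝ → E} (h : ∀ i ∈ s, Tempered (w i)) (j : ℕ)
    (p : ℝ) (hτ : 0 < τ) : jet (fun t => ∑ i ∈ s, w i t) j p τ = ∑ i ∈ s, jet (w i) j p τ := by
  simp only [jet, Finset.smul_sum]
  exact integral_finsetSum s fun i hi => (h i hi).integrable_heatKernel_smul j p hτ

lemma jet_smul_const [CompleteSpace E] (r : ℝ → ℝ) (g : E) (j : ℕ) (p τ : ℝ) :
    jet (fun t => r t • g) j p τ = jet r j p τ • g := by
  simp only [jet, ← smul_assoc]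
  exact integral_smul_const _ g

lemma clm_jet [CompleteSpace E] {F : Type*} [NormedAddCommGroup F] [NormedSpace ℝ F]
    [CompleteSpace F] (L : E →L[ℝ] F) (hw : Tempered w) (j : ℕ) (p : ℝ) (hτ : 0 < τ) :
    L (jet w j p τ) = jet (fun t => L (w t)) j p τ := by
  simp only [jet, ← map_smul]
  exact (L.integral_comp_comm (hw.integrable_heatKernel_smul j p hτ)).symm

end Linearity

lemma norm_partials_le (a b : E) : ‖partials a b‖ ≤ ‖a‖ + ‖b‖ := by
  refine ContinuousLinearMap.opNorm_le_bound _ (by positivity) fun v => ?_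
  rw [partials_apply, add_mul, mul_comm ‖a‖, mul_comm ‖b‖]
  refine (norm_add_le _ _).trans ?_
  rw [norm_smul, norm_smul]
  gcongr
  exacts [norm_fst_le v, norm_snd_le v]

lemma integrable_partials {a b : ℝ → E} (ha : Integrable a) (hb : Integrable b) :
    Integrable fun t => partials (a t) (b t) :=
  ((ContinuousLinearMap.smulRightL ℝ _ E (.fst ℝ ℝ ℝ)).integrable_comp ha).add
    ((ContinuousLinearMap.smulRightL ℝ _ E (.snd ℝ ℝ ℝ)).integrable_comp hb)

lemma integral_partials {a b : ℝ → E} (ha : Integrable a) (hb : Integrable b) :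
    ∫ t, partials (a t) (b t) = partials (∫ t, a t) (∫ t, b t) := by
  refine ContinuousLinearMap.ext fun v => ?_
  rw [ContinuousLinearMap.integral_apply (integrable_partials ha hb)]
  simp only [partials_apply]
  exact (integral_add (ha.smul v.1) (hb.smul v.2)).trans
    (congrArg₂ (· + ·) (integral_smul _ _) (integral_smul _ _))

section Derivatives

variable {w : ℝ → E} {τ : ℝ}

lemma hasFDerivAt_heatKernel_sub_smul (j : ℕ) (t : ℝ) (g : E) {q : ℝ × ℝ} (hq : 0 < q.2) :
    HasFDerivAt (fun q : ℝ × ℝ => heatKernel j (q.1 - t) q.2 • g)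
      (partials (heatKernel (j + 1) (q.1 - t) q.2 • g)
        ((2⁻¹ : ℝ) • heatKernel (j + 2) (q.1 - t) q.2 • g)) q := by
  have hshift : HasFDerivAt (fun q : ℝ × ℝ => (q.1 - t, q.2)) (.id ℝ (ℝ × ℝ)) q :=
    ((hasFDerivAt_id q).sub_const (t, 0)).congr_of_eventuallyEq
      (.of_forall fun q => by ext <;> simp)
  refine (((hasFDerivAt_heatKernel j (q.1 - t) hq).comp q hshift).smul_const g).congr_fderiv ?_
  refine ContinuousLinearMap.ext fun v => ?_
  simp only [ContinuousLinearMap.comp_id, ContinuousLinearMap.smulRight_apply, partials_apply,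
    smul_smul, smul_eq_mul, add_smul, div_eq_inv_mul]

lemma hasFDerivAt_jet (hw : Tempered w) (j : ℕ) (p : ℝ) (hτ : 0 < τ) :
    HasFDerivAt (fun q : ℝ × ℝ => jet w j q.1 q.2)
      (partials (jet w (j + 1) p τ) ((2⁻¹ : ℝ) • jet w (j + 2) p τ)) (p, τ) := by
  have hbox : Icc (p - 1) (p + 1) ×ˢ Icc (τ / 2) (τ + 1) ∈ 𝓝 (p, τ) :=
    prod_mem_nhds (Icc_mem_nhds (by linarith) (by linarith))
      (Icc_mem_nhds (by linarith) (by linarith))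
  have hpos {q : ℝ × ℝ} (hq : q ∈ Icc (p - 1) (p + 1) ×ˢ Icc (τ / 2) (τ + 1)) : 0 < q.2 :=
    (half_pos hτ).trans_le hq.2.1
  obtain ⟨C, hC⟩ := exists_abs_heatKernel_sub_le (half_pos hτ) (τ + 1) (|p| + 1) (j + 1)
  obtain ⟨D, hD⟩ := exists_abs_heatKernel_sub_le (half_pos hτ) (τ + 1) (|p| + 1) (j + 2)
  have hK₁ := hw.integrable_heatKernel_smul (j + 1) p hτ
  have hK₂ := (hw.integrable_heatKernel_smul (j + 2) p hτ).smul (2⁻¹ : ℝ)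
  refine (hasFDerivAt_integral_of_dominated_of_fderiv_le
    (F' := fun q t => partials (heatKernel (j + 1) (q.1 - t) q.2 • w t)
      ((2⁻¹ : ℝ) • heatKernel (j + 2) (q.1 - t) q.2 • w t))
    (bound := fun t => (C + 2⁻¹ * D) * ‖Real.exp (-|t|) • w t‖) hbox ?_
    (hw.integrable_heatKernel_smul j p hτ) (integrable_partials hK₁ hK₂).aestronglyMeasurable
    (.of_forall fun t q hq => ?_) (hw.norm.const_mul _)
    (.of_forall fun t q hq => hasFDerivAt_heatKernel_sub_smul j t (w t) (hpos hq))).congr_fderiv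
      ((integral_partials hK₁ hK₂).trans (congrArg _ (integral_smul _ _)))
  · filter_upwards [hbox] with q hq
    exact (hw.integrable_heatKernel_smul j q.1 (hpos hq)).aestronglyMeasurable
  · have hq₁ : |q.1| ≤ |p| + 1 := by
      have hdist : |q.1 - p| ≤ 1 := abs_sub_le_iff.2 ⟨by linarith [hq.1.2], by linarith [hq.1.1]⟩
      linarith [abs_sub_abs_le_abs_sub q.1 p]
    calc _ ≤ |heatKernel (j + 1) (q.1 - t) q.2| * ‖w t‖
          + 2⁻¹ * (|heatKernel (j + 2) (q.1 - t) q.2| * ‖w t‖) := by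
          refine (norm_partials_le _ _).trans_eq ?_
          simp only [norm_smul, Real.norm_eq_abs, abs_of_pos (by norm_num : (0 : ℝ) < 2⁻¹)]
      _ ≤ C * Real.exp (-|t|) * ‖w t‖ + 2⁻¹ * (D * Real.exp (-|t|) * ‖w t‖) := by
          gcongr
          exacts [hC _ hq.2 _ hq₁ t, hD _ hq.2 _ hq₁ t]
      _ = (C + 2⁻¹ * D) * ‖Real.exp (-|t|) • w t‖ := by
          rw [norm_smul, Real.norm_of_nonneg (Real.exp_pos _).le]
          ring

lemma hasDerivAt_jet (hw : Tempered w) (j : ℕ) (p : ℝ) (hτ : 0 < τ) :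
    HasDerivAt (jet w j · τ) (jet w (j + 1) p τ) p :=
  ((hasFDerivAt_jet hw j p hτ).comp_hasDerivAt (f := fun p => (p, τ)) p
    ((hasDerivAt_id p).prodMk (hasDerivAt_const p τ))).congr_deriv (by simp)

lemma continuousOn_jet (hw : Tempered w) (j : ℕ) :
    ContinuousOn (fun q : ℝ × ℝ => jet w j q.1 q.2) {q | 0 < q.2} :=
  fun q hq => (hasFDerivAt_jet hw j q.1 hq).continuousAt.continuousWithinAt

lemma iteratedDeriv_jet (hw : Tempered w) (hτ : 0 < τ) (n j : ℕ) :
    iteratedDeriv n (jet w j · τ) = (jet w (j + n) · τ) := by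
  induction n with
  | zero => simp
  | succ n ih =>
    rw [iteratedDeriv_succ, ih]
    exact funext fun p => (hasDerivAt_jet hw (j + n) p hτ).deriv

end Derivatives

lemma heatExtension_eq_jet (w₁ w₂ : ℝ≥0 → ℝ) (p : ℝ) {τ : ℝ} (hτ : 0 < τ) :
    heatExtension w₁ w₂ p τ = jet (extendedPath w₁ w₂) 0 p τ := by
  have hv : τ.toNNReal ≠ 0 := (Real.toNNReal_pos.2 hτ).ne'
  rw [heatExtension, integral_gaussianReal_eq_integral_smul hv, ← integral_sub_left_eq_self _ _ p]
  simp only [jet, sub_sub_cancel, heatKernel_zero_eq_gaussianPDFReal _ hτ]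

lemma heatKernel_zero_sub (p t : ℝ) {τ : ℝ} (hτ : 0 < τ) :
    heatKernel 0 (p - t) τ =
      Real.exp (-p ^ 2 / (2 * τ)) * (heatKernel 0 t τ * Real.exp (p / τ * t)) := by
  rw [heatKernel_zero, heatKernel_zero, mul_assoc (_⁻¹), mul_left_comm, ← Real.exp_add,
    ← Real.exp_add]
  congr 2
  field_simp
  ring

/-- The heat extension of a nonnegative path is a Gaussian factor times the moment generating
function of a measure. -/
lemma analyticAt_jet_zero_of_nonneg {w : ℝ → ℝ} (hw : Tempered w) (hw₀ : 0 ≤ w) {τ : ℝ}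
    (hτ : 0 < τ) (p : ℝ) : AnalyticAt ℝ (jet w 0 · τ) p := by
  let μ := volume.withDensity fun t => ENNReal.ofReal (heatKernel 0 t τ * w t)
  have hdens₀ (t) : 0 ≤ heatKernel 0 t τ * w t := mul_nonneg (heatKernel_zero_pos t hτ).le (hw₀ t)
  have hdens : AEMeasurable fun t => ENNReal.ofReal (heatKernel 0 t τ * w t) :=
    ((continuous_heatKernel 0 hτ).aemeasurable.mul
      hw.aestronglyMeasurable.aemeasurable).ennreal_ofReal
  have hfin : ∀ᵐ t : ℝ, ENNReal.ofReal (heatKernel 0 t τ * w t) < ⊤ :=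
    .of_forall fun _ => ENNReal.ofReal_lt_top
  have hset : integrableExpSet id μ = univ := by
    refine eq_univ_of_forall fun s => ?_
    have hint := (hw.integrable_heatKernel_smul 0 (s * τ) hτ).const_mul
      (Real.exp (-(s * τ) ^ 2 / (2 * τ)))⁻¹
    refine (integrable_withDensity_iff_integrable_smul₀' hdens hfin).2
      (hint.congr (.of_forall fun t => ?_))
    simp only [ENNReal.toReal_ofReal (hdens₀ t), heatKernel_zero_sub (s * τ) t hτ, smul_eq_mul,
      mul_assoc, mul_div_cancel_right₀ s hτ.ne', id, inv_mul_cancel_left₀ (Real.exp_ne_zero _)]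
    ring
  have hmgf : (jet w 0 · τ) = fun p => Real.exp (-p ^ 2 / (2 * τ)) * mgf id μ (p / τ) := by
    funext p
    rw [mgf, integral_withDensity_eq_integral_toReal_smul₀ hdens hfin, jet, ← integral_const_mul]
    refine integral_congr_ae (.of_forall fun t => ?_)
    simp only [ENNReal.toReal_ofReal (hdens₀ t), heatKernel_zero_sub p t hτ, smul_eq_mul, id]
    ring
  rw [hmgf]
  have hcomp : AnalyticAt ℝ (fun p => mgf id μ (p / τ)) p :=
    (analyticAt_mgf (by simp [hset])).comp_of_eq (analyticAt_id.div_const) rfl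
  fun_prop (disch := positivity)

protected lemma Tempered.pos_part {w : ℝ → ℝ} (hw : Tempered w) :
    Tempered fun t => max (w t) 0 := by
  refine (Integrable.pos_part hw).congr (.of_forall fun t => ?_)
  simp [mul_max_of_nonneg _ _ (Real.exp_pos _).le]

lemma analyticAt_jet_zero_real {w : ℝ → ℝ} (hw : Tempered w) {τ : ℝ} (hτ : 0 < τ) (p : ℝ) :
    AnalyticAt ℝ (jet w 0 · τ) p := by
  have hneg : Tempered fun t => max (-w t) 0 := (hw.clm_comp (-.id ℝ ℝ)).pos_part
  have hsplit : (jet w 0 · τ) =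
      fun p => jet (fun t => max (w t) 0) 0 p τ - jet (fun t => max (-w t) 0) 0 p τ := by
    funext p
    rw [eq_sub_iff_add_eq, ← jet_add hw hneg 0 p hτ]
    congr 1
    funext t
    rw [← max_add_add_left, add_neg_cancel, add_zero, max_comm]
  rw [hsplit]
  exact (analyticAt_jet_zero_of_nonneg hw.pos_part (fun _ => le_max_right _ _) hτ p).sub
    (analyticAt_jet_zero_of_nonneg hneg (fun _ => le_max_right _ _) hτ p)

lemma analyticAt_jet_zero {w : ℝ → ℂ} (hw : Tempered w) {τ : ℝ} (hτ : 0 < τ) (p : ℝ) :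
    AnalyticAt ℝ (jet w 0 · τ) p := by
  have hcoord : (jet w 0 · τ) = fun p => Complex.equivRealProdCLM.symm
      (jet (fun t => (w t).re) 0 p τ, jet (fun t => (w t).im) 0 p τ) := by
    funext p
    exact Complex.ext (clm_jet Complex.reCLM hw 0 p hτ) (clm_jet Complex.imCLM hw 0 p hτ)
  rw [hcoord]
  exact (Complex.equivRealProdCLM.symm.analyticAt _).comp
    ((analyticAt_jet_zero_real (hw.clm_comp Complex.reCLM) hτ p).prod
      (analyticAt_jet_zero_real (hw.clm_comp Complex.imCLM) hτ p))

/-! ### Parabolic expansion of the heat extension -/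

variable {E : Type*} [NormedAddCommGroup E] [NormedSpace ℝ E]

lemma isBigO_pow_succ_of_hasDerivAt {X : Type*} {l : Filter X} {F F' : ℝ → X → E} {n : ℕ}
    (hF₀ : ∀ P, F 0 P = 0)
    (hF : ∀ᶠ q in 𝓝 0 ×ˢ l, HasDerivAt (F · q.2) (F' q.1 q.2) q.1)
    (hF' : (fun q => F' q.1 q.2) =O[𝓝 0 ×ˢ l] fun q => q.1 ^ n) :
    (fun q => F q.1 q.2) =O[𝓝 0 ×ˢ l] fun q => q.1 ^ (n + 1) := by
  obtain ⟨C, hC₀, hC⟩ := hF'.exists_nonneg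
  obtain ⟨A, hA, B, hB, hAB⟩ := eventually_prod_iff.1 (hF.and hC.bound)
  obtain ⟨r, hr, hrA⟩ := Metric.eventually_nhds_iff_ball.1 hA
  refine .of_bound C ?_
  filter_upwards [prod_mem_prod (Metric.ball_mem_nhds 0 hr) hB] with ⟨ε, P⟩ ⟨hε, hP⟩
  have hsegment {x : ℝ} (hx : x ∈ uIcc 0 ε) : |x| ≤ |ε| := by
    simpa using abs_sub_left_of_mem_uIcc hx
  have hnear {x : ℝ} (hx : x ∈ uIcc 0 ε) := hAB (hrA x (mem_ball_zero_iff.2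
    ((hsegment hx).trans_lt (mem_ball_zero_iff.1 hε)))) hP
  have hmean := (convex_uIcc 0 ε).norm_image_sub_le_of_norm_hasDerivWithin_le
    (f := (F · P)) (f' := (F' · P)) (C := C * |ε| ^ n)
    (fun x hx => (hnear hx).1.hasDerivWithinAt) (fun x hx => ?_)
    left_mem_uIcc right_mem_uIcc
  · simpa [hF₀, pow_succ, mul_assoc] using hmean
  · refine (hnear hx).2.trans ?_
    rw [norm_pow, Real.norm_eq_abs]
    exact mul_le_mul_of_nonneg_left (pow_le_pow_left₀ (abs_nonneg x) (hsegment hx) n) hC₀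

/-- The value at `P` of the `k`-th probabilists' Hermite polynomial, divided by `k!`: the
coefficient of `x ^ k` in `exp (P x - x ^ 2 / 2)`. -/
noncomputable def hermiteCoeff : ℕ → ℝ → ℝ
  | 0, _ => 1
  | 1, P => P
  | k + 2, P => (P * hermiteCoeff (k + 1) P - hermiteCoeff k P) / (k + 2)

lemma hermiteCoeff_two (P : ℝ) : hermiteCoeff 2 P = (P ^ 2 - 1) / 2 := by
  simp [hermiteCoeff, pow_two]

lemma hermiteCoeff_three (P : ℝ) : hermiteCoeff 3 P = (P ^ 3 - 3 * P) / 6 := by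
  simp only [hermiteCoeff]
  push_cast
  ring

lemma continuous_hermiteCoeff (k : ℕ) : Continuous (hermiteCoeff k) := by
  induction k using Nat.twoStepInduction with
  | zero => exact continuous_const
  | one => exact continuous_id
  | more k ih₀ ih₁ => exact ((continuous_id.mul ih₁).sub ih₀).div_const _

lemma hasDerivAt_hermiteCoeff_succ (k : ℕ) (P : ℝ) :
    HasDerivAt (hermiteCoeff (k + 1)) (hermiteCoeff k P) P := by
  induction k using Nat.twoStepInduction with
  | zero => exact hasDerivAt_id P
  | one =>
    rw [show hermiteCoeff (1 + 1) = fun P => (P ^ 2 - 1) / 2 from funext hermiteCoeff_two]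
    exact (((hasDerivAt_pow 2 P).sub_const 1).div_const 2).congr_deriv (by simp [hermiteCoeff])
  | more k ih₀ ih₁ =>
    refine ((((hasDerivAt_id P).mul ih₁).sub ih₀).div_const ((k + 1 : ℕ) + 2 : ℝ)).congr_deriv ?_
    simp only [hermiteCoeff, id_eq]
    push_cast
    field_simp
    ring

/-- The sum of the first `n` terms of the Taylor expansion, in powers of `ε`, of a solution of the
heat equation at `(p + ε P, τ - ε ^ 2)`, in terms of its space derivatives `J k` at `(p, τ)`. -/
noncomputable def parabolicSum (J : ℕ → E) (n : ℕ) (ε P : ℝ) : E :=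
  ∑ k ∈ Finset.range n, (ε ^ k * hermiteCoeff k P) • J k

lemma hasDerivAt_parabolicSum (J : ℕ → E) (n : ℕ) (ε P : ℝ) :
    HasDerivAt (parabolicSum J (n + 1) · P)
      (P • parabolicSum (fun k => J (1 + k)) n ε P -
        ε • parabolicSum (fun k => J (2 + k)) (n - 1) ε P) ε := by
  induction n using Nat.twoStepInduction with
  | zero => simpa [parabolicSum, hermiteCoeff] using hasDerivAt_const ε (J 0)
  | one =>
    simpa [parabolicSum, Finset.sum_range_succ, hermiteCoeff] using
      (((hasDerivAt_id ε).mul_const P).smul_const (J 1)).const_add (J 0)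
  | more n _ ih =>
    have hterm : HasDerivAt (fun ε : ℝ => (ε ^ (n + 2) * hermiteCoeff (n + 2) P) • J (n + 2))
        ((ε ^ (n + 1) * (P * hermiteCoeff (n + 1) P - hermiteCoeff n P)) • J (n + 2)) ε := by
      refine (((hasDerivAt_pow (n + 2) ε).mul_const _).smul_const _).congr_deriv ?_
      rw [hermiteCoeff]
      push_cast
      congr 1
      field_simp
    simp only [parabolicSum, Finset.sum_range_succ _ (n + 2), Nat.add_sub_cancel,
      show n + 2 - 1 = n + 1 from rfl] at ih ⊢
    refine (ih.add hterm).congr_deriv ?_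
    simp only [Finset.sum_range_succ _ (n + 1), Finset.sum_range_succ _ n,
      show 1 + (n + 1) = n + 2 by ring, show 2 + n = n + 2 by ring]
    module

lemma hasDerivAt_jet_parabolic {w : ℝ → E} (hw : Tempered w) (j : ℕ) (p P : ℝ) {τ ε : ℝ}
    (hε : ε ^ 2 < τ) :
    HasDerivAt (fun ε => jet w j (p + ε * P) (τ - ε ^ 2))
      (P • jet w (j + 1) (p + ε * P) (τ - ε ^ 2) -
        ε • jet w (j + 2) (p + ε * P) (τ - ε ^ 2)) ε := by
  have hpath : HasDerivAt (fun ε : ℝ => (p + ε * P, τ - ε ^ 2)) (P, -(2 * ε)) ε :=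
    (((hasDerivAt_id ε).mul_const P).const_add p |>.congr_deriv (one_mul P)).prodMk
      (((hasDerivAt_id ε).pow 2).const_sub τ |>.congr_deriv (by simp))
  refine ((hasFDerivAt_jet hw j (p + ε * P) (sub_pos.2 hε)).comp_hasDerivAt ε hpath).congr_deriv ?_
  simp only [partials_apply, smul_smul, show -(2 * ε) * 2⁻¹ = -ε by ring, neg_smul]
  exact (sub_eq_add_neg _ _).symm

/-- The error of the Taylor expansion of order `n` of the `j`-th space derivative of the heat
extension of `w`, from `(p, τ)` to `(p + ε P, τ - ε ^ 2)`. -/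
noncomputable def parabolicRemainder (w : ℝ → E) (p τ : ℝ) (n j : ℕ) (ε P : ℝ) : E :=
  jet w j (p + ε * P) (τ - ε ^ 2) - parabolicSum (fun k => jet w (j + k) p τ) n ε P

section Taylor

variable {w : ℝ → E} {τ : ℝ}

lemma parabolicRemainder_zero_step (w : ℝ → E) (p τ : ℝ) (n j : ℕ) (P : ℝ) :
    parabolicRemainder w p τ (n + 1) j 0 P = 0 := by
  simp [parabolicRemainder, parabolicSum, Finset.sum_range_succ', hermiteCoeff]

lemma hasDerivAt_parabolicRemainder (hw : Tempered w) (n j : ℕ) (p P : ℝ) {ε : ℝ} (hε : ε ^ 2 < τ) :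
    HasDerivAt (parabolicRemainder w p τ (n + 1) j · P)
      (P • parabolicRemainder w p τ n (j + 1) ε P -
        ε • parabolicRemainder w p τ (n - 1) (j + 2) ε P) ε := by
  refine ((hasDerivAt_jet_parabolic hw j p P hε).sub
    (hasDerivAt_parabolicSum _ n ε P)).congr_deriv ?_
  simp only [parabolicRemainder, add_assoc, smul_sub]
  abel

lemma parabolicRemainder_zero_isBigO (hw : Tempered w) (hτ : 0 < τ) (p P₀ : ℝ) (j : ℕ) :
    (fun q : ℝ × ℝ => parabolicRemainder w p τ 0 j q.1 q.2) =O[𝓝 0 ×ˢ 𝓝 P₀]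
      fun _ => (1 : ℝ) := by
  have hjet : ContinuousAt (fun q : ℝ × ℝ => jet w j q.1 q.2) (p + 0 * P₀, τ - 0 ^ 2) :=
    (hasFDerivAt_jet hw j _ (by simpa)).continuousAt
  simpa [parabolicRemainder, parabolicSum, nhds_prod_eq] using
    (hjet.comp (x := (0, P₀)) (f := fun q : ℝ × ℝ => (p + q.1 * q.2, τ - q.1 ^ 2))
      (by fun_prop)).isBigO_one ℝ

lemma parabolicRemainder_isBigO (hw : Tempered w) (hτ : 0 < τ) (p P₀ : ℝ) (n j : ℕ) :
    (fun q : ℝ × ℝ => parabolicRemainder w p τ n j q.1 q.2) =O[𝓝 0 ×ˢ 𝓝 P₀]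
      fun q => q.1 ^ n := by
  have hsmall : ∀ᶠ q : ℝ × ℝ in 𝓝 0 ×ˢ 𝓝 P₀, q.1 ^ 2 < τ := by
    rw [← nhds_prod_eq]
    exact (by fun_prop : ContinuousAt (fun q : ℝ × ℝ => q.1 ^ 2) (0, P₀)).eventually_lt
      continuousAt_const (by simpa)
  have hP : (fun q : ℝ × ℝ => q.2) =O[𝓝 0 ×ˢ 𝓝 P₀] fun _ => (1 : ℝ) :=
    tendsto_snd.isBigO_one ℝ
  have step {n j : ℕ}
      (h₁ : (fun q : ℝ × ℝ => parabolicRemainder w p τ n (j + 1) q.1 q.2) =O[𝓝 0 ×ˢ 𝓝 P₀]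
        fun q => q.1 ^ n)
      (h₂ : (fun q : ℝ × ℝ => q.1 • parabolicRemainder w p τ (n - 1) (j + 2) q.1 q.2)
        =O[𝓝 0 ×ˢ 𝓝 P₀] fun q => q.1 ^ n) :
      (fun q : ℝ × ℝ => parabolicRemainder w p τ (n + 1) j q.1 q.2) =O[𝓝 0 ×ˢ 𝓝 P₀]
        fun q => q.1 ^ (n + 1) :=
    isBigO_pow_succ_of_hasDerivAt
      (F' := fun ε P => P • parabolicRemainder w p τ n (j + 1) ε P -
        ε • parabolicRemainder w p τ (n - 1) (j + 2) ε P)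
      (parabolicRemainder_zero_step w p τ n j)
      (hsmall.mono fun q hq => hasDerivAt_parabolicRemainder hw n j p q.2 hq)
      ((by simpa using hP.smul h₁ : _ =O[_] _).sub h₂)
  induction n using Nat.twoStepInduction generalizing j with
  | zero => simpa using parabolicRemainder_zero_isBigO hw hτ p P₀ j
  | one =>
    have hε : (fun q : ℝ × ℝ => q.1) =O[𝓝 0 ×ˢ 𝓝 P₀] fun _ => (1 : ℝ) := tendsto_fst.isBigO_one ℝ
    refine step (by simpa using parabolicRemainder_zero_isBigO hw hτ p P₀ (j + 1)) ?_
    simpa using hε.smul (parabolicRemainder_zero_isBigO hw hτ p P₀ (j + 2))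
  | more n ih₀ ih₁ =>
    refine step (ih₁ (j + 1)) ?_
    simpa [pow_succ'] using (Asymptotics.isBigO_refl (fun q : ℝ × ℝ => q.1) _).smul (ih₀ (j + 2))

theorem tendsto_parabolicRemainder (hw : Tempered w) (hτ : 0 < τ) (p P₀ : ℝ) (n j : ℕ) :
    Tendsto (fun q : ℝ × ℝ => (q.1 ^ n)⁻¹ • parabolicRemainder w p τ n j q.1 q.2)
      (𝓝[≠] 0 ×ˢ 𝓝 P₀) (𝓝 (hermiteCoeff n P₀ • jet w (j + n) p τ)) := by
  have hmono : 𝓝[≠] (0 : ℝ) ×ˢ 𝓝 P₀ ≤ 𝓝 0 ×ˢ 𝓝 P₀ := prod_mono nhdsWithin_le_nhds le_rfl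
  have hne : ∀ᶠ q : ℝ × ℝ in 𝓝[≠] 0 ×ˢ 𝓝 P₀, q.1 ≠ 0 := eventually_mem_nhdsWithin.prod_inl _
  have hmain : Tendsto (fun q : ℝ × ℝ => hermiteCoeff n q.2 • jet w (j + n) p τ)
      (𝓝[≠] 0 ×ˢ 𝓝 P₀) (𝓝 (hermiteCoeff n P₀ • jet w (j + n) p τ)) :=
    (((continuous_hermiteCoeff n).tendsto P₀).comp tendsto_snd).smul_const _
  have herror : Tendsto (fun q : ℝ × ℝ => (q.1 ^ n)⁻¹ • parabolicRemainder w p τ (n + 1) j q.1 q.2)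
      (𝓝[≠] 0 ×ˢ 𝓝 P₀) (𝓝 0) := by
    have hbound := (Asymptotics.isBigO_refl (fun q : ℝ × ℝ => (q.1 ^ n)⁻¹) _).smul
      ((parabolicRemainder_isBigO hw hτ p P₀ (n + 1) j).mono hmono)
    refine hbound.trans_tendsto (((tendsto_nhdsWithin_of_tendsto_nhds tendsto_id).comp
      tendsto_fst).congr' ?_)
    filter_upwards [hne] with q hq
    rw [smul_eq_mul, pow_succ, inv_mul_cancel_left₀ (pow_ne_zero n hq)]
    rfl
  refine (add_zero (hermiteCoeff n P₀ • jet w (j + n) p τ) ▸ hmain.add herror).congr' ?_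
  filter_upwards [hne] with q hq
  have hsplit : parabolicRemainder w p τ n j q.1 q.2 =
      (q.1 ^ n * hermiteCoeff n q.2) • jet w (j + n) p τ +
        parabolicRemainder w p τ (n + 1) j q.1 q.2 := by
    simp only [parabolicRemainder, parabolicSum, Finset.sum_range_succ]
    abel
  rw [hsplit, smul_add, smul_smul, inv_mul_cancel_left₀ (pow_ne_zero n hq)]

end Taylor

/-! ### Loops and double points -/

/-- The restriction of `γ` to `[a, b]`, as a `Curve` (a junk value unless `a < b` and `γ` is
continuous on `[a, b]`). -/
noncomputable def arc (γ : ℝ → ℂ) (a b : ℝ) : Curve :=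
  open Classical in
  if h : a < b ∧ ContinuousOn γ (Icc a b) then ⟨a, b, h.1, ⟨_, h.2.domRestrict⟩⟩
  else ⟨0, 1, one_pos, 0⟩

section Arc

variable {γ : ℝ → ℂ} {a b : ℝ}

lemma arc_left (h : a < b) (hγ : ContinuousOn γ (Icc a b)) : (arc γ a b).left = a := by
  simp [arc, h, hγ]

lemma arc_right (h : a < b) (hγ : ContinuousOn γ (Icc a b)) : (arc γ a b).right = b := by
  simp [arc, h, hγ]

lemma arc_toFun (h : a < b) (hγ : ContinuousOn γ (Icc a b)) (x) : (arc γ a b).toFun x = γ x := by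
  have hab := And.intro h hγ
  generalize hK : arc γ a b = K at x
  rw [arc, dif_pos hab] at hK
  subst hK
  rfl

end Arc

lemma Curve.ext_of_restriction {K L : Curve} {γ : ℝ → ℂ} (hl : K.left = L.left)
    (hr : K.right = L.right) (hK : ∀ x, K.toFun x = γ x) (hL : ∀ x, L.toFun x = γ x) : K = L := by
  obtain ⟨a, b, h, f⟩ := K
  obtain ⟨a', b', h', g⟩ := L
  obtain rfl : a = a' := hl
  obtain rfl : b = b' := hr
  obtain rfl : f = g := by ext x; rw [hK, hL]
  rfl

/-- `γ` takes the same value at `a` and `b`, where `a < b` and `[a, b] ⊆ S`, and at no other pair of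
parameters with these properties. Then `γ` has a unique loop in `S`, its restriction to `[a, b]`. -/
structure IsUniqueDouble (γ : ℝ → ℂ) (S : Set ℝ) (a b : ℝ) : Prop where
  lt : a < b
  eq : γ a = γ b
  subset : Icc a b ⊆ S
  unique : ∀ a' b', a' < b' → Icc a' b' ⊆ S → γ a' = γ b' → a' = a ∧ b' = b

namespace IsUniqueDouble

variable {γ : ℝ → ℂ} {S : Set ℝ} {a b : ℝ}

lemma injOn (h : IsUniqueDouble γ S a b) : InjOn γ (Ico a b) := by
  have ne_of_lt : ∀ x ∈ Ico a b, ∀ y ∈ Ico a b, x < y → γ x ≠ γ y := fun x hx y hy hxy he =>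
    hy.2.ne (h.unique x y hxy ((Icc_subset_Icc hx.1 hy.2.le).trans h.subset) he).2
  intro x hx y hy he
  rcases lt_trichotomy x y with hlt | rfl | hlt
  · exact absurd he (ne_of_lt x hx y hy hlt)
  · rfl
  · exact absurd he.symm (ne_of_lt y hy x hx hlt)

lemma isUniqueLoopIn (h : IsUniqueDouble γ S a b) {L : Curve} (hl : L.left = a) (hr : L.right = b)
    (hL : ∀ x, L.toFun x = γ x) : IsUniqueLoopIn γ S L := by
  subst hl hr
  refine ⟨⟨hL, h.eq, h.injOn⟩, h.subset, fun L' h' hS => ?_⟩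
  obtain ⟨hl, hr⟩ := h.unique _ _ L'.left_lt_right hS h'.closed
  exact Curve.ext_of_restriction hl hr h'.restriction hL

lemma isUniqueLoopIn_arc (h : IsUniqueDouble γ S a b) (hγ : ContinuousOn γ (Icc a b)) :
    IsUniqueLoopIn γ S (arc γ a b) :=
  h.isUniqueLoopIn (arc_left h.lt hγ) (arc_right h.lt hγ) (arc_toFun h.lt hγ)

lemma congr {γ' : ℝ → ℂ} (h : IsUniqueDouble γ S a b) (hγ : ∀ x y, γ' x = γ' y ↔ γ x = γ y) :
    IsUniqueDouble γ' S a b :=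
  ⟨h.lt, (hγ a b).2 h.eq, h.subset, fun a' b' hlt hS he => h.unique a' b' hlt hS ((hγ a' b').1 he)⟩

lemma affine {p ε R : ℝ} (hε : 0 < ε)
    (h : IsUniqueDouble (fun P => γ (p + ε * P)) (Icc (-R) R) a b) :
    IsUniqueDouble γ (Icc (p - R * ε) (p + R * ε)) (p + ε * a) (p + ε * b) := by
  have ha := h.subset (left_mem_Icc.2 h.lt.le)
  have hb := h.subset (right_mem_Icc.2 h.lt.le)
  refine ⟨by nlinarith [h.lt], h.eq, Icc_subset_Icc (by nlinarith [ha.1]) (by nlinarith [hb.2]),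
    fun a' b' hab hS he => ?_⟩
  have hl := hS (left_mem_Icc.2 hab.le)
  have hr := hS (right_mem_Icc.2 hab.le)
  have e (x : ℝ) : p + ε * ((x - p) / ε) = x := by field_simp; ring
  obtain ⟨ha', hb'⟩ := h.unique ((a' - p) / ε) ((b' - p) / ε) (by gcongr)
    (Icc_subset_Icc (by rw [le_div_iff₀ hε]; linarith [hl.1])
      (by rw [div_le_iff₀ hε]; linarith [hr.2])) (by simpa only [e] using he)
  exact ⟨by rw [← ha', e], by rw [← hb', e]⟩

end IsUniqueDouble

lemma limitCurve_eq_iff {a b x y : ℝ} (ha : a ≠ 0) (hb : b ≠ 0) (hxy : x < y) :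
    limitCurve a b x = limitCurve a b y ↔ x = -√3 ∧ y = √3 := by
  have sqrt_cube : √3 ^ 3 = 3 * √3 := by rw [pow_succ, Real.sq_sqrt (by norm_num)]
  simp only [limitCurve, Complex.mk.injEq, mul_eq_mul_left_iff, ha, hb, or_false]
  constructor
  · rintro ⟨hre, him⟩
    obtain rfl : x = -y := by
      have : (x - y) * (x + y) = 0 := by linarith
      rcases mul_eq_zero.1 this with h | h <;> linarith
    have hy : 0 < y := by linarith
    have hsq : y ^ 2 = 3 := by
      have : y * (y ^ 2 - 3) = 0 := by linarith
      rcases mul_eq_zero.1 this with h | h <;> linarith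
    have : √3 = y := by rw [← hsq, Real.sqrt_sq hy.le]
    exact ⟨by rw [this], this.symm⟩
  · rintro ⟨rfl, rfl⟩
    exact ⟨by ring, by rw [neg_pow, sqrt_cube]; ring⟩

lemma isUniqueDouble_limitCurve {a b : ℝ} (ha : a ≠ 0) (hb : b ≠ 0) :
    IsUniqueDouble (limitCurve a b) univ (-√3) √3 := by
  have hlt : -√3 < √3 := neg_lt_self (by positivity)
  exact ⟨hlt, (limitCurve_eq_iff ha hb hlt).2 ⟨rfl, rfl⟩, subset_univ _,
    fun x y hxy _ he => (limitCurve_eq_iff ha hb hxy).1 he⟩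

lemma isUniqueLoopIn_limitLoop {a b : ℝ} (ha : a ≠ 0) (hb : b ≠ 0) :
    IsUniqueLoopIn (limitCurve a b) univ (limitLoop a b) :=
  (isUniqueDouble_limitCurve ha hb).isUniqueLoopIn rfl rfl fun _ => rfl

/-! ### Convergence of curves -/

namespace Curve

lemma abs_sub_le_cost (K L : Curve) (l : (I ≃ₜ Icc K.left K.right) × (I ≃ₜ Icc L.left L.right))
    (t : I) : |(l.1 t : ℝ) - l.2 t| ≤ cost K L l :=
  ((param l.1 - param l.2).norm_coe_le_norm t).trans (le_add_of_nonneg_right (norm_nonneg _))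

lemma sub_left_le_dist (K L : Curve) : L.left - K.left ≤ dist K L := by
  refine le_ciInf fun l => ?_
  have h := abs_sub_le_cost K L l (l.1.symm ⟨_, left_mem_Icc.2 K.left_lt_right.le⟩)
  rw [l.1.apply_symm_apply] at h
  linarith [(abs_le.1 h).1, (l.2 (l.1.symm ⟨_, left_mem_Icc.2 K.left_lt_right.le⟩)).2.1]

lemma sub_right_le_dist (K L : Curve) : K.right - L.right ≤ dist K L := by
  refine le_ciInf fun l => ?_
  have h := abs_sub_le_cost K L l (l.1.symm ⟨_, right_mem_Icc.2 K.left_lt_right.le⟩)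
  rw [l.1.apply_symm_apply] at h
  linarith [(abs_le.1 h).2, (l.2 (l.1.symm ⟨_, right_mem_Icc.2 K.left_lt_right.le⟩)).2.2]

lemma continuous_left : Continuous left :=
  (LipschitzWith.of_dist_le' (K := 1) fun K L => by
    have := sub_left_le_dist L K
    rw [dist_comm] at this
    rw [one_mul, Real.dist_eq, abs_le]
    constructor <;> linarith [sub_left_le_dist K L]).continuous

lemma continuous_right : Continuous right :=
  (LipschitzWith.of_dist_le' (K := 1) fun K L => by
    have := sub_right_le_dist L K
    rw [dist_comm] at this
    rw [one_mul, Real.dist_eq, abs_le]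
    constructor <;> linarith [sub_right_le_dist K L]).continuous

/-- The increasing affine homeomorphism of `[0, 1]` with the interval of definition of a curve. -/
noncomputable def affineParam (K : Curve) : I ≃ₜ Icc K.left K.right :=
  (iccHomeoI K.left K.right K.left_lt_right).symm

lemma coe_affineParam (K : Curve) (t : I) :
    (K.affineParam t : ℝ) = (K.right - K.left) * t + K.left := by
  simp [affineParam]

end Curve

section Convergence

variable {ι X E : Type*} {l : Filter ι}

lemma tendstoLocallyUniformly_of_forall_tendsto [TopologicalSpace X] [UniformSpace E]
    {F : ι → X → E} {f : X → E} (hf : Continuous f)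
    (h : ∀ x, Tendsto (fun z : ι × X => F z.1 z.2) (l ×ˢ 𝓝 x) (𝓝 (f x))) :
    TendstoLocallyUniformly F f l :=
  tendstoLocallyUniformly_iff_forall_tendsto.2 fun x =>
    ((hf.tendsto x).comp tendsto_snd |>.prodMk_nhds (h x)).mono_right (nhds_le_uniformity _)

lemma tendsto_affineParam {L : ι → Curve} {L₀ : Curve}
    (hl : Tendsto (fun i => (L i).left) l (𝓝 L₀.left))
    (hr : Tendsto (fun i => (L i).right) l (𝓝 L₀.right)) (t : I) :
    Tendsto (fun z : ι × I => ((L z.1).affineParam z.2 : ℝ)) (l ×ˢ 𝓝 t)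
      (𝓝 (L₀.affineParam t)) := by
  simp only [Curve.coe_affineParam]
  have hl' := hl.comp (tendsto_fst (f := l) (g := 𝓝 t))
  have hr' := hr.comp (tendsto_fst (f := l) (g := 𝓝 t))
  have ht : Tendsto (fun z : ι × I => (z.2 : ℝ)) (l ×ˢ 𝓝 t) (𝓝 t) :=
    (continuous_subtype_val.tendsto t).comp tendsto_snd
  exact ((hr'.sub hl').mul ht).add hl'

lemma tendsto_curve {γ : ι → ℝ → ℂ} {γ₀ : ℝ → ℂ} (h : TendstoLocallyUniformly γ γ₀ l)
    (hγ₀ : Continuous γ₀) {L : ι → Curve} {L₀ : Curve}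
    (hL : ∀ᶠ i in l, ∀ x, (L i).toFun x = γ i x) (hL₀ : ∀ x, L₀.toFun x = γ₀ x)
    (hl : Tendsto (fun i => (L i).left) l (𝓝 L₀.left))
    (hr : Tendsto (fun i => (L i).right) l (𝓝 L₀.right)) : Tendsto L l (𝓝 L₀) := by
  have hparam : Tendsto (fun i => Curve.param (L i).affineParam) l
      (𝓝 (Curve.param L₀.affineParam)) :=
    ContinuousMap.tendsto_iff_tendstoLocallyUniformly.2 <|
      tendstoLocallyUniformly_of_forall_tendsto (ContinuousMap.continuous _)
        (tendsto_affineParam hl hr)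
  have hreparam : Tendsto (fun i => (L i).reparam (L i).affineParam) l
      (𝓝 (L₀.reparam L₀.affineParam)) := by
    refine ContinuousMap.tendsto_iff_tendstoLocallyUniformly.2 <|
      tendstoLocallyUniformly_of_forall_tendsto (ContinuousMap.continuous _) fun t => ?_
    have := (tendstoLocallyUniformly_iff_forall_tendsto.1 h (L₀.affineParam t)).comp
      (tendsto_fst.prodMk (tendsto_affineParam hl hr t))
    have hcomp := (hγ₀.tendsto _).comp (tendsto_affineParam hl hr t) |>.congr_uniformity this
    refine Tendsto.congr' ?_ (hcomp.trans_eq (by simp [Curve.reparam, hL₀]))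
    filter_upwards [tendsto_fst.eventually hL] with z hz
    simp [Curve.reparam, hz]
  refine tendsto_iff_dist_tendsto_zero.2 <| squeeze_zero (fun _ => dist_nonneg)
    (fun i => Curve.d_le (L i) L₀ ((L i).affineParam, L₀.affineParam)) ?_
  simpa [Curve.cost] using (tendsto_iff_norm_sub_tendsto_zero.1 hparam).add
    (tendsto_iff_norm_sub_tendsto_zero.1 hreparam)

lemma tendsto_of_apply_fst_eq_apply_snd [TopologicalSpace X] [UniformSpace E] [T2Space E]
    {γ : ι → X → E} {γ₀ : X → E} (h : TendstoLocallyUniformly γ γ₀ l) (hγ₀ : Continuous γ₀)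
    {K : Set (X × X)} (hK : IsCompact K) {x : ι → X × X}
    (hx : ∀ᶠ i in l, x i ∈ K ∧ γ i (x i).1 = γ i (x i).2) {x₀ : X × X}
    (hx₀ : ∀ y ∈ K, γ₀ y.1 = γ₀ y.2 → y = x₀) : Tendsto x l (𝓝 x₀) := by
  refine hK.tendsto_nhds_of_unique_mapClusterPt (hx.mono fun _ => And.left) fun y hy hc => ?_
  obtain ⟨U, hU, hUy⟩ := mapClusterPt_iff_ultrafilter.1 hc
  have hγU : TendstoLocallyUniformly γ γ₀ U := fun u hu x =>
    (h u hu x).imp fun _ ht => ⟨ht.1, hU ht.2⟩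
  refine hx₀ y hy (tendsto_nhds_unique
    ((hγU.tendsto_comp hγ₀.continuousAt ((continuous_fst.tendsto y).comp hUy)).congr' ?_)
    (hγU.tendsto_comp hγ₀.continuousAt ((continuous_snd.tendsto y).comp hUy)))
  filter_upwards [hU hx] with i hi using hi.2

end Convergence

/-! ### Death of a loop -/

/-- Coincidence of the two evolutions is closed by continuity of the end points, and open by
uniqueness of the loop in the window. -/
lemma IsLoopEvolution.eqOn_of_isUniqueLoopIn {f : ℝ → ℝ → ℂ} {T₁ T : ℝ} {L L' : ℝ → Curve}
    {l r : ℝ → ℝ} (hT : T₁ < T) (hL : IsLoopEvolution f T₁ T L) (hL' : IsLoopEvolution f T₁ T L')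
    (hinit : L' T₁ = L T₁)
    (hu : ∀ t ∈ Ico T₁ T, IsUniqueLoopIn (fun p => f p t) (Icc (l t) (r t)) (L t))
    (hl : ContinuousOn l (Ico T₁ T)) (hr : ContinuousOn r (Ico T₁ T))
    (hlL : ∀ t ∈ Ico T₁ T, l t < (L t).left ∧ (L t).right < r t) : EqOn L' L (Ico T₁ T) := by
  have : PreconnectedSpace (Ico T₁ T) := Subtype.preconnectedSpace isPreconnected_Ico
  have hLc : Continuous fun t : Ico T₁ T => L t := hL.continuousOn.domRestrict
  have hLc' : Continuous fun t : Ico T₁ T => L' t := hL'.continuousOn.domRestrict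
  have hlc : Continuous fun t : Ico T₁ T => l t := hl.domRestrict
  have hrc : Continuous fun t : Ico T₁ T => r t := hr.domRestrict
  have eq_iff_endpoints (t : Ico T₁ T) : L' t = L t ↔
      (L' t).left = (L t).left ∧ (L' t).right = (L t).right :=
    ⟨fun h => by rw [h]; exact ⟨rfl, rfl⟩, fun h =>
      Curve.ext_of_restriction (γ := fun p => f p t) h.1 h.2
      (hL'.isLoop t t.2).restriction (hL.isLoop t t.2).restriction⟩
  have eq_iff_inside (t : Ico T₁ T) : L' t = L t ↔ l t < (L' t).left ∧ (L' t).right < r t :=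
    ⟨fun h => h ▸ hlL t t.2, fun h => (hu t t.2).unique _ (hL'.isLoop t t.2)
      (Icc_subset_Icc h.1.le h.2.le)⟩
  have hclopen : IsClopen {t : Ico T₁ T | L' t = L t} := by
    constructor
    · simp only [eq_iff_endpoints]
      exact (isClosed_eq (Curve.continuous_left.comp hLc') (Curve.continuous_left.comp hLc)).inter
        (isClosed_eq (Curve.continuous_right.comp hLc') (Curve.continuous_right.comp hLc))
    · simp only [eq_iff_inside]
      exact (isOpen_lt hlc (Curve.continuous_left.comp hLc')).inter
        (isOpen_lt (Curve.continuous_right.comp hLc') hrc)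
  have heq := hclopen.eq_univ ⟨⟨T₁, left_mem_Ico.2 hT⟩, hinit⟩
  exact fun t ht => heq.ge (mem_univ (⟨t, ht⟩ : Ico T₁ T))

lemma vanishesAfter_of_unique {f : ℝ → ℝ → ℂ} {T₁ T : ℝ} {L : ℝ → Curve} {l r : ℝ → ℝ}
    (hT : T₁ < T) (hL : IsLoopEvolution f T₁ T L)
    (hu : ∀ t ∈ Ico T₁ T, IsUniqueLoopIn (fun p => f p t) (Icc (l t) (r t)) (L t))
    (hl : ContinuousOn l (Ico T₁ T)) (hr : ContinuousOn r (Ico T₁ T))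
    (hlL : ∀ t ∈ Ico T₁ T, l t < (L t).left ∧ (L t).right < r t)
    (hlen : Tendsto (fun t => (L t).right - (L t).left) (𝓝[<] T) (𝓝 0)) :
    VanishesAfter f T₁ (L T₁) T := by
  refine ⟨?_, fun T' hT' => hT' ⟨hT, L, hL, rfl⟩⟩
  rintro T₂ ⟨-, L', hL', hinit⟩
  by_contra! hlt
  have hsub : Ico T₁ T ⊆ Ico T₁ T₂ := Ico_subset_Ico_right hlt.le
  have heq : EqOn L' L (Ico T₁ T) := hL.eqOn_of_isUniqueLoopIn hT
    ⟨hL'.continuousOn.mono hsub, fun t ht => hL'.isLoop t (hsub ht)⟩ hinit hu hl hr hlL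
  have hL'T : Tendsto L' (𝓝[<] T) (𝓝 (L' T)) := by
    rw [← nhdsWithin_Ico_eq_nhdsLT hT]
    exact (hL'.continuousOn T ⟨hT.le, hlt⟩).mono hsub
  have hlen' := ((Curve.continuous_right.tendsto _).comp hL'T).sub
    ((Curve.continuous_left.tendsto _).comp hL'T)
  have : (L' T).right - (L' T).left = 0 := by
    refine tendsto_nhds_unique (hlen'.congr' ?_) hlen
    filter_upwards [Ico_mem_nhdsLT hT] with t ht
    simp [heq ht]
  linarith [(L' T).left_lt_right]

/-! ### Double points of perturbed cusps -/

lemma exists_sub_eq_mul_of_lipschitzOnWith {K : ℝ≥0} {g : ℝ → ℝ} {s : Set ℝ}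
    (hg : LipschitzOnWith K g s)
    {a b : ℝ} (ha : a ∈ s) (hb : b ∈ s) : ∃ e : ℝ, |e| ≤ K ∧ g b - g a = (b - a) * e := by
  rcases eq_or_ne a b with rfl | hab
  · exact ⟨0, by simp⟩
  have hd : b - a ≠ 0 := sub_ne_zero.2 hab.symm
  refine ⟨(g b - g a) / (b - a), ?_, by field_simp⟩
  rw [abs_div, div_le_iff₀ (abs_pos.2 hd)]
  simpa only [Real.dist_eq] using hg.dist_le_mul b hb a ha

lemma eq_and_eq_of_strictMonoOn {α β : Type*} [LinearOrder α] [Preorder β] {x y : α → β}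
    {A B : Set α} (hxA : StrictAntiOn x A) (hxB : StrictMonoOn x B) (hyA : StrictMonoOn y A)
    (hyB : StrictMonoOn y B) {a a' b b' : α} (ha : a ∈ A) (ha' : a' ∈ A) (hb : b ∈ B)
    (hb' : b' ∈ B) (hx : x a = x b) (hy : y a = y b) (hx' : x a' = x b') (hy' : y a' = y b') :
    a' = a ∧ b' = b := by
  have lt_iff_x : a < a' ↔ b' < b := by rw [← hxA.lt_iff_gt ha' ha, hx, hx', hxB.lt_iff_lt hb' hb]
  have lt_iff_x' : a' < a ↔ b < b' := by rw [← hxA.lt_iff_gt ha ha', hx, hx', hxB.lt_iff_lt hb hb']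
  have lt_iff_y : a < a' ↔ b < b' := by rw [← hyA.lt_iff_lt ha ha', hy, hy', hyB.lt_iff_lt hb hb']
  grind

lemma exists_apply_eq_apply_of_image_subset {X Z : Type*} [TopologicalSpace X]
    [TopologicalSpace Z] [T2Space Z] {x : X → Z} {y : X → ℝ} {A B : Set X} (hA : IsCompact A)
    (hB : IsPreconnected B) (hxA : ContinuousOn x A) (hinj : InjOn x A) (hyA : ContinuousOn y A)
    (hxB : ContinuousOn x B) (hyB : ContinuousOn y B) (hsub : x '' B ⊆ x '' A) {b₀ b₁ : X}
    (hb₀ : b₀ ∈ B) (hb₁ : b₁ ∈ B) (h₀ : ∀ a ∈ A, x a = x b₀ → y b₀ ≤ y a)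
    (h₁ : ∀ a ∈ A, x a = x b₁ → y a ≤ y b₁) : ∃ a ∈ A, ∃ b ∈ B, x a = x b ∧ y a = y b := by
  have : CompactSpace A := isCompact_iff_compactSpace.1 hA
  have : PreconnectedSpace B := Subtype.preconnectedSpace hB
  have hpartner (b : B) : ∃ a : A, x a = x b := by
    obtain ⟨a, ha, hab⟩ := hsub (mem_image_of_mem x b.2)
    exact ⟨⟨a, ha⟩, hab⟩
  choose ρ hρ using hpartner
  have hρc : Continuous ρ := by
    refine (hxA.domRestrict.isClosedEmbedding hinj.injective).isEmbedding.continuous_iff.2 ?_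
    exact hxB.domRestrict.congr fun b => (hρ b).symm
  obtain ⟨b, hb⟩ := intermediate_value_univ₂ (a := (⟨b₀, hb₀⟩ : B)) (b := ⟨b₁, hb₁⟩)
    hyB.domRestrict (hyA.domRestrict.comp hρc) (h₀ _ (ρ _).2 (hρ _)) (h₁ _ (ρ _).2 (hρ _))
  exact ⟨ρ b, (ρ b).2, b, b.2, hρ b, hb.symm⟩

/-- On `[-2, 2]`, the curve `(x, y)` differs from the cuspidal loop `P ↦ (P ^ 2 - 1, P ^ 3 - 3 P)`
by a map with small Lipschitz constant. Such a curve still has exactly one double point. -/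
structure IsCuspPerturbation (x y : ℝ → ℝ) : Prop where
  fst : LipschitzOnWith (1 / 40) (fun P => x P - (P ^ 2 - 1)) (Icc (-2) 2)
  snd : LipschitzOnWith (1 / 40) (fun P => y P - (P ^ 3 - 3 * P)) (Icc (-2) 2)

namespace IsCuspPerturbation

variable {x y : ℝ → ℝ} {a b : ℝ}

lemma exists_fst_sub_eq (h : IsCuspPerturbation x y) (ha : a ∈ Icc (-2) 2) (hb : b ∈ Icc (-2) 2) :
    ∃ e, |e| ≤ 1 / 40 ∧ x b - x a = (b - a) * (a + b + e) := by
  obtain ⟨e, he, heq⟩ := exists_sub_eq_mul_of_lipschitzOnWith h.fst ha hb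
  exact ⟨e, by simpa using he, by linarith⟩

lemma exists_snd_sub_eq (h : IsCuspPerturbation x y) (ha : a ∈ Icc (-2) 2) (hb : b ∈ Icc (-2) 2) :
    ∃ e, |e| ≤ 1 / 40 ∧ y b - y a = (b - a) * (a ^ 2 + a * b + b ^ 2 - 3 + e) := by
  obtain ⟨e, he, heq⟩ := exists_sub_eq_mul_of_lipschitzOnWith h.snd ha hb
  exact ⟨e, by simpa using he, by linarith⟩

lemma exists_snd_sub_eq_of_fst_eq (h : IsCuspPerturbation x y) (ha : a ∈ Icc (-2) 2)
    (hb : b ∈ Icc (-2) 2) (hab : a ≠ b) (hx : x a = x b) :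
    |a + b| ≤ 1 / 40 ∧ ∃ e, |e| ≤ 3 / 40 ∧ y b - y a = (b - a) * (b ^ 2 - 3 + e) := by
  obtain ⟨e, he, hxe⟩ := h.exists_fst_sub_eq ha hb
  obtain ⟨e', he', hye⟩ := h.exists_snd_sub_eq ha hb
  rw [hx, sub_self, zero_eq_mul, or_iff_right (sub_ne_zero.2 hab.symm)] at hxe
  obtain rfl : e = -(a + b) := by linarith
  rw [abs_neg] at he
  refine ⟨he, a * (a + b) + e', ?_, by rw [hye]; ring⟩
  calc |a * (a + b) + e'| ≤ |a| * |a + b| + |e'| := (abs_add_le _ _).trans_eq (by rw [abs_mul])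
    _ ≤ 2 * (1 / 40) + 1 / 40 := by gcongr; exact abs_le.2 ha
    _ = 3 / 40 := by norm_num

lemma continuousOn_fst (h : IsCuspPerturbation x y) : ContinuousOn x (Icc (-2) 2) :=
  (h.fst.continuousOn.add (g := fun P => P ^ 2 - 1) (by fun_prop)).congr fun P _ => by simp

lemma continuousOn_snd (h : IsCuspPerturbation x y) : ContinuousOn y (Icc (-2) 2) :=
  (h.snd.continuousOn.add (g := fun P => P ^ 3 - 3 * P) (by fun_prop)).congr fun P _ => by simp

lemma strictMonoOn_fst (h : IsCuspPerturbation x y) : StrictMonoOn x (Icc 1.5 2) := by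
  intro a ha b hb hab
  obtain ⟨e, he, heq⟩ := h.exists_fst_sub_eq (a := a) (b := b) ⟨by linarith [ha.1], ha.2⟩
    ⟨by linarith [hb.1], hb.2⟩
  nlinarith [(abs_le.1 he).1, ha.1, hb.1]

lemma strictAntiOn_fst (h : IsCuspPerturbation x y) : StrictAntiOn x (Icc (-2) (-1.5)) := by
  intro a ha b hb hab
  obtain ⟨e, he, heq⟩ := h.exists_fst_sub_eq (a := a) (b := b) ⟨ha.1, by linarith [ha.2]⟩
    ⟨hb.1, by linarith [hb.2]⟩
  nlinarith [(abs_le.1 he).2, ha.2, hb.2]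

lemma snd_lt_snd (h : IsCuspPerturbation x y) (ha : a ∈ Icc (-2) 2) (hb : b ∈ Icc (-2) 2)
    (hab : a < b) (hq : 4 ≤ a ^ 2 + a * b + b ^ 2) : y a < y b := by
  obtain ⟨e, he, heq⟩ := h.exists_snd_sub_eq ha hb
  nlinarith [(abs_le.1 he).1]

lemma strictMonoOn_snd_right (h : IsCuspPerturbation x y) : StrictMonoOn y (Icc 1.5 2) :=
  fun a ha b hb hab => h.snd_lt_snd ⟨by linarith [ha.1], ha.2⟩ ⟨by linarith [hb.1], hb.2⟩ hab
    (by nlinarith [ha.1, hb.1])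

lemma strictMonoOn_snd_left (h : IsCuspPerturbation x y) : StrictMonoOn y (Icc (-2) (-1.5)) :=
  fun a ha b hb hab => h.snd_lt_snd ⟨ha.1, by linarith [ha.2]⟩ ⟨hb.1, by linarith [hb.2]⟩ hab
    (by nlinarith [ha.2, hb.2])

lemma mem_Icc_of_double (h : IsCuspPerturbation x y) (ha : a ∈ Icc (-2) 2) (hb : b ∈ Icc (-2) 2)
    (hab : a < b) (hx : x a = x b) (hy : y a = y b) :
    a ∈ Icc (-1.8) (-1.6) ∧ b ∈ Icc 1.6 1.8 := by
  obtain ⟨hsum, e, he, hye⟩ := h.exists_snd_sub_eq_of_fst_eq ha hb hab.ne hx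
  rw [hy, sub_self, zero_eq_mul, or_iff_right (sub_pos.2 hab).ne'] at hye
  obtain ⟨hsum₁, hsum₂⟩ := abs_le.1 hsum
  obtain ⟨he₁, he₂⟩ := abs_le.1 he
  have hlo : 1.65 ≤ b := by nlinarith
  have hhi : b ≤ 1.77 := by nlinarith
  exact ⟨⟨by linarith, by linarith⟩, by linarith, by linarith⟩

lemma exists_double (h : IsCuspPerturbation x y) :
    ∃ a ∈ Icc (-1.95 : ℝ) (-1.55), ∃ b ∈ Icc (1.6 : ℝ) 1.9, x a = x b ∧ y a = y b := by
  have hA : Icc (-1.95 : ℝ) (-1.55) ⊆ Icc (-2) 2 := Icc_subset_Icc (by norm_num) (by norm_num)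
  have hB : Icc (1.6 : ℝ) 1.9 ⊆ Icc (-2) 2 := Icc_subset_Icc (by norm_num) (by norm_num)
  have hb₀ : (1.6 : ℝ) ∈ Icc (1.6 : ℝ) 1.9 := by norm_num
  have hb₁ : (1.9 : ℝ) ∈ Icc (1.6 : ℝ) 1.9 := by norm_num
  refine exists_apply_eq_apply_of_image_subset (b₀ := 1.6) (b₁ := 1.9) isCompact_Icc
    isPreconnected_Icc (h.continuousOn_fst.mono hA)
    (h.strictAntiOn_fst.injOn.mono (Icc_subset_Icc (by norm_num) (by norm_num)))
    (h.continuousOn_snd.mono hA) (h.continuousOn_fst.mono hB) (h.continuousOn_snd.mono hB)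
    ?_ hb₀ hb₁ (fun a ha hxa => ?_) fun a ha hxa => ?_
  · rintro _ ⟨b, hb, rfl⟩
    obtain ⟨e, he, heq⟩ := h.exists_fst_sub_eq (hA (left_mem_Icc.2 (by norm_num))) (hB hb)
    obtain ⟨e', he', heq'⟩ := h.exists_fst_sub_eq (hA (right_mem_Icc.2 (by norm_num))) (hB hb)
    refine intermediate_value_Icc' (by norm_num) (h.continuousOn_fst.mono hA) ⟨?_, ?_⟩
    · nlinarith [(abs_le.1 he').1, hb.1]
    · nlinarith [(abs_le.1 he).2, hb.1, hb.2]
  · obtain ⟨-, e, he, hye⟩ :=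
      h.exists_snd_sub_eq_of_fst_eq (hA ha) (hB hb₀) (by linarith [ha.2]) hxa
    nlinarith [(abs_le.1 he).2, ha.2]
  · obtain ⟨-, e, he, hye⟩ :=
      h.exists_snd_sub_eq_of_fst_eq (hA ha) (hB hb₁) (by linarith [ha.2]) hxa
    nlinarith [(abs_le.1 he).1, ha.2]

lemma exists_isUniqueDouble {γ : ℝ → ℂ} (h : IsCuspPerturbation (fun P => (γ P).re)
    fun P => (γ P).im) : ∃ a ∈ Icc (-1.8 : ℝ) (-1.6), ∃ b ∈ Icc (1.6 : ℝ) 1.8,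
      IsUniqueDouble γ (Icc (-2) 2) a b := by
  obtain ⟨a, ha, b, hb, hx, hy⟩ := h.exists_double
  have hab : a < b := by linarith [ha.2, hb.1]
  have hloc : ∀ a' b', a' < b' → Icc a' b' ⊆ Icc (-2) 2 → γ a' = γ b' →
      a' ∈ Icc (-1.8) (-1.6) ∧ b' ∈ Icc 1.6 1.8 := fun a' b' hlt hS he =>
    h.mem_Icc_of_double (hS (left_mem_Icc.2 hlt.le)) (hS (right_mem_Icc.2 hlt.le)) hlt
      (congrArg Complex.re he) (congrArg Complex.im he)
  have hsub : Icc a b ⊆ Icc (-2) 2 :=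
    Icc_subset_Icc (by linarith [ha.1]) (by linarith [hb.2])
  have he : γ a = γ b := Complex.ext hx hy
  obtain ⟨ha', hb'⟩ := hloc a b hab hsub he
  have hA : Icc (-1.8 : ℝ) (-1.6) ⊆ Icc (-2) (-1.5) := Icc_subset_Icc (by norm_num) (by norm_num)
  have hB : Icc (1.6 : ℝ) 1.8 ⊆ Icc 1.5 2 := Icc_subset_Icc (by norm_num) (by norm_num)
  refine ⟨a, ha', b, hb', hab, he, hsub, fun a' b' hlt hS he' => ?_⟩
  obtain ⟨ha'', hb''⟩ := hloc a' b' hlt hS he'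
  exact eq_and_eq_of_strictMonoOn h.strictAntiOn_fst h.strictMonoOn_fst h.strictMonoOn_snd_left
    h.strictMonoOn_snd_right (hA ha') (hA ha'') (hB hb') (hB hb'') hx hy
    (congrArg Complex.re he') (congrArg Complex.im he')

end IsCuspPerturbation

/-! ### Natural frames and Taylor coefficients -/

/-- The first coordinate of a point of the plane after multiplication by `c`. -/
noncomputable def reMul (c : ℂ) : ℂ →L[ℝ] ℝ := Complex.reCLM ∘L ContinuousLinearMap.mul ℝ ℂ c

/-- The second coordinate of a point of the plane after multiplication by `c`. -/
noncomputable def imMul (c : ℂ) : ℂ →L[ℝ] ℝ := Complex.imCLM ∘L ContinuousLinearMap.mul ℝ ℂ c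

@[simp] lemma reMul_apply (c z : ℂ) : reMul c z = (c * z).re := rfl

@[simp] lemma imMul_apply (c z : ℂ) : imMul c z = (c * z).im := rfl

lemma iteratedDeriv_clm_comp {E F : Type*} [NormedAddCommGroup E] [NormedSpace ℝ E]
    [NormedAddCommGroup F] [NormedSpace ℝ F] (L : E →L[ℝ] F) {γ : ℝ → E} {t : ℝ} {n : ℕ}
    (hγ : ContDiffAt ℝ n γ t) :
    iteratedDeriv n (fun x => L (γ x)) t = L (iteratedDeriv n γ t) := by
  simp only [iteratedDeriv]
  exact DFunLike.congr_fun (L.iteratedFDeriv_comp_left hγ le_rfl) _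

lemma iteratedDeriv_clm_sub {E F : Type*} [NormedAddCommGroup E] [NormedSpace ℝ E]
    [NormedAddCommGroup F] [NormedSpace ℝ F] (L : E →L[ℝ] F) {γ : ℝ → E} {t : ℝ} {n : ℕ}
    (hn : n ≠ 0) (hγ : ContDiffAt ℝ n γ t) (z : E) :
    iteratedDeriv n (fun x => L (γ x - z)) t = L (iteratedDeriv n γ t) := by
  rw [iteratedDeriv_clm_comp L (hγ.sub contDiffAt_const),
    iteratedDeriv_fun_sub hγ contDiffAt_const, iteratedDeriv_const, if_neg hn, sub_zero]

lemma hasFPowerSeriesAt_ofScalars_iff {g : ℝ → ℝ} {A : ℕ → ℝ} {t₀ : ℝ} :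
    HasFPowerSeriesAt g (FormalMultilinearSeries.ofScalars ℝ A) t₀ ↔
      ∃ r > 0, ∀ t, |t - t₀| ≤ r → HasSum (fun i => A i * (t - t₀) ^ i) (g t) := by
  rw [hasFPowerSeriesAt_iff', Metric.nhds_basis_closedBall.eventually_iff]
  simp only [FormalMultilinearSeries.coeff_ofScalars, smul_eq_mul, Metric.mem_closedBall,
    Real.dist_eq, mul_comm]

lemma hasSum_taylor_iff {g : ℝ → ℝ} {t₀ : ℝ} (hg : AnalyticAt ℝ g t₀) {A : ℕ → ℝ} :
    (∃ r > 0, ∀ t, |t - t₀| ≤ r → HasSum (fun i => A i * (t - t₀) ^ i) (g t)) ↔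
      A = fun i => iteratedDeriv i g t₀ / i.factorial := by
  rw [← hasFPowerSeriesAt_ofScalars_iff]
  constructor
  · exact fun h => FormalMultilinearSeries.ofScalars_series_injective ℝ ℝ
      (h.eq_formalMultilinearSeries hg.hasFPowerSeriesAt)
  · rintro rfl
    exact hg.hasFPowerSeriesAt

section

variable {γ : ℝ → ℂ} {t₀ : ℝ}

/-- The first coordinates of the Taylor coefficients of `t ↦ c * (γ t - γ t₀)` at `t₀`. -/
noncomputable def reTaylor (γ : ℝ → ℂ) (t₀ : ℝ) (c : ℂ) (i : ℕ) : ℝ :=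
  iteratedDeriv i (fun t => reMul c (γ t - γ t₀)) t₀ / i.factorial

/-- The second coordinates of the Taylor coefficients of `t ↦ c * (γ t - γ t₀)` at `t₀`. -/
noncomputable def imTaylor (γ : ℝ → ℂ) (t₀ : ℝ) (c : ℂ) (i : ℕ) : ℝ :=
  iteratedDeriv i (fun t => imMul c (γ t - γ t₀)) t₀ / i.factorial

lemma taylor_zero (c : ℂ) : reTaylor γ t₀ c 0 = 0 ∧ imTaylor γ t₀ c 0 = 0 := by
  simp [reTaylor, imTaylor]

lemma reTaylor_of_ne_zero (hγ : AnalyticAt ℝ γ t₀) (c : ℂ) {i : ℕ} (hi : i ≠ 0) :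
    reTaylor γ t₀ c i = (c * iteratedDeriv i γ t₀).re / i.factorial := by
  rw [reTaylor, iteratedDeriv_clm_sub _ hi hγ.contDiffAt, reMul_apply]

lemma imTaylor_of_ne_zero (hγ : AnalyticAt ℝ γ t₀) (c : ℂ) {i : ℕ} (hi : i ≠ 0) :
    imTaylor γ t₀ c i = (c * iteratedDeriv i γ t₀).im / i.factorial := by
  rw [imTaylor, iteratedDeriv_clm_sub _ hi hγ.contDiffAt, imMul_apply]

lemma hasSum_taylor_coordinates_iff (hγ : AnalyticAt ℝ γ t₀) (c : ℂ) {a b : ℕ → ℝ} :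
    (∃ r > 0, ∀ t, |t - t₀| ≤ r →
      HasSum (fun i => a i * (t - t₀) ^ i) (c * (γ t - γ t₀)).re ∧
      HasSum (fun i => b i * (t - t₀) ^ i) (c * (γ t - γ t₀)).im) ↔
      a = reTaylor γ t₀ c ∧ b = imTaylor γ t₀ c := by
  have hre : AnalyticAt ℝ (fun t => reMul c (γ t - γ t₀)) t₀ :=
    ((reMul c).analyticAt _).comp (hγ.sub analyticAt_const)
  have him : AnalyticAt ℝ (fun t => imMul c (γ t - γ t₀)) t₀ :=
    ((imMul c).analyticAt _).comp (hγ.sub analyticAt_const)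
  unfold reTaylor imTaylor
  rw [← hasSum_taylor_iff hre, ← hasSum_taylor_iff him]
  constructor
  · rintro ⟨r, hr, h⟩
    exact ⟨⟨r, hr, fun t ht => (h t ht).1⟩, r, hr, fun t ht => (h t ht).2⟩
  · rintro ⟨⟨r, hr, h⟩, s, hs, k⟩
    exact ⟨min r s, lt_min hr hs, fun t ht =>
      ⟨h t (ht.trans (min_le_left _ _)), k t (ht.trans (min_le_right _ _))⟩⟩

lemma IsNaturalFrame.reMul_iteratedDeriv {c : ℂ} {a b : ℕ → ℝ} (h : IsNaturalFrame γ t₀ c a b)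
    (hγ : AnalyticAt ℝ γ t₀) {i : ℕ} (hi : i ≠ 0) :
    reMul c (iteratedDeriv i γ t₀) = i.factorial * a i := by
  rw [reMul_apply, ((hasSum_taylor_coordinates_iff hγ c).1 h.expansion).1,
    reTaylor_of_ne_zero hγ c hi]
  field_simp

lemma IsNaturalFrame.imMul_iteratedDeriv {c : ℂ} {a b : ℕ → ℝ} (h : IsNaturalFrame γ t₀ c a b)
    (hγ : AnalyticAt ℝ γ t₀) {i : ℕ} (hi : i ≠ 0) :
    imMul c (iteratedDeriv i γ t₀) = i.factorial * b i := by
  rw [imMul_apply, ((hasSum_taylor_coordinates_iff hγ c).1 h.expansion).2,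
    imTaylor_of_ne_zero hγ c hi]
  field_simp

lemma IsNaturalFrame.reMul_iteratedDeriv_eq_zero {c : ℂ} {a b : ℕ → ℝ}
    (h : IsNaturalFrame γ t₀ c a b) (hγ : AnalyticAt ℝ γ t₀) (i : ℕ) (hi : i ≠ 0) (hi₁ : i ≤ 1) :
    reMul c (iteratedDeriv i γ t₀) = 0 := by
  rw [h.reMul_iteratedDeriv hγ hi, h.a_low i (Nat.lt_succ_of_le hi₁), mul_zero]

lemma IsNaturalFrame.imMul_iteratedDeriv_eq_zero {c : ℂ} {a b : ℕ → ℝ}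
    (h : IsNaturalFrame γ t₀ c a b) (hγ : AnalyticAt ℝ γ t₀) (i : ℕ) (hi : i ≠ 0) (hi₂ : i ≤ 2) :
    imMul c (iteratedDeriv i γ t₀) = 0 := by
  rw [h.imMul_iteratedDeriv hγ hi, h.b_low i (Nat.lt_succ_of_le hi₂), mul_zero]

lemma isNaturalFrame_taylor (hγ : AnalyticAt ℝ γ t₀) {c : ℂ} (hc : ‖c‖ = 1)
    (h₁ : iteratedDeriv 1 γ t₀ = 0) (h₂_re : (c * iteratedDeriv 2 γ t₀).re ≠ 0)
    (h₂_im : (c * iteratedDeriv 2 γ t₀).im = 0) (h₃ : (c * iteratedDeriv 3 γ t₀).im ≠ 0) :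
    IsNaturalFrame γ t₀ c (reTaylor γ t₀ c) (imTaylor γ t₀ c) where
  norm_eq_one := hc
  a_low i hi := by
    interval_cases i
    · exact (taylor_zero c).1
    · rw [reTaylor_of_ne_zero hγ c one_ne_zero, h₁, mul_zero, Complex.zero_re, zero_div]
  b_low i hi := by
    interval_cases i
    · exact (taylor_zero c).2
    · rw [imTaylor_of_ne_zero hγ c one_ne_zero, h₁, mul_zero, Complex.zero_im, zero_div]
    · rw [imTaylor_of_ne_zero hγ c two_ne_zero, h₂_im, zero_div]
  a_two := by
    rw [reTaylor_of_ne_zero hγ c two_ne_zero]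
    exact div_ne_zero h₂_re (by positivity)
  b_three := by
    rw [imTaylor_of_ne_zero hγ c three_ne_zero]
    exact div_ne_zero h₃ (by positivity)
  expansion := (hasSum_taylor_coordinates_iff hγ c).2 ⟨rfl, rfl⟩

/- Multiplication by `c = conj γ'' / ‖γ''‖` turns the second derivative into the positive real
`‖γ''‖`. -/
lemma isCuspSingularity_of_im_conj_mul_ne_zero (hγ : AnalyticAt ℝ γ t₀)
    (hs : IsSingularity γ t₀)
    (h : (starRingEnd ℂ (iteratedDeriv 2 γ t₀) * iteratedDeriv 3 γ t₀).im ≠ 0) :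
    IsCuspSingularity γ t₀ := by
  refine ⟨hs, hγ, ?_⟩
  set D₂ := iteratedDeriv 2 γ t₀
  set D₃ := iteratedDeriv 3 γ t₀
  have hD₂ : D₂ ≠ 0 := by
    intro h0
    simp [h0] at h
  have hn : ‖D₂‖ ≠ 0 := norm_ne_zero_iff.2 hD₂
  set c : ℂ := ((‖D₂‖⁻¹ : ℝ) : ℂ) * starRingEnd ℂ D₂
  have hcD₂ : c * D₂ = (‖D₂‖ : ℝ) := by
    rw [mul_assoc, Complex.conj_mul', ← Complex.ofReal_pow, ← Complex.ofReal_mul]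
    congr 1
    field_simp
  refine ⟨c, _, _, isNaturalFrame_taylor hγ ?_ ?_ ?_ ?_ ?_⟩
  · simp [c, hn]
  · rw [iteratedDeriv_one]
    exact hs.deriv
  · rw [hcD₂, Complex.ofReal_re]
    exact hn
  · rw [hcD₂, Complex.ofReal_im]
  · rw [mul_assoc, Complex.im_ofReal_mul]
    exact mul_ne_zero (inv_ne_zero hn) h

end

/-! ### Parabolic blow-up -/

lemma eventually_lipschitzOnWith_sub {ι : Type*} {l : Filter ι} {F F' : ι → ℝ → ℝ} {g g' : ℝ → ℝ}
    (hF : ∀ᶠ i in l, ∀ P, HasDerivAt (F i) (F' i P) P) (hg : ∀ P, HasDerivAt g (g' P) P)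
    (hlim : TendstoLocallyUniformly F' g' l) {s : Set ℝ} (hs : IsCompact s) (hconv : Convex ℝ s)
    {K : ℝ≥0} (hK : 0 < K) : ∀ᶠ i in l, LipschitzOnWith K (fun P => F i P - g P) s := by
  have hunif := (tendstoLocallyUniformlyOn_iff_tendstoUniformlyOn_of_compact hs).1
    (hlim.tendstoLocallyUniformlyOn (s := s))
  filter_upwards [hF, Metric.tendstoUniformlyOn_iff.1 hunif K hK] with i hi hclose
  refine hconv.lipschitzOnWith_of_nnnorm_hasDerivWithin_le
    (fun P _ => ((hi P).sub (hg P)).hasDerivWithinAt) fun P hP => ?_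
  rw [← NNReal.coe_le_coe, coe_nnnorm, ← dist_eq_norm, dist_comm]
  exact (hclose P hP).le

section

variable {w : ℝ → ℝ} {p τ : ℝ} {n : ℕ}

lemma tendsto_parabolic_quotient (hw : Tempered w) (hτ : 0 < τ)
    (hzero : ∀ k, k ≠ 0 → k ≤ n → jet w k p τ = 0) (P₀ : ℝ) :
    Tendsto (fun q : ℝ × ℝ =>
        (q.1 ^ (n + 1))⁻¹ * (jet w 0 (p + q.1 * q.2) (τ - q.1 ^ 2) - jet w 0 p τ))
      (𝓝[≠] 0 ×ˢ 𝓝 P₀) (𝓝 (hermiteCoeff (n + 1) P₀ * jet w (n + 1) p τ)) := by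
  have hsum (ε P : ℝ) :
      parabolicSum (fun k => jet w k p τ) (n + 1) ε P = jet w 0 p τ := by
    rw [parabolicSum, Finset.sum_range_succ', Finset.sum_eq_zero fun k hk => ?_]
    · simp [hermiteCoeff]
    · rw [hzero _ k.succ_ne_zero (Finset.mem_range.1 hk), smul_zero]
  simpa only [parabolicRemainder, hsum, smul_eq_mul, zero_add] using
    tendsto_parabolicRemainder hw hτ p P₀ (n + 1) 0

lemma tendsto_deriv_parabolic_quotient (hw : Tempered w) (hτ : 0 < τ)
    (hzero : ∀ k, k ≠ 0 → k ≤ n → jet w k p τ = 0) (P₀ : ℝ) :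
    Tendsto (fun q : ℝ × ℝ => (q.1 ^ n)⁻¹ * jet w 1 (p + q.1 * q.2) (τ - q.1 ^ 2))
      (𝓝[≠] 0 ×ˢ 𝓝 P₀) (𝓝 (hermiteCoeff n P₀ * jet w (n + 1) p τ)) := by
  have hsum (ε P : ℝ) : parabolicSum (fun k => jet w (1 + k) p τ) n ε P = 0 :=
    Finset.sum_eq_zero fun k hk => smul_eq_zero_of_right _ <|
      hzero _ (by omega) (by have := Finset.mem_range.1 hk; omega)
  simpa only [parabolicRemainder, hsum, sub_zero, smul_eq_mul, add_comm 1 n] using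
    tendsto_parabolicRemainder hw hτ p P₀ n 1

lemma hasDerivAt_parabolic_quotient (hw : Tempered w) {ε : ℝ} (hε : ε ≠ 0) (hετ : ε ^ 2 < τ)
    (P : ℝ) :
    HasDerivAt (fun P =>
        (ε ^ (n + 1))⁻¹ * (jet w 0 (p + ε * P) (τ - ε ^ 2) - jet w 0 p τ))
      ((ε ^ n)⁻¹ * jet w 1 (p + ε * P) (τ - ε ^ 2)) P := by
  have hinner : HasDerivAt (fun P => p + ε * P) ε P := by
    simpa using ((hasDerivAt_id P).const_mul ε).const_add p
  have houter := hasDerivAt_jet hw 0 (p + ε * P) (sub_pos.2 hετ)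
  refine (((houter.comp P hinner).sub_const _).const_mul _).congr_deriv ?_
  field_simp
  ring_nf

lemma eventually_lipschitzOnWith_parabolic_quotient (hw : Tempered w) (hτ : 0 < τ)
    (hzero : ∀ k, k ≠ 0 → k ≤ n → jet w k p τ = 0) {s : Set ℝ} (hs : IsCompact s)
    (hconv : Convex ℝ s) {K : ℝ≥0} (hK : 0 < K) :
    ∀ᶠ ε in 𝓝[≠] 0, LipschitzOnWith K (fun P =>
      (ε ^ (n + 1))⁻¹ * (jet w 0 (p + ε * P) (τ - ε ^ 2) - jet w 0 p τ) -
        hermiteCoeff (n + 1) P * jet w (n + 1) p τ) s := by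
  have hsmall : ∀ᶠ ε : ℝ in 𝓝[≠] 0, ε ^ 2 < τ :=
    nhdsWithin_le_nhds (((continuous_pow 2).tendsto' 0 0 (by simp)).eventually_lt_const hτ)
  refine eventually_lipschitzOnWith_sub ?_
    (fun P => (hasDerivAt_hermiteCoeff_succ n P).mul_const (jet w (n + 1) p τ))
    (tendstoLocallyUniformly_of_forall_tendsto
      (F := fun ε P => (ε ^ n)⁻¹ * jet w 1 (p + ε * P) (τ - ε ^ 2))
      ((continuous_hermiteCoeff n).mul continuous_const)
      (tendsto_deriv_parabolic_quotient hw hτ hzero)) hs hconv hK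
  filter_upwards [self_mem_nhdsWithin, hsmall] with ε hε hετ
  exact hasDerivAt_parabolic_quotient hw hε hετ

end

lemma tendsto_sqrt_nhdsGT_zero : Tendsto Real.sqrt (𝓝[>] 0) (𝓝[≠] 0) :=
  tendsto_nhdsWithin_iff.2
    ⟨(Real.continuous_sqrt.tendsto' 0 0 Real.sqrt_zero).mono_left nhdsWithin_le_nhds,
      eventually_mem_nhdsWithin.mono fun _ hs => (Real.sqrt_pos.2 hs).ne'⟩

/-- For positive times, `f` is the heat extension of the path `w`. -/
structure IsHeatFlow (f : ℝ → ℝ → ℂ) (w : ℝ → ℂ) : Prop where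
  tempered : Tempered w
  eq_jet : ∀ p τ, 0 < τ → f p τ = jet w 0 p τ

namespace IsHeatFlow

variable {f : ℝ → ℝ → ℂ} {w : ℝ → ℂ} {p τ : ℝ}

lemma slice_eq (h : IsHeatFlow f w) (hτ : 0 < τ) : (f · τ) = (jet w 0 · τ) :=
  funext fun p => h.eq_jet p τ hτ

lemma continuousOn (h : IsHeatFlow f w) :
    ContinuousOn (fun q : ℝ × ℝ => f q.1 q.2) {q | 0 < q.2} :=
  (continuousOn_jet h.tempered 0).congr fun q hq => h.eq_jet q.1 q.2 hq

lemma analyticAt (h : IsHeatFlow f w) (hτ : 0 < τ) : AnalyticAt ℝ (f · τ) p := by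
  rw [h.slice_eq hτ]
  exact analyticAt_jet_zero h.tempered hτ p

lemma iteratedDeriv_slice (h : IsHeatFlow f w) (hτ : 0 < τ) (n : ℕ) (p : ℝ) :
    iteratedDeriv n (f · τ) p = jet w n p τ := by
  rw [h.slice_eq hτ, iteratedDeriv_jet h.tempered hτ, zero_add]

lemma jet_one_eq_zero (h : IsHeatFlow f w) (hτ : 0 < τ) (hsing : IsSingularity (f · τ) p) :
    jet w 1 p τ = 0 := by
  rw [← h.iteratedDeriv_slice hτ, iteratedDeriv_one]
  exact hsing.deriv

lemma jet_clm (h : IsHeatFlow f w) (hτ : 0 < τ) (L : ℂ →L[ℝ] ℝ) (n : ℕ) (p : ℝ) :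
    jet (fun t => L (w t)) n p τ = L (iteratedDeriv n (f · τ) p) := by
  rw [h.iteratedDeriv_slice hτ, clm_jet L h.tempered n p hτ]

lemma clm_apply_sub (h : IsHeatFlow f w) (hτ : 0 < τ) (L : ℂ →L[ℝ] ℝ) {s : ℝ} (hs : s < τ)
    (x : ℝ) :
    L (f x (τ - s) - f p τ) =
      jet (fun t => L (w t)) 0 x (τ - s) - jet (fun t => L (w t)) 0 p τ := by
  rw [map_sub, h.jet_clm hτ, h.jet_clm (sub_pos.2 hs), iteratedDeriv_zero, iteratedDeriv_zero]

lemma tendsto_quotient (h : IsHeatFlow f w) (hτ : 0 < τ) {L : ℂ →L[ℝ] ℝ} {n : ℕ}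
    (hzero : ∀ k, k ≠ 0 → k ≤ n → L (iteratedDeriv k (f · τ) p) = 0) (P₀ : ℝ) :
    Tendsto (fun q : ℝ × ℝ => (√q.1 ^ (n + 1))⁻¹ * L (f (p + √q.1 * q.2) (τ - q.1) - f p τ))
      (𝓝[>] 0 ×ˢ 𝓝 P₀)
      (𝓝 (hermiteCoeff (n + 1) P₀ * L (iteratedDeriv (n + 1) (f · τ) p))) := by
  have hlim := (tendsto_parabolic_quotient (h.tempered.clm_comp L) hτ
    (fun k hk hkn => (h.jet_clm hτ L k p).trans (hzero k hk hkn)) P₀).comp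
    (tendsto_sqrt_nhdsGT_zero.prodMap tendsto_id)
  rw [← h.jet_clm hτ L (n + 1)]
  refine hlim.congr' ?_
  have hmem : ∀ᶠ q : ℝ × ℝ in 𝓝[>] 0 ×ˢ 𝓝 P₀, q.1 ∈ Ioo 0 τ :=
    Eventually.prod_inl (Ioo_mem_nhdsGT hτ) _
  filter_upwards [hmem] with q hq
  simp only [Function.comp_apply, Prod.map_fst, Prod.map_snd, id_eq, Real.sq_sqrt hq.1.le,
    h.clm_apply_sub hτ L hq.2]

lemma eventually_lipschitzOnWith_quotient (h : IsHeatFlow f w) (hτ : 0 < τ) {L : ℂ →L[ℝ] ℝ}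
    {n : ℕ} (hzero : ∀ k, k ≠ 0 → k ≤ n → L (iteratedDeriv k (f · τ) p) = 0) {S : Set ℝ}
    (hS : IsCompact S) (hconv : Convex ℝ S) {K : ℝ≥0} (hK : 0 < K) :
    ∀ᶠ s in 𝓝[>] 0, LipschitzOnWith K (fun P =>
      (√s ^ (n + 1))⁻¹ * L (f (p + √s * P) (τ - s) - f p τ) -
        hermiteCoeff (n + 1) P * L (iteratedDeriv (n + 1) (f · τ) p)) S := by
  have hlip := tendsto_sqrt_nhdsGT_zero.eventually <|
    eventually_lipschitzOnWith_parabolic_quotient (h.tempered.clm_comp L) hτ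
      (fun k hk hkn => (h.jet_clm hτ L k p).trans (hzero k hk hkn)) hS hconv hK
  filter_upwards [hlip, Ioo_mem_nhdsGT hτ] with s hs hsτ
  simpa only [Real.sq_sqrt hsτ.1.le, h.jet_clm hτ L (n + 1), h.clm_apply_sub hτ L hsτ.2] using hs

end IsHeatFlow

/-! ### The rescaled curves -/

section Rescaled

variable {f : ℝ → ℝ → ℂ} {c : ℂ} {p₀ τ₀ s : ℝ}

lemma rescaled_re (hs : 0 < s) (P : ℝ) : (rescaled f c p₀ τ₀ s P).re =
    (√s ^ 2)⁻¹ * reMul c (f (p₀ + √s * P) (τ₀ - s) - f p₀ τ₀) := by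
  rw [Real.sq_sqrt hs.le]
  rfl

lemma rescaled_im (hs : 0 < s) (P : ℝ) : (rescaled f c p₀ τ₀ s P).im =
    (√s ^ 3)⁻¹ * imMul c (f (p₀ + √s * P) (τ₀ - s) - f p₀ τ₀) := by
  have hpow : s ^ (-(3 / 2) : ℝ) = (√s ^ 3)⁻¹ := by
    rw [Real.sqrt_eq_rpow, ← Real.rpow_natCast, ← Real.rpow_mul hs.le, ← Real.rpow_neg hs.le]
    norm_num
  rw [← hpow]
  rfl

lemma rescaled_eq_iff (hc : c ≠ 0) (hs : 0 < s) (x y : ℝ) :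
    rescaled f c p₀ τ₀ s x = rescaled f c p₀ τ₀ s y ↔
      f (p₀ + √s * x) (τ₀ - s) = f (p₀ + √s * y) (τ₀ - s) := by
  refine ⟨fun h => ?_, fun h => by simp only [rescaled, h]⟩
  have hre := mul_left_cancel₀ (inv_ne_zero hs.ne') (congrArg Complex.re h)
  have him := mul_left_cancel₀ (Real.rpow_pos_of_pos hs _).ne' (congrArg Complex.im h)
  exact sub_left_injective (mul_left_cancel₀ hc (Complex.ext hre him))

end Rescaled

namespace IsNaturalFrame

variable {f : ℝ → ℝ → ℂ} {w : ℝ → ℂ} {p₀ τ₀ : ℝ} {c : ℂ} {a b : ℕ → ℝ}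

lemma ne_zero {γ : ℝ → ℂ} {t₀ : ℝ} (h : IsNaturalFrame γ t₀ c a b) : c ≠ 0 :=
  norm_ne_zero_iff.1 (by rw [h.norm_eq_one]; exact one_ne_zero)

lemma tendsto_rescaled (h : IsNaturalFrame (f · τ₀) p₀ c a b) (hf : IsHeatFlow f w)
    (hτ : 0 < τ₀) (P : ℝ) :
    Tendsto (fun q : ℝ × ℝ => rescaled f c p₀ τ₀ q.1 q.2) (𝓝[>] 0 ×ˢ 𝓝 P)
      (𝓝 (limitCurve (a 2) (b 3) P)) := by
  have hγ : AnalyticAt ℝ (f · τ₀) p₀ := hf.analyticAt hτ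
  have hre := hf.tendsto_quotient hτ (h.reMul_iteratedDeriv_eq_zero hγ) P
  have him := hf.tendsto_quotient hτ (h.imMul_iteratedDeriv_eq_zero hγ) P
  rw [h.reMul_iteratedDeriv hγ two_ne_zero, hermiteCoeff_two] at hre
  rw [h.imMul_iteratedDeriv hγ three_ne_zero, hermiteCoeff_three] at him
  have hlimit : limitCurve (a 2) (b 3) P = Complex.equivRealProdCLM.symm
      ((P ^ 2 - 1) / 2 * (Nat.factorial 2 * a 2),
        (P ^ 3 - 3 * P) / 6 * (Nat.factorial 3 * b 3)) := by
    apply Complex.ext <;> simp [limitCurve, Nat.factorial] <;> ring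
  rw [hlimit]
  refine ((Complex.equivRealProdCLM.symm.continuous.tendsto _).comp
    (hre.prodMk_nhds him)).congr' ?_
  have hpos : ∀ᶠ q : ℝ × ℝ in 𝓝[>] 0 ×ˢ 𝓝 P, 0 < q.1 := eventually_mem_nhdsWithin.prod_inl _
  filter_upwards [hpos] with q hq
  exact Complex.ext (rescaled_re hq q.2).symm (rescaled_im hq q.2).symm

lemma eventually_isCuspPerturbation (h : IsNaturalFrame (f · τ₀) p₀ c a b)
    (hf : IsHeatFlow f w) (hτ : 0 < τ₀) :
    ∀ᶠ s in 𝓝[>] 0, IsCuspPerturbation (fun P => (a 2)⁻¹ * (rescaled f c p₀ τ₀ s P).re)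
      fun P => (b 3)⁻¹ * (rescaled f c p₀ τ₀ s P).im := by
  have hγ : AnalyticAt ℝ (f · τ₀) p₀ := hf.analyticAt hτ
  have hfst := hf.eventually_lipschitzOnWith_quotient (p := p₀) (L := (a 2)⁻¹ • reMul c)
    (n := 1) hτ
    (fun i hi hi₁ => by
      rw [smul_apply, h.reMul_iteratedDeriv_eq_zero hγ i hi hi₁, smul_zero])
    (isCompact_Icc (a := -2) (b := 2)) (convex_Icc _ _) (K := 1 / 40) (by norm_num)
  have hsnd := hf.eventually_lipschitzOnWith_quotient (p := p₀) (L := (b 3)⁻¹ • imMul c)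
    (n := 2) hτ
    (fun i hi hi₂ => by
      rw [smul_apply, h.imMul_iteratedDeriv_eq_zero hγ i hi hi₂, smul_zero])
    (isCompact_Icc (a := -2) (b := 2)) (convex_Icc _ _) (K := 1 / 40) (by norm_num)
  filter_upwards [hfst, hsnd, eventually_mem_nhdsWithin] with s hx hy hs
  refine ⟨?_, ?_⟩
  · have ha := h.a_two
    convert! hx using 2 with P
    simp only [smul_apply, smul_eq_mul, rescaled_re hs, Nat.reduceAdd,
      h.reMul_iteratedDeriv hγ two_ne_zero, hermiteCoeff_two, Nat.factorial]
    field_simp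
    push_cast
    ring
  · have hb := h.b_three
    convert! hy using 2 with P
    simp only [smul_apply, smul_eq_mul, rescaled_im hs, Nat.reduceAdd,
      h.imMul_iteratedDeriv hγ three_ne_zero, hermiteCoeff_three, Nat.factorial]
    field_simp
    push_cast
    ring

end IsNaturalFrame

/-! ### The loops near a cusp -/

section Branch

variable {f : ℝ → ℝ → ℂ} {p₀ τ₀ δ : ℝ} {A B : ℝ → ℝ}

/-- The pair of functions `A`, `B` describes, for `0 < s ≤ δ`, the only double point in `[-2, 2]` of
the curve `P ↦ f (p₀ + √s P) (τ₀ - s)`, which differs from the rescaled curve at time `τ₀ - s` by an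
affine map of the plane. The numerical bounds keep `A` and `B` close to `-√3` and `√3`. -/
structure IsDoubleBranch (f : ℝ → ℝ → ℂ) (p₀ τ₀ δ : ℝ) (A B : ℝ → ℝ) : Prop where
  left_mem : ∀ s ∈ Ioc 0 δ, A s ∈ Icc (-1.8) (-1.6)
  right_mem : ∀ s ∈ Ioc 0 δ, B s ∈ Icc 1.6 1.8
  double : ∀ s ∈ Ioc 0 δ,
    IsUniqueDouble (fun P => f (p₀ + √s * P) (τ₀ - s)) (Icc (-2) 2) (A s) (B s)

lemma IsNaturalFrame.exists_isUniqueDouble {c : ℂ} {a b : ℕ → ℝ} {s : ℝ}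
    (h : IsNaturalFrame (f · τ₀) p₀ c a b) (hs : 0 < s)
    (hper : IsCuspPerturbation (fun P => (a 2)⁻¹ * (rescaled f c p₀ τ₀ s P).re)
      fun P => (b 3)⁻¹ * (rescaled f c p₀ τ₀ s P).im) :
    ∃ A ∈ Icc (-1.8 : ℝ) (-1.6), ∃ B ∈ Icc (1.6 : ℝ) 1.8,
      IsUniqueDouble (fun P => f (p₀ + √s * P) (τ₀ - s)) (Icc (-2) 2) A B := by
  obtain ⟨A, hA, B, hB, hAB⟩ := IsCuspPerturbation.exists_isUniqueDouble (γ := fun P =>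
    ⟨(a 2)⁻¹ * (rescaled f c p₀ τ₀ s P).re, (b 3)⁻¹ * (rescaled f c p₀ τ₀ s P).im⟩) hper
  refine ⟨A, hA, B, hB, hAB.congr fun x y => ?_⟩
  simp only [← rescaled_eq_iff h.ne_zero hs, Complex.ext_iff,
    mul_right_inj' (inv_ne_zero h.a_two), mul_right_inj' (inv_ne_zero h.b_three)]

lemma IsNaturalFrame.exists_isDoubleBranch {w : ℝ → ℂ} {c : ℂ} {a b : ℕ → ℝ}
    (h : IsNaturalFrame (f · τ₀) p₀ c a b) (hf : IsHeatFlow f w) (hp : 0 < p₀) (hτ : 0 < τ₀) :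
    ∃ δ A B, 0 < δ ∧ δ < τ₀ ∧ 2 * √δ < p₀ ∧ IsDoubleBranch f p₀ τ₀ δ A B := by
  have hdouble : ∀ᶠ s in 𝓝[>] 0, ∃ a ∈ Icc (-1.8 : ℝ) (-1.6), ∃ b ∈ Icc (1.6 : ℝ) 1.8,
      IsUniqueDouble (fun P => f (p₀ + √s * P) (τ₀ - s)) (Icc (-2) 2) a b := by
    filter_upwards [h.eventually_isCuspPerturbation hf hτ, self_mem_nhdsWithin] with s hper hs
    exact h.exists_isUniqueDouble hs hper
  have hsmall : ∀ᶠ s : ℝ in 𝓝[>] 0, s < τ₀ ∧ 2 * √s < p₀ := by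
    have hsqrt : Continuous fun s : ℝ => 2 * √s := by fun_prop
    exact nhdsWithin_le_nhds <| (eventually_lt_nhds hτ).and <|
      (hsqrt.tendsto' 0 0 (by simp)).eventually_lt_const hp
  obtain ⟨δ, hδ, hsub⟩ := mem_nhdsGT_iff_exists_Ioc_subset.1 (hdouble.and hsmall)
  choose! A hA B hB hAB using fun s (hs : s ∈ Ioc 0 δ) => (hsub hs).1
  obtain ⟨-, hδτ, hδp⟩ := hsub (right_mem_Ioc.2 hδ)
  exact ⟨δ, A, B, hδ, hδτ, hδp, hA, hB, hAB⟩

/-- The loop of `f` at time `τ` given by a branch of double points. -/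
noncomputable def branchLoop (f : ℝ → ℝ → ℂ) (p₀ τ₀ : ℝ) (A B : ℝ → ℝ) (τ : ℝ) : Curve :=
  arc (f · τ) (p₀ + √(τ₀ - τ) * A (τ₀ - τ)) (p₀ + √(τ₀ - τ) * B (τ₀ - τ))

lemma continuous_slice (hf : ContinuousOn (fun q : ℝ × ℝ => f q.1 q.2) {q | 0 < q.2}) {τ : ℝ}
    (hτ : 0 < τ) : Continuous (f · τ) :=
  hf.comp_continuous (f := fun p => (p, τ)) (by fun_prop) fun _ => hτ

lemma continuousAt_uncurry (hf : ContinuousOn (fun q : ℝ × ℝ => f q.1 q.2) {q | 0 < q.2}) (p : ℝ)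
    {τ : ℝ} (hτ : 0 < τ) : ContinuousAt (fun q : ℝ × ℝ => f q.1 q.2) (p, τ) :=
  hf.continuousAt ((isOpen_lt continuous_const continuous_snd).mem_nhds hτ)

lemma tendsto_sqrt_sub (τ₀ : ℝ) : Tendsto (fun τ => √(τ₀ - τ)) (𝓝[<] τ₀) (𝓝 0) := by
  have hcont : Continuous fun τ => √(τ₀ - τ) := by fun_prop
  exact (hcont.tendsto' τ₀ 0 (by simp)).mono_left nhdsWithin_le_nhds

namespace IsDoubleBranch

lemma sub_mem_Ioc {τ : ℝ} (hτ : τ ∈ Ico (τ₀ - δ) τ₀) : τ₀ - τ ∈ Ioc 0 δ :=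
  ⟨sub_pos.2 hτ.2, sub_le_comm.1 hτ.1⟩

variable (h : IsDoubleBranch f p₀ τ₀ δ A B)
include h

lemma double_unscaled {τ : ℝ} (hτ : τ ∈ Ico (τ₀ - δ) τ₀) :
    IsUniqueDouble (f · τ) (Icc (p₀ - 2 * √(τ₀ - τ)) (p₀ + 2 * √(τ₀ - τ)))
      (p₀ + √(τ₀ - τ) * A (τ₀ - τ)) (p₀ + √(τ₀ - τ) * B (τ₀ - τ)) := by
  have hd := h.double _ (sub_mem_Ioc hτ)
  rw [sub_sub_cancel] at hd
  exact hd.affine (γ := (f · τ)) (Real.sqrt_pos.2 (sub_mem_Ioc hτ).1)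

variable (hf : ContinuousOn (fun q : ℝ × ℝ => f q.1 q.2) {q | 0 < q.2}) (hδ : δ < τ₀)
include hf hδ

lemma continuousOn : ContinuousOn (fun s => (A s, B s)) (Ioc 0 δ) := by
  intro s hs
  have ht : 0 < τ₀ - s := sub_pos.2 (hs.2.trans_lt hδ)
  have hslice : Continuous fun P => f (p₀ + √s * P) (τ₀ - s) :=
    (continuous_slice hf ht).comp (by fun_prop)
  have hlim : TendstoLocallyUniformly (fun s P => f (p₀ + √s * P) (τ₀ - s))
      (fun P => f (p₀ + √s * P) (τ₀ - s)) (𝓝[Ioc 0 δ] s) := by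
    refine tendstoLocallyUniformly_of_forall_tendsto hslice fun P => ?_
    refine Tendsto.mono_left ?_ (Filter.prod_mono nhdsWithin_le_nhds le_rfl)
    rw [← nhds_prod_eq]
    exact (continuousAt_uncurry hf (p₀ + √s * P) ht).comp
      (f := fun z : ℝ × ℝ => (p₀ + √z.1 * z.2, τ₀ - z.1)) (x := (s, P)) (by fun_prop)
  refine tendsto_of_apply_fst_eq_apply_snd hlim hslice (K := Icc (-1.8) (-1.6) ×ˢ Icc 1.6 1.8)
    (isCompact_Icc.prod isCompact_Icc) ?_ fun y hy he => ?_
  · filter_upwards [self_mem_nhdsWithin] with t ht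
    exact ⟨⟨h.left_mem t ht, h.right_mem t ht⟩, (h.double t ht).eq⟩
  · obtain ⟨⟨hl, hl'⟩, hr, hr'⟩ := hy
    exact Prod.ext_iff.2 <| (h.double s hs).unique y.1 y.2 (by linarith)
      (Icc_subset_Icc (by linarith) (by linarith)) he

variable {τ : ℝ} (hτ : τ ∈ Ico (τ₀ - δ) τ₀)
include hτ

lemma isUniqueLoopIn :
    IsUniqueLoopIn (f · τ) (Icc (p₀ - 2 * √(τ₀ - τ)) (p₀ + 2 * √(τ₀ - τ)))
      (branchLoop f p₀ τ₀ A B τ) :=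
  (h.double_unscaled hτ).isUniqueLoopIn_arc
    (continuous_slice hf (by linarith [hτ.1])).continuousOn

lemma branchLoop_left : (branchLoop f p₀ τ₀ A B τ).left = p₀ + √(τ₀ - τ) * A (τ₀ - τ) :=
  arc_left (h.double_unscaled hτ).lt (continuous_slice hf (by linarith [hτ.1])).continuousOn

lemma branchLoop_right : (branchLoop f p₀ τ₀ A B τ).right = p₀ + √(τ₀ - τ) * B (τ₀ - τ) :=
  arc_right (h.double_unscaled hτ).lt (continuous_slice hf (by linarith [hτ.1])).continuousOn

omit hτ in
lemma isLoopEvolution : IsLoopEvolution f (τ₀ - δ) τ₀ (branchLoop f p₀ τ₀ A B) := by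
  have hcont : ContinuousOn (fun τ => (A (τ₀ - τ), B (τ₀ - τ))) (Ico (τ₀ - δ) τ₀) :=
    (h.continuousOn hf hδ).comp (f := fun τ => τ₀ - τ) (by fun_prop) fun _ => sub_mem_Ioc
  have hendpoint {C : ℝ → ℝ} (hC : ContinuousOn (fun τ => C (τ₀ - τ)) (Ico (τ₀ - δ) τ₀)) :
      ContinuousOn (fun τ => p₀ + √(τ₀ - τ) * C (τ₀ - τ)) (Ico (τ₀ - δ) τ₀) :=
    continuousOn_const.add (ContinuousOn.mul (by fun_prop) hC)
  have hleft : ContinuousOn (fun τ => (branchLoop f p₀ τ₀ A B τ).left) (Ico (τ₀ - δ) τ₀) :=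
    (hendpoint hcont.fst).congr fun _ ht => h.branchLoop_left hf hδ ht
  have hright : ContinuousOn (fun τ => (branchLoop f p₀ τ₀ A B τ).right) (Ico (τ₀ - δ) τ₀) :=
    (hendpoint hcont.snd).congr fun _ ht => h.branchLoop_right hf hδ ht
  have hrestriction (τ) (hτ : τ ∈ Ico (τ₀ - δ) τ₀) := (h.isUniqueLoopIn hf hδ hτ).isLoop.restriction
  refine ⟨fun τ hτ => ?_, fun τ hτ => (h.isUniqueLoopIn hf hδ hτ).isLoop⟩
  have hpos : 0 < τ := by linarith [hτ.1]
  have hlim : TendstoLocallyUniformly (fun τ p => f p τ) (f · τ) (𝓝[Ico (τ₀ - δ) τ₀] τ) := by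
    refine tendstoLocallyUniformly_of_forall_tendsto (continuous_slice hf hpos) fun p => ?_
    refine Tendsto.mono_left ?_ (Filter.prod_mono nhdsWithin_le_nhds le_rfl)
    rw [← nhds_prod_eq]
    exact (continuousAt_uncurry hf p hpos).comp
      (f := fun z : ℝ × ℝ => (z.2, z.1)) (x := (τ, p)) (by fun_prop)
  exact tendsto_curve hlim (continuous_slice hf hpos)
    (eventually_mem_nhdsWithin.mono hrestriction) (hrestriction τ hτ) (hleft τ hτ) (hright τ hτ)

lemma branchLoop_bounds :
    p₀ - 2 * √(τ₀ - τ) < (branchLoop f p₀ τ₀ A B τ).left ∧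
      (branchLoop f p₀ τ₀ A B τ).left < p₀ ∧ p₀ < (branchLoop f p₀ τ₀ A B τ).right ∧
      (branchLoop f p₀ τ₀ A B τ).right < p₀ + 2 * √(τ₀ - τ) := by
  have hpos : 0 < √(τ₀ - τ) := Real.sqrt_pos.2 (sub_mem_Ioc hτ).1
  have hA := h.left_mem _ (sub_mem_Ioc hτ)
  have hB := h.right_mem _ (sub_mem_Ioc hτ)
  rw [h.branchLoop_left hf hδ hτ, h.branchLoop_right hf hδ hτ]
  refine ⟨?_, ?_, ?_, ?_⟩ <;> nlinarith [hA.1, hA.2, hB.1, hB.2]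

omit hτ in
lemma diesAt (hδ₀ : 0 < δ) : DiesAt f (τ₀ - δ) (branchLoop f p₀ τ₀ A B) p₀ τ₀ := by
  have hbounds : ∀ᶠ τ in 𝓝[<] τ₀, τ ∈ Ico (τ₀ - δ) τ₀ := Ico_mem_nhdsLT (sub_lt_self τ₀ hδ₀)
  replace hbounds := hbounds.mono fun τ hτ => h.branchLoop_bounds hf hδ hτ
  have hleft : Tendsto (fun τ => (branchLoop f p₀ τ₀ A B τ).left) (𝓝[<] τ₀) (𝓝 p₀) := by
    have hlower : Tendsto (fun τ => p₀ - 2 * √(τ₀ - τ)) (𝓝[<] τ₀) (𝓝 p₀) := by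
      simpa using ((tendsto_sqrt_sub τ₀).const_mul 2).const_sub p₀
    exact tendsto_of_tendsto_of_tendsto_of_le_of_le' hlower tendsto_const_nhds
      (hbounds.mono fun _ hb => hb.1.le) (hbounds.mono fun _ hb => hb.2.1.le)
  have hlength : Tendsto (fun τ => (branchLoop f p₀ τ₀ A B τ).right -
      (branchLoop f p₀ τ₀ A B τ).left) (𝓝[<] τ₀) (𝓝 0) := by
    refine squeeze_zero' (.of_forall fun τ => sub_nonneg.2 (Curve.left_lt_right _).le)
      (hbounds.mono fun τ hb => ?_) (g := fun τ => 4 * √(τ₀ - τ))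
      (by simpa using (tendsto_sqrt_sub τ₀).const_mul 4)
    linarith [hb.1, hb.2.2.2]
  refine ⟨h.isLoopEvolution hf hδ, ?_, hleft, hlength⟩
  exact vanishesAfter_of_unique (sub_lt_self τ₀ hδ₀) (h.isLoopEvolution hf hδ)
    (fun τ hτ => h.isUniqueLoopIn hf hδ hτ) (by fun_prop) (by fun_prop)
    (fun τ hτ => ⟨(h.branchLoop_bounds hf hδ hτ).1, (h.branchLoop_bounds hf hδ hτ).2.2.2⟩) hlength

end IsDoubleBranch

lemma continuous_rescaled (hf : ContinuousOn (fun q : ℝ × ℝ => f q.1 q.2) {q | 0 < q.2}) (c : ℂ)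
    {s : ℝ} (hs : s < τ₀) : Continuous (rescaled f c p₀ τ₀ s) := by
  have hslice : Continuous fun P => f (p₀ + √s * P) (τ₀ - s) :=
    (continuous_slice hf (sub_pos.2 hs)).comp (by fun_prop)
  have hmoved : Continuous fun P => c * (f (p₀ + √s * P) (τ₀ - s) - f p₀ τ₀) :=
    continuous_const.mul (hslice.sub continuous_const)
  exact Complex.equivRealProdCLM.symm.continuous.comp <|
    (continuous_const.mul (Complex.continuous_re.comp hmoved)).prodMk
      (continuous_const.mul (Complex.continuous_im.comp hmoved))

namespace IsDoubleBranch

variable {c : ℂ} (h : IsDoubleBranch f p₀ τ₀ δ A B)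
include h

lemma isUniqueDouble_rescaled (hc : c ≠ 0) {s : ℝ} (hs : s ∈ Ioc 0 δ) :
    IsUniqueDouble (rescaled f c p₀ τ₀ s) (Icc (-2) 2) (A s) (B s) :=
  (h.double s hs).congr (rescaled_eq_iff hc hs.1)

variable (hf : ContinuousOn (fun q : ℝ × ℝ => f q.1 q.2) {q | 0 < q.2}) (hδ : δ < τ₀)
include hf hδ

lemma isUniqueLoopIn_rescaled (hc : c ≠ 0) {s : ℝ} (hs : s ∈ Ioc 0 δ) :
    IsUniqueLoopIn (rescaled f c p₀ τ₀ s) (Icc (-2) 2) (arc (rescaled f c p₀ τ₀ s) (A s) (B s)) :=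
  (h.isUniqueDouble_rescaled hc hs).isUniqueLoopIn_arc
    (continuous_rescaled hf c (hs.2.trans_lt hδ)).continuousOn

lemma tendsto_rescaled_loop (hδ₀ : 0 < δ) (hc : c ≠ 0) {a b : ℝ} (ha : a ≠ 0) (hb : b ≠ 0)
    (hlim : TendstoLocallyUniformly (rescaled f c p₀ τ₀) (limitCurve a b) (𝓝[>] 0)) :
    Tendsto (fun s => arc (rescaled f c p₀ τ₀ s) (A s) (B s)) (𝓝[>] 0) (𝓝 (limitLoop a b)) := by
  have hmem : ∀ᶠ s in 𝓝[>] (0 : ℝ), s ∈ Ioc 0 δ := Ioc_mem_nhdsGT hδ₀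
  have hcont (s) (hs : s ∈ Ioc 0 δ) : ContinuousOn (rescaled f c p₀ τ₀ s) (Icc (A s) (B s)) :=
    (continuous_rescaled hf c (hs.2.trans_lt hδ)).continuousOn
  have hlt (s) (hs : s ∈ Ioc 0 δ) : A s < B s := (h.double s hs).lt
  have hends : Tendsto (fun s => (A s, B s)) (𝓝[>] 0) (𝓝 (-√3, √3)) := by
    refine tendsto_of_apply_fst_eq_apply_snd hlim (continuous_limitCurve a b)
      (isCompact_Icc.prod isCompact_Icc) (hmem.mono fun s hs =>
        ⟨⟨h.left_mem s hs, h.right_mem s hs⟩, (h.isUniqueDouble_rescaled hc hs).eq⟩)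
      fun y hy he => ?_
    exact Prod.ext_iff.2 ((limitCurve_eq_iff ha hb (by linarith [hy.1.2, hy.2.1])).1 he)
  refine tendsto_curve hlim (continuous_limitCurve a b)
    (hmem.mono fun s hs => arc_toFun (hlt s hs) (hcont s hs)) (fun _ => rfl) ?_ ?_
  · exact (hends.fst_nhds).congr' (hmem.mono fun s hs => (arc_left (hlt s hs) (hcont s hs)).symm)
  · exact (hends.snd_nhds).congr' (hmem.mono fun s hs => (arc_right (hlt s hs) (hcont s hs)).symm)

end IsDoubleBranch

theorem IsHeatFlow.cusp_formation {w : ℝ → ℂ} (hf : IsHeatFlow f w) (hp : 0 < p₀) (hτ : 0 < τ₀)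
    (hsing : IsSingularity (f · τ₀) p₀)
    (hdet : (starRingEnd ℂ (jet w 2 p₀ τ₀) * jet w 3 p₀ τ₀).im ≠ 0) :
    IsCuspSingularity (f · τ₀) p₀ ∧
      ∃ δ : ℝ, 0 < δ ∧ δ < τ₀ ∧
        (∃ (l r : ℝ → ℝ) (L : ℝ → Curve),
          (∀ τ ∈ Ico (τ₀ - δ) τ₀, 0 < l τ ∧ p₀ ∈ Ioo (l τ) (r τ) ∧
            IsUniqueLoopIn (f · τ) (Icc (l τ) (r τ)) (L τ)) ∧
          MonotoneOn l (Ico (τ₀ - δ) τ₀) ∧ AntitoneOn r (Ico (τ₀ - δ) τ₀) ∧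
          Tendsto l (𝓝[<] τ₀) (𝓝 p₀) ∧ Tendsto r (𝓝[<] τ₀) (𝓝 p₀) ∧
          DiesAt f (τ₀ - δ) L p₀ τ₀) ∧
        ∀ (c : ℂ) (a b : ℕ → ℝ), IsNaturalFrame (f · τ₀) p₀ c a b →
          IsUniqueLoopIn (limitCurve (a 2) (b 3)) univ (limitLoop (a 2) (b 3)) ∧
          ∃ Lhat : ℝ → Curve,
            (∀ s ∈ Ioc 0 δ, IsUniqueLoopIn (rescaled f c p₀ τ₀ s) (Icc (-2) 2) (Lhat s)) ∧
            Tendsto Lhat (𝓝[>] 0) (𝓝 (limitLoop (a 2) (b 3))) := by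
  have hcusp : IsCuspSingularity (f · τ₀) p₀ :=
    isCuspSingularity_of_im_conj_mul_ne_zero (hf.analyticAt hτ) hsing <| by
      rwa [hf.iteratedDeriv_slice hτ, hf.iteratedDeriv_slice hτ]
  obtain ⟨c, a, b, hframe⟩ := hcusp.exists_frame
  obtain ⟨δ, A, B, hδ₀, hδ, hδp, hAB⟩ := hframe.exists_isDoubleBranch hf hp hτ
  have hpos (τ) (hτ' : τ ∈ Ico (τ₀ - δ) τ₀) : 0 < √(τ₀ - τ) := Real.sqrt_pos.2 (sub_pos.2 hτ'.2)
  have hlower (τ) (hτ' : τ ∈ Ico (τ₀ - δ) τ₀) : 0 < p₀ - 2 * √(τ₀ - τ) := by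
    linarith [Real.sqrt_le_sqrt (IsDoubleBranch.sub_mem_Ioc hτ').2]
  refine ⟨hcusp, δ, hδ₀, hδ, ⟨fun τ => p₀ - 2 * √(τ₀ - τ), fun τ => p₀ + 2 * √(τ₀ - τ),
    branchLoop f p₀ τ₀ A B, fun τ hτ' => ⟨hlower τ hτ', ⟨?_, ?_⟩,
      hAB.isUniqueLoopIn hf.continuousOn hδ hτ'⟩, fun τ _ τ' _ hle => ?_, fun τ _ τ' _ hle => ?_,
    ?_, ?_, hAB.diesAt hf.continuousOn hδ hδ₀⟩, fun c a b hframe => ?_⟩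
  · linarith [hpos τ hτ']
  · linarith [hpos τ hτ']
  · dsimp only
    gcongr
  · dsimp only
    gcongr
  · simpa using ((tendsto_sqrt_sub τ₀).const_mul 2).const_sub p₀
  · simpa using ((tendsto_sqrt_sub τ₀).const_mul 2).const_add p₀
  · have hlim := tendstoLocallyUniformly_of_forall_tendsto (continuous_limitCurve (a 2) (b 3))
      (hframe.tendsto_rescaled hf hτ)
    exact ⟨isUniqueLoopIn_limitLoop hframe.a_two hframe.b_three,
      fun s => arc (rescaled f c p₀ τ₀ s) (A s) (B s),
      fun s hs => hAB.isUniqueLoopIn_rescaled hf.continuousOn hδ hframe.ne_zero hs,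
      hAB.tendsto_rescaled_loop hf.continuousOn hδ hδ₀ hframe.ne_zero hframe.a_two hframe.b_three
        hlim⟩

end Branch

/-! ### Perturbation by ramps -/

section Ramp

lemma integrable_abs_pow_mul_exp_neg_abs (n : ℕ) :
    Integrable fun t : ℝ => |t| ^ n * Real.exp (-|t|) := by
  have hfact : ∫ x in Ioi (0 : ℝ), x ^ n * Real.exp (-x) = n.factorial := by
    rw [← Real.Gamma_nat_eq_factorial, Real.Gamma_eq_integral (by positivity)]
    simp [mul_comm]
  refine .of_integral_ne_zero ?_
  rw [integral_comp_abs (f := fun x => x ^ n * Real.exp (-x)), hfact]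
  positivity

protected lemma Tempered.of_continuous_of_norm_le {E : Type*} [NormedAddCommGroup E]
    [NormedSpace ℝ E] {w : ℝ → E} {C : ℝ} (hw : Continuous w) (hC : ∀ t, ‖w t‖ ≤ C) :
    Tempered w := by
  have hexp : Integrable fun t : ℝ => Real.exp (-|t|) := by
    simpa only [pow_zero, one_mul] using integrable_abs_pow_mul_exp_neg_abs 0
  exact hexp.smul_bdd C hw.aestronglyMeasurable (.of_forall hC)

/-- The function that vanishes up to time `k` and grows linearly to `1` on `[k, k + 1]`. -/
noncomputable def ramp (k t : ℝ) : ℝ := max 0 (min 1 (t - k))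

lemma continuous_ramp (k : ℝ) : Continuous (ramp k) := by unfold ramp; fun_prop

lemma ramp_mem_Icc (k t : ℝ) : ramp k t ∈ Icc 0 1 :=
  ⟨le_max_left _ _, max_le zero_le_one (min_le_left _ _)⟩

lemma tempered_ramp (k : ℝ) : Tempered (ramp k) :=
  .of_continuous_of_norm_le (continuous_ramp k) fun t => by
    rw [Real.norm_of_nonneg (ramp_mem_Icc k t).1]
    exact (ramp_mem_Icc k t).2

lemma ramp_eq_measureReal (k t : ℝ) : ramp k t = volume.real (Ioc k (k + 1) ∩ Iic t) := by
  rw [Ioc_inter_Iic, Real.volume_real_Ioc, ramp, max_comm, ← min_sub_sub_right, add_sub_cancel_left]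

lemma integral_ramp_mul {ψ ψ' : ℝ → ℝ} (k : ℝ) (hψ : ∀ t, HasDerivAt ψ (ψ' t) t)
    (hint : Integrable ψ) (hint' : Integrable ψ') :
    ∫ t, ramp k t * ψ' t = -∫ t in k..(k + 1), ψ t := by
  have htail (s : ℝ) : ∫ t in Ici s, ψ' t = -ψ s := by
    rw [integral_Ici_eq_integral_Ioi, ← zero_sub]
    exact integral_Ioi_of_hasDerivAt_of_tendsto' (fun t _ => hψ t) hint'.integrableOn
      (tendsto_zero_of_hasDerivAt_of_integrableOn_Ioi (a := s) (fun t _ => hψ t)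
        hint'.integrableOn hint.integrableOn)
  have hramp (t : ℝ) : ramp k t * ψ' t = ∫ s in Ioc k (k + 1), (Ici s).indicator ψ' t := by
    have (s : ℝ) : (Ici s).indicator ψ' t = (Iic t).indicator (fun _ => ψ' t) s := by
      simp only [indicator_apply, mem_Ici, mem_Iic]
    simp only [this]
    rw [setIntegral_indicator measurableSet_Iic, setIntegral_const, ramp_eq_measureReal,
      smul_eq_mul]
  have hswap : Integrable (Function.uncurry fun t s => (Ici s).indicator ψ' t)
      (volume.prod (volume.restrict (Ioc k (k + 1)))) := by
    have hmeas : MeasurableSet {q : ℝ × ℝ | q.2 ≤ q.1} :=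
      measurableSet_le measurable_snd measurable_fst
    exact (hint'.comp_fst (volume.restrict (Ioc k (k + 1)))).indicator hmeas
  simp only [hramp]
  rw [integral_integral_swap hswap, intervalIntegral.integral_of_le (by simp), ← integral_neg]
  simp only [integral_indicator measurableSet_Ici, htail]

lemma jet_ramp (k : ℝ) (j : ℕ) (p : ℝ) {τ : ℝ} (hτ : 0 < τ) :
    jet (ramp k) (j + 1) p τ = ∫ t in k..(k + 1), heatKernel j (p - t) τ := by
  have hint (i : ℕ) : Integrable fun t => heatKernel i (p - t) τ := by
    have hone : Tempered fun _ : ℝ => (1 : ℝ) :=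
      .of_continuous_of_norm_le continuous_const fun _ => norm_one.le
    simpa using hone.integrable_heatKernel_smul i p hτ
  have hderiv (t : ℝ) :
      HasDerivAt (fun t => heatKernel j (p - t) τ) (-heatKernel (j + 1) (p - t) τ) t :=
    (hasDerivAt_heatKernel j (p - t) hτ).scomp t ((hasDerivAt_id t).const_sub p) |>.congr_deriv
      (by simp)
  have := integral_ramp_mul k hderiv (hint j) (hint (j + 1)).neg
  simpa [jet, mul_comm, integral_neg] using this

lemma exists_zero_of_intervalIntegral_eq_zero {ψ : ℝ → ℝ} (hψ : Continuous ψ) {a b : ℝ}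
    (hab : a < b) (h : ∫ t in a..b, ψ t = 0) : ∃ t ∈ Ioo a b, ψ t = 0 := by
  have hderiv (x : ℝ) : HasDerivAt (fun x => ∫ t in a..x, ψ t) (ψ x) x :=
    (hψ.integral_hasStrictDerivAt a x).hasDerivAt
  exact exists_hasDerivAt_eq_zero hab (fun x _ => (hderiv x).continuousAt.continuousWithinAt)
    (by simp [h]) fun x _ => hderiv x

end Ramp

section DiffMat
open Matrix

variable {𝕜 𝕂 X n : Type*} [NontriviallyNormedField 𝕜] [NormedField 𝕂] [NormedAlgebra 𝕜 𝕂]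
  [NormedAddCommGroup X] [NormedSpace 𝕜 X] [Fintype n] [DecidableEq n] {x : X}

lemma differentiableAt_det {A : X → Matrix n n 𝕂}
    (hA : ∀ i j, DifferentiableAt 𝕜 (fun x => A x i j) x) :
    DifferentiableAt 𝕜 (fun x => (A x).det) x := by
  simp only [det_apply, Units.smul_def, zsmul_eq_mul]
  exact .fun_sum fun s _ => .const_mul
    (HasFDerivAt.finsetProd fun i _ => (hA (s i) i).hasFDerivAt).differentiableAt _

lemma inv_mulVec_eq_cramer (A : Matrix n n 𝕂) (b : n → 𝕂) :
    A⁻¹ *ᵥ b = A.det⁻¹ • A.cramer b := by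
  rw [inv_def, Ring.inverse_eq_inv', cramer_eq_adjugate_mulVec, smul_mulVec]

lemma differentiableAt_inv_mulVec {A : X → Matrix n n 𝕂} {b : X → n → 𝕂}
    (hA : ∀ i j, DifferentiableAt 𝕜 (fun x => A x i j) x) (hb : ∀ i, DifferentiableAt 𝕜 (b · i) x)
    (hdet : (A x).det ≠ 0) : DifferentiableAt 𝕜 (fun x => (A x)⁻¹ *ᵥ b x) x := by
  simp only [inv_mulVec_eq_cramer]
  refine ((differentiableAt_det hA).inv hdet).smul (differentiableAt_pi.2 fun i => ?_)
  simp only [cramer_apply]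
  refine differentiableAt_det fun j k => ?_
  simp only [updateCol_apply]
  split_ifs
  exacts [hb j, hA j k]
end DiffMat

lemma Tempered.differentiableAt_jet {E X : Type*} [NormedAddCommGroup E] [NormedSpace ℝ E]
    [NormedAddCommGroup X] [NormedSpace ℝ X] {w : ℝ → E} (hw : Tempered w) (j : ℕ) {p τ : X → ℝ}
    {x : X} (hp : DifferentiableAt ℝ p x) (hτ : DifferentiableAt ℝ τ x) (hτ₀ : 0 < τ x) :
    DifferentiableAt ℝ (fun x => jet w j (p x) (τ x)) x :=
  (hasFDerivAt_jet hw j (p x) hτ₀).differentiableAt.comp (f := fun x => (p x, τ x)) x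
    (hp.prodMk hτ)

section Perturbation
open Matrix

/-- The matrix of the first three space derivatives of the heat extensions of three ramps. -/
noncomputable def rampMatrix (p τ : ℝ) : Matrix (Fin 3) (Fin 3) ℝ :=
  .of fun j k => jet (ramp k.val) (j + 1) p τ

lemma sum_heatKernel_eq (α : Fin 3 → ℝ) (x τ : ℝ) :
    ∑ j : Fin 3, α j * heatKernel j x τ =
      heatKernel 0 x τ *
        ∑ i : Fin 3, x ^ (i : ℕ) * ![α 0 - α 2 / τ, -(α 1 / τ), α 2 / τ ^ 2] i := by
  simp only [Fin.sum_univ_three, Fin.val_zero, Fin.val_one, Fin.val_two, heatKernel_add_two 0,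
    heatKernel_one, cons_val, zero_add, Nat.cast_zero]
  ring

lemma exists_sum_heatKernel_eq_zero {α : Fin 3 → ℝ} {p τ : ℝ} (hτ : 0 < τ)
    (h : α ᵥ* rampMatrix p τ = 0) (k : Fin 3) :
    ∃ t ∈ Ioo (k : ℝ) (k + 1), ∑ j : Fin 3, α j * heatKernel j (p - t) τ = 0 := by
  have hcont (j : ℕ) : Continuous fun t => heatKernel j (p - t) τ :=
    (continuous_heatKernel j hτ).comp (continuous_const.sub continuous_id)
  refine exists_zero_of_intervalIntegral_eq_zero (by fun_prop) (lt_add_one _) ?_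
  rw [intervalIntegral.integral_finsetSum (f := fun (j : Fin 3) t => α j * heatKernel j (p - t) τ)
    fun j _ => ((hcont j).const_mul _).intervalIntegrable _ _]
  simpa only [vecMul, dotProduct, rampMatrix, of_apply, jet_ramp _ _ p hτ,
    intervalIntegral.integral_const_mul, Pi.zero_apply] using congrFun h k

lemma det_rampMatrix_ne_zero (p : ℝ) {τ : ℝ} (hτ : 0 < τ) : (rampMatrix p τ).det ≠ 0 := by
  intro hdet
  obtain ⟨α, hα, hmul⟩ := exists_vecMul_eq_zero_iff.2 hdet
  choose t ht hzero using exists_sum_heatKernel_eq_zero hτ hmul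
  have hinj : Function.Injective fun k => p - t k := by
    intro k l hkl
    have hkl : t k = t l := sub_right_injective hkl
    have h₁ := (ht k).1.trans_eq hkl |>.trans (ht l).2
    have h₂ := (ht l).1.trans_eq hkl.symm |>.trans (ht k).2
    norm_cast at h₁ h₂
    omega
  have hβ := eq_zero_of_forall_index_sum_pow_mul_eq_zero hinj fun k =>
    (mul_eq_zero.1 ((sum_heatKernel_eq α _ τ).symm.trans (hzero k))).resolve_left
      (heatKernel_zero_pos _ hτ).ne'
  have h₂ : α 2 = 0 := by simpa [hτ.ne'] using congrFun hβ 2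
  have h₁ : α 1 = 0 := by simpa [hτ.ne'] using congrFun hβ 1
  have h₀ : α 0 = 0 := by simpa [h₂] using congrFun hβ 0
  exact hα (funext fun i => by fin_cases i <;> assumption)

lemma det_map_rampMatrix_ne_zero (p : ℝ) {τ : ℝ} (hτ : 0 < τ) :
    ((rampMatrix p τ).map (algebraMap ℝ ℂ)).det ≠ 0 := by
  rw [← RingHom.mapMatrix_apply, ← RingHom.map_det]
  simpa using det_rampMatrix_ne_zero p hτ

/-- The path `w` perturbed by a combination of the first three ramps. -/
noncomputable def perturb {E : Type*} [AddCommGroup E] [Module ℝ E] (w : ℝ → E)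
    (g : Fin 3 → E) : ℝ → E := fun t => w t + ∑ k : Fin 3, ramp k t • g k

/-- The first three space derivatives of the heat extension of `w`. -/
noncomputable def jets (w : ℝ → ℂ) (p τ : ℝ) : Fin 3 → ℂ := fun j => jet w (j + 1) p τ

lemma jets_perturb {w : ℝ → ℂ} (hw : Tempered w) (g : Fin 3 → ℂ) (p : ℝ) {τ : ℝ} (hτ : 0 < τ) :
    jets (perturb w g) p τ = jets w p τ + (rampMatrix p τ).map (algebraMap ℝ ℂ) *ᵥ g := by
  have hramp : ∀ k ∈ Finset.univ, Tempered fun t => ramp (k : Fin 3).val t • g k :=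
    fun k _ => (tempered_ramp _).smul_const _
  have hperturb : perturb w g = fun t => w t + ∑ k : Fin 3, ramp k t • g k := rfl
  ext j
  simp only [jets, hperturb, jet_add hw (.sum hramp) _ _ hτ, jet_sum hramp _ _ hτ, jet_smul_const,
    Pi.add_apply, mulVec, dotProduct, map_apply, rampMatrix, of_apply,
    ← Algebra.smul_def]

/-- The derivatives of a curve at a point, the first one at index `0`, exhibit a singularity that
is not a cusp. -/
def IsDegenerate (y : Fin 3 → ℂ) : Prop :=
  y 0 = 0 ∧ (starRingEnd ℂ (y 1) * y 2).im = 0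

lemma IsDegenerate.exists_eq {y : Fin 3 → ℂ} (hy : IsDegenerate y) :
    ∃ (z : ℂ) (s : ℝ), y = ![0, 0, s * z] ∨ y = ![0, z, s * z] := by
  obtain ⟨h₀, him⟩ := hy
  rcases eq_or_ne (y 1) 0 with h₁ | h₁
  · refine ⟨y 2, 1, .inl (funext fun i => ?_)⟩
    fin_cases i <;> simp [h₀, h₁]
  · have hy₂ : y 2 = (((starRingEnd ℂ (y 1) * y 2).re / Complex.normSq (y 1) : ℝ) : ℂ) * y 1 := by
      have hre : ((starRingEnd ℂ (y 1) * y 2).re : ℂ) = starRingEnd ℂ (y 1) * y 2 :=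
        Complex.ext rfl him.symm
      have hconj : starRingEnd ℂ (y 1) ≠ 0 := by simpa using h₁
      rw [Complex.ofReal_div, hre, Complex.normSq_eq_conj_mul_self]
      field_simp
    refine ⟨y 1, (starRingEnd ℂ (y 1) * y 2).re / Complex.normSq (y 1), .inr (funext fun i => ?_)⟩
    fin_cases i
    exacts [h₀, rfl, hy₂]

lemma addHaar_image_solution_eq_zero {w : ℝ → ℂ} (hw : Tempered w) (μ : Measure (Fin 3 → ℂ))
    [μ.IsAddHaarMeasure] (r : ℂ) :
    μ ((fun x : Fin 3 → ℂ => ((rampMatrix (x 0).re (x 0).im).map (algebraMap ℝ ℂ))⁻¹ *ᵥ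
        (![0, r * x 1, x 2 * x 1] - jets w (x 0).re (x 0).im)) ''
      {x | 0 < (x 0).im ∧ (x 2).im = 0}) = 0 := by
  refine addHaar_image_eq_zero_of_differentiableOn_of_addHaar_eq_zero μ (fun x hx => ?_) ?_
  · have hre : DifferentiableAt ℝ (fun x : Fin 3 → ℂ => (x 0).re) x := by fun_prop
    have him : DifferentiableAt ℝ (fun x : Fin 3 → ℂ => (x 0).im) x := by fun_prop
    refine (differentiableAt_inv_mulVec (fun j k => ?_) (fun j => ?_) ?_).differentiableWithinAt
    · exact Complex.ofRealCLM.differentiableAt.comp x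
        ((tempered_ramp k).differentiableAt_jet (j + 1) hre him hx.1)
    · refine .sub ?_ (hw.differentiableAt_jet (j + 1) hre him hx.1)
      have hb : DifferentiableAt ℝ (fun x : Fin 3 → ℂ => ![0, r * x 1, x 2 * x 1]) x :=
        differentiableAt_pi.2 (Fin.forall_fin_succ.2 ⟨differentiableAt_const 0,
          Fin.forall_fin_two.2 ⟨by dsimp; fun_prop, by dsimp; fun_prop⟩⟩)
      exact differentiableAt_pi.1 hb j
    · exact det_map_rampMatrix_ne_zero _ hx.1
  · set F : Submodule ℝ (Fin 3 → ℂ) := LinearMap.ker (Complex.imLm ∘ₗ LinearMap.proj 2)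
    have hF : F ≠ ⊤ := fun h => by
      have hI : (fun _ => Complex.I) ∈ F := h ▸ Submodule.mem_top
      simp [F] at hI
    exact measure_mono_null (fun x hx => hx.2) (Measure.addHaar_submodule μ F hF)

theorem addHaar_degenerate_eq_zero {w : ℝ → ℂ} (hw : Tempered w) (μ : Measure (Fin 3 → ℂ))
    [μ.IsAddHaarMeasure] :
    μ {g | ∃ p τ, 0 < τ ∧ IsDegenerate (jets (perturb w g) p τ)} = 0 := by
  refine measure_mono_null ?_ (measure_union_null (addHaar_image_solution_eq_zero hw μ 0)
    (addHaar_image_solution_eq_zero hw μ 1))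
  rintro g ⟨p, τ, hτ, hdeg⟩
  have hsolve : ((rampMatrix p τ).map (algebraMap ℝ ℂ))⁻¹ *ᵥ
      (jets (perturb w g) p τ - jets w p τ) = g := by
    rw [jets_perturb hw g p hτ, add_sub_cancel_left, mulVec_mulVec, 
      nonsing_inv_mul _ (det_map_rampMatrix_ne_zero p hτ).isUnit, one_mulVec]
  obtain ⟨z, s, hzs⟩ := hdeg.exists_eq
  refine hzs.imp (fun h => ?_) fun h => ?_ <;>
  · refine ⟨![⟨p, τ⟩, z, s], ⟨by simpa using hτ, by simp⟩, ?_⟩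
    simpa [h] using hsolve

end Perturbation

/-! ### Brownian paths -/

section BrownianPaths

variable {Ω : Type*} {mΩ : MeasurableSpace Ω}

lemma measurable_of_continuous_of_denseRange {V : ℝ≥0 → Ω → ℝ} (hc : ∀ ω, Continuous (V · ω))
    {D : ℕ → ℝ≥0} (hD : DenseRange D) (hm : ∀ n, Measurable (V (D n))) (t : ℝ≥0) :
    Measurable (V t) := by
  obtain ⟨u, hu, hut⟩ := mem_closure_iff_seq_limit.1 (hD.closure_range ▸ mem_univ t)
  choose n hn using hu
  obtain rfl : D ∘ n = u := funext hn
  exact measurable_of_tendsto_metrizable (fun k => hm (n k))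
    (tendsto_pi_nhds.2 fun ω => ((hc ω).tendsto t).comp hut)

/-- A pre-Brownian motion with measurable coordinates all of whose paths are continuous. Any
Brownian motion has such a version, and it spares us null sets in measurability arguments. -/
structure IsRegularBrownian (V : ℝ≥0 → Ω → ℝ) (P : Measure Ω) : Prop where
  isPreBrownianReal : IsPreBrownianReal V P
  measurable : ∀ t, Measurable (V t)
  continuous : ∀ ω, Continuous (V · ω)

lemma exists_isRegularBrownian {P : Measure Ω} {W : ℝ≥0 → Ω → ℝ} (hW : IsBrownianReal W P) :
    ∃ V : ℝ≥0 → Ω → ℝ, IsRegularBrownian V P ∧ ∀ᵐ ω ∂P, (W · ω) = (V · ω) := by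
  set D := TopologicalSpace.denseSeq ℝ≥0
  have hae (t) : AEMeasurable (W t) P := hW.aemeasurable t
  have hgood : ∀ᵐ ω ∂P, Continuous (W · ω) ∧ ∀ n, W (D n) ω = (hae (D n)).mk _ ω :=
    hW.cont.and (ae_all_iff.2 fun n => (hae (D n)).ae_eq_mk)
  obtain ⟨S, hS, hSmeas, hSgood⟩ := hgood.exists_measurable_mem
  have hcont (ω) : Continuous fun t => S.indicator (W t) ω := by
    by_cases hω : ω ∈ S
    · simpa only [indicator_of_mem hω] using (hSgood ω hω).1
    · simpa only [indicator_of_notMem hω] using continuous_const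
  have hmeas (n) : Measurable (S.indicator (W (D n))) := by
    rw [indicator_congr fun ω hω => (hSgood ω hω).2 n]
    exact (hae (D n)).measurable_mk.indicator hSmeas
  have hversion : ∀ᵐ ω ∂P, (W · ω) = fun t => S.indicator (W t) ω := by
    filter_upwards [hS] with ω hω
    simp only [indicator_of_mem hω]
  exact ⟨fun t => S.indicator (W t),
    ⟨hW.toIsPreBrownianReal.congr fun t => hversion.mono fun ω h => congrFun h t,
      measurable_of_continuous_of_denseRange hcont
        (TopologicalSpace.denseRange_denseSeq ℝ≥0) hmeas, hcont⟩, hversion⟩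

variable {V₁ V₂ : ℝ≥0 → Ω → ℝ}

lemma measurable_uncurry_extendedPath (hm₁ : ∀ t, Measurable (V₁ t))
    (hm₂ : ∀ t, Measurable (V₂ t)) (hc₁ : ∀ ω, Continuous (V₁ · ω))
    (hc₂ : ∀ ω, Continuous (V₂ · ω)) :
    Measurable fun x : Ω × ℝ => extendedPath (V₁ · x.1) (V₂ · x.1) x.2 := by
  have hV {V : ℝ≥0 → Ω → ℝ} (hm : ∀ t, Measurable (V t)) (hc : ∀ ω, Continuous (V · ω)) :
      Measurable fun x : Ω × ℝ => V x.2.toNNReal x.1 :=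
    (measurable_uncurry_of_continuous_of_measurable hc hm).comp
      ((measurable_real_toNNReal.comp measurable_snd).prodMk measurable_fst)
  exact Measurable.ite (measurableSet_lt measurable_const measurable_snd)
    (Complex.measurableEquivRealProd.symm.measurable.comp ((hV hm₁ hc₁).prodMk (hV hm₂ hc₂)))
    measurable_const

lemma measurable_jets_extendedPath (hm₁ : ∀ t, Measurable (V₁ t)) (hm₂ : ∀ t, Measurable (V₂ t))
    (hc₁ : ∀ ω, Continuous (V₁ · ω)) (hc₂ : ∀ ω, Continuous (V₂ · ω)) (p : ℝ) {τ : ℝ}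
    (hτ : 0 < τ) : Measurable fun ω => jets (extendedPath (V₁ · ω) (V₂ · ω)) p τ := by
  refine measurable_pi_lambda _ fun j => ?_
  have hkernel : Measurable fun x : Ω × ℝ => heatKernel (j + 1) (p - x.2) τ :=
    (continuous_heatKernel (j + 1) hτ).measurable.comp (measurable_snd.const_sub p)
  exact (hkernel.smul (measurable_uncurry_extendedPath hm₁ hm₂ hc₁
    hc₂)).stronglyMeasurable.integral_prod_right.measurable

variable {P : Measure Ω} [IsProbabilityMeasure P]

lemma integral_abs_le_one_add {W : ℝ≥0 → Ω → ℝ} (hW : IsPreBrownianReal W P) (t : ℝ≥0) :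
    ∫ ω, |W t ω| ∂P ≤ 1 + t := by
  have hsq : Integrable (fun ω => W t ω ^ 2) P :=
    (hW.isGaussianProcess.hasGaussianLaw_eval t).memLp_two.integrable_sq
  have hvar : ∫ ω, W t ω ^ 2 ∂P = t := by
    rw [← variance_of_integral_eq_zero (hW.aemeasurable t) (hW.integral_eval t),
      ← covariance_self (hW.aemeasurable t), hW.covariance_eval, min_self]
  calc ∫ ω, |W t ω| ∂P ≤ ∫ ω, (1 + W t ω ^ 2) ∂P :=
        integral_mono (hW.integrable_eval t).abs ((integrable_const _).add hsq) fun ω => by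
          nlinarith only [sq_nonneg (|W t ω| - 1), sq_abs (W t ω), abs_nonneg (W t ω)]
    _ = 1 + t := by rw [integral_add (integrable_const _) hsq, hvar]; simp

lemma integral_norm_extendedPath_le (hV₁ : IsPreBrownianReal V₁ P)
    (hV₂ : IsPreBrownianReal V₂ P) (t : ℝ) :
    ∫ ω, ‖extendedPath (V₁ · ω) (V₂ · ω) t‖ ∂P ≤ 2 * (1 + |t|) := by
  unfold extendedPath
  split_ifs with ht
  · have hint₁ := (hV₁.integrable_eval t.toNNReal).abs
    have hint₂ := (hV₂.integrable_eval t.toNNReal).abs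
    have hE₁ := integral_abs_le_one_add hV₁ t.toNNReal
    have hE₂ := integral_abs_le_one_add hV₂ t.toNNReal
    rw [show (t.toNNReal : ℝ) = |t| by rw [Real.coe_toNNReal t ht.le, abs_of_pos ht]] at hE₁ hE₂
    calc ∫ ω, ‖(⟨V₁ t.toNNReal ω, V₂ t.toNNReal ω⟩ : ℂ)‖ ∂P
        ≤ ∫ ω, (|V₁ t.toNNReal ω| + |V₂ t.toNNReal ω|) ∂P :=
          integral_mono_of_nonneg (.of_forall fun _ => norm_nonneg _) (hint₁.add hint₂)
            (.of_forall fun _ => Complex.norm_le_abs_re_add_abs_im _)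
      _ ≤ 2 * (1 + |t|) := by rw [integral_add hint₁ hint₂]; linarith
  · simp only [norm_zero, integral_zero]; positivity

lemma integrable_extendedPath (hV₁ : IsPreBrownianReal V₁ P) (hV₂ : IsPreBrownianReal V₂ P)
    (t : ℝ) : Integrable (fun ω => extendedPath (V₁ · ω) (V₂ · ω) t) P := by
  unfold extendedPath
  split_ifs
  · exact Complex.equivRealProdCLM.symm.integrable_comp_iff.2
      ((hV₁.integrable_eval _).prodMk (hV₂.integrable_eval _))
  · exact integrable_const _

lemma ae_tempered_extendedPath (hV₁ : IsRegularBrownian V₁ P) (hV₂ : IsRegularBrownian V₂ P) :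
    ∀ᵐ ω ∂P, Tempered (extendedPath (V₁ · ω) (V₂ · ω)) := by
  have hmeas : AEStronglyMeasurable
      (fun x : Ω × ℝ => Real.exp (-|x.2|) • extendedPath (V₁ · x.1) (V₂ · x.1) x.2)
      (P.prod volume) :=
    (Measurable.smul (f := fun x : Ω × ℝ => Real.exp (-|x.2|)) (by fun_prop)
      (measurable_uncurry_extendedPath hV₁.measurable hV₂.measurable hV₁.continuous
        hV₂.continuous)).aestronglyMeasurable
  have hslice (t) := integrable_extendedPath hV₁.isPreBrownianReal hV₂.isPreBrownianReal t
  refine Integrable.prod_right_ae ((integrable_prod_iff' hmeas).2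
    ⟨.of_forall fun t => (hslice t).smul (Real.exp (-|t|)), ?_⟩)
  have hbound : Integrable fun t : ℝ =>
      2 * (|t| ^ 0 * Real.exp (-|t|) + |t| ^ 1 * Real.exp (-|t|)) :=
    ((integrable_abs_pow_mul_exp_neg_abs 0).add (integrable_abs_pow_mul_exp_neg_abs 1)).const_mul 2
  refine hbound.mono' hmeas.norm.prod_swap.integral_prod_right' (.of_forall fun t => ?_)
  rw [Real.norm_of_nonneg (integral_nonneg fun _ => norm_nonneg _)]
  simp only [norm_smul, Real.norm_eq_abs, Real.abs_exp, integral_const_mul]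
  calc Real.exp (-|t|) * ∫ ω, ‖extendedPath (V₁ · ω) (V₂ · ω) t‖ ∂P
      ≤ Real.exp (-|t|) * (2 * (1 + |t|)) := by
        gcongr
        exact integral_norm_extendedPath_le hV₁.isPreBrownianReal hV₂.isPreBrownianReal t
    _ = 2 * (|t| ^ 0 * Real.exp (-|t|) + |t| ^ 1 * Real.exp (-|t|)) := by ring

end BrownianPaths

/-- The increments of `v` over `[0, 1]`, `[1, 2]` and `[2, 3]`. -/
def increments (v : ℝ≥0 → ℝ) (k : Fin 3) : ℝ := v (k.val + 1) - v k.val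

/-- What is left of `v` after removing the linear interpolation of its three `increments`. For a
Brownian path this is independent of the increments. -/
noncomputable def remainder (v : ℝ≥0 → ℝ) (t : ℝ≥0) : ℝ :=
  v t - ∑ k : Fin 3, ramp k.val t * increments v k

/-- The planar increments with coordinates `a` and `b`. -/
def complexify (a b : Fin 3 → ℝ) (k : Fin 3) : ℂ := ⟨a k, b k⟩

lemma measurable_increments : Measurable increments :=
  measurable_pi_lambda _ fun _ => (measurable_pi_apply _).sub (measurable_pi_apply _)

lemma measurable_remainder : Measurable remainder :=
  measurable_pi_lambda _ fun _ => (measurable_pi_apply _).sub <|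
    Finset.measurable_sum _ fun k _ =>
      ((measurable_pi_apply k).comp measurable_increments).const_mul _

lemma measurePreserving_complexify :
    MeasurePreserving fun a : (Fin 3 → ℝ) × (Fin 3 → ℝ) => complexify a.1 a.2 :=
  (volume_preserving_pi fun _ => Complex.volume_preserving_equiv_real_prod.symm _).comp
    ((volume_measurePreserving_arrowProdEquivProdArrow ℝ ℝ (Fin 3)).symm _)

lemma continuous_remainder {v : ℝ≥0 → ℝ} (hv : Continuous v) : Continuous (remainder v) :=
  hv.sub <| continuous_finsetSum _ fun _ _ =>
    ((continuous_ramp _).comp NNReal.continuous_coe).mul continuous_const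

lemma ramp_eq_zero {k t : ℝ} (h : t ≤ k) : ramp k t = 0 :=
  max_eq_left ((min_le_right _ _).trans (sub_nonpos.2 h))

lemma extendedPath_eq_perturb_remainder (v₁ v₂ : ℝ≥0 → ℝ) :
    extendedPath v₁ v₂ = perturb (extendedPath (remainder v₁) (remainder v₂))
      (complexify (increments v₁) (increments v₂)) := by
  ext t
  unfold perturb extendedPath
  split_ifs with ht
  · simp [Complex.ext_iff, remainder, complexify, ht.le]
  · simp [ramp_eq_zero ((not_lt.1 ht).trans (Nat.cast_nonneg _))]

lemma Tempered.perturb {w : ℝ → ℂ} (hw : Tempered w) (g : Fin 3 → ℂ) :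
    Tempered (perturb w g) :=
  hw.add (.sum fun _ _ => (tempered_ramp _).smul_const _)

lemma Tempered.extendedPath_remainder {v₁ v₂ : ℝ≥0 → ℝ} (h : Tempered (extendedPath v₁ v₂)) :
    Tempered (extendedPath (remainder v₁) (remainder v₂)) := by
  convert h.perturb (-complexify (increments v₁) (increments v₂)) using 1
  ext t
  simp [extendedPath_eq_perturb_remainder v₁ v₂, CongaLoop.perturb]

section Brownian

variable {Ω : Type*} {mΩ : MeasurableSpace Ω} {P : Measure Ω} {W : ℝ≥0 → Ω → ℝ}

lemma memLp_two_increments (hW : IsPreBrownianReal W P) (k : Fin 3) :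
    MemLp (fun ω => increments (W · ω) k) 2 P :=
  (hW.isGaussianProcess.hasGaussianLaw_eval _).memLp_two.sub
    (hW.isGaussianProcess.hasGaussianLaw_eval _).memLp_two

lemma covariance_increments (hW : IsPreBrownianReal W P) (t : ℝ≥0) (k : Fin 3) :
    cov[W t, fun ω => increments (W · ω) k; P] = ramp k.val t := by
  have := hW.isGaussianProcess.isProbabilityMeasure
  have hL (t) : MemLp (fun ω => W t ω) 2 P :=
    (hW.isGaussianProcess.hasGaussianLaw_eval t).memLp_two
  unfold increments ramp
  rw [covariance_fun_sub_right (hL _) (hL _) (hL _), hW.covariance_fun_eval,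
    hW.covariance_fun_eval]
  push_cast
  grind

lemma covariance_increments_increments (hW : IsPreBrownianReal W P) (l k : Fin 3) :
    cov[fun ω => increments (W · ω) l, fun ω => increments (W · ω) k; P] =
      if l = k then 1 else 0 := by
  have := hW.isGaussianProcess.isProbabilityMeasure
  have hL (t) := (hW.isGaussianProcess.hasGaussianLaw_eval t).memLp_two
  have hl : (fun ω => increments (W · ω) l) = W (l.val + 1) - W l.val := rfl
  rw [hl, covariance_sub_left (hL _) (hL _) (memLp_two_increments hW k),
    covariance_increments hW, covariance_increments hW]
  fin_cases l <;> fin_cases k <;> norm_num [ramp]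

lemma covariance_remainder_increments (hW : IsPreBrownianReal W P) (t : ℝ≥0) (k : Fin 3) :
    cov[fun ω => remainder (W · ω) t, fun ω => increments (W · ω) k; P] = 0 := by
  have := hW.isGaussianProcess.isProbabilityMeasure
  have hL := (hW.isGaussianProcess.hasGaussianLaw_eval t).memLp_two
  have hG := memLp_two_increments hW
  unfold remainder
  rw [covariance_fun_sub_left hL (memLp_finsetSum _ fun l _ => (hG l).const_mul _) (hG k),
    covariance_fun_sum_left (fun l => (hG l).const_mul _) (hG k), covariance_increments hW]
  simp [covariance_const_mul_left, covariance_increments_increments hW]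

lemma isGaussianProcess_remainder_increments (hW : IsPreBrownianReal W P) :
    IsGaussianProcess (Sum.elim (fun t ω => remainder (W · ω) t)
      fun (k : Fin 3) ω => increments (W · ω) k) P := by
  refine hW.isGaussianProcess.of_isGaussianProcess ?_
  let ev {J : Finset ℝ≥0} (s : ℝ≥0) (hs : s ∈ J) : (J → ℝ) →L[ℝ] ℝ := .proj ⟨s, hs⟩
  rintro (t | k)
  · refine ⟨{t, 0, 1, 2, 3}, ev t (by simp) -
      (ramp 0 t • (ev 1 (by simp) - ev 0 (by simp)) + ramp 1 t • (ev 2 (by simp) - ev 1 (by simp)) +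
        ramp 2 t • (ev 3 (by simp) - ev 2 (by simp))), fun ω => ?_⟩
    norm_num [ev, remainder, increments, Fin.sum_univ_three]
  · exact ⟨{(k.val : ℝ≥0) + 1, (k.val : ℝ≥0)}, ev (k.val + 1) (by simp) - ev k.val (by simp),
      fun ω => by simp [ev, increments]⟩

lemma indepFun_remainder_increments (hW : IsPreBrownianReal W P) :
    IndepFun (fun ω => remainder (W · ω)) (fun ω => increments (W · ω)) P := by
  refine IsGaussianProcess.indepFun_of_covariance_eq_zero
    (isGaussianProcess_remainder_increments hW)
    (fun t => ?_) (fun k => ?_) (covariance_remainder_increments hW)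
  · exact (isGaussianProcess_remainder_increments hW).aemeasurable (.inl t)
  · exact (memLp_two_increments hW k).aemeasurable

end Brownian

/-! ### Independence and absolute continuity of the perturbation -/

lemma absolutelyContinuous_pi {n : ℕ} {α : Fin n → Type*} [∀ i, MeasurableSpace (α i)]
    {μ ν : ∀ i, Measure (α i)} [∀ i, SigmaFinite (μ i)] [∀ i, SigmaFinite (ν i)]
    (h : ∀ i, μ i ≪ ν i) : Measure.pi μ ≪ Measure.pi ν := by
  induction n with
  | zero => rw [Measure.pi_of_empty μ, Measure.pi_of_empty ν]
  | succ n ih =>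
    rw [← (measurePreserving_piFinSuccAbove μ 0).symm.map_eq,
      ← (measurePreserving_piFinSuccAbove ν 0).symm.map_eq]
    exact ((h 0).prod (ih fun i => h _)).map (MeasurableEquiv.measurable _)

section Independence

variable {Ω α α₁ α₂ β β₁ β₂ : Type*} {mΩ : MeasurableSpace Ω} [mα : MeasurableSpace α]
  [mα₁ : MeasurableSpace α₁] [mα₂ : MeasurableSpace α₂] [mβ : MeasurableSpace β]
  [mβ₁ : MeasurableSpace β₁] [mβ₂ : MeasurableSpace β₂] {P : Measure Ω}

lemma indepFun_of_measurable_comap {X : Ω → α} {Y : Ω → β} {X' : Ω → α₁} {Y' : Ω → β₁}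
    (h : IndepFun X Y P) (hX : Measurable[mα.comap X] X') (hY : Measurable[mβ.comap Y] Y') :
    IndepFun X' Y' P :=
  (IndepFun_iff_Indep _ _ _).2 (indep_of_indep_of_le_left
    (indep_of_indep_of_le_right ((IndepFun_iff_Indep _ _ _).1 h) hY.comap_le) hX.comap_le)

lemma comap_prodMk_eq_generateFrom (X : Ω → α) (Y : Ω → β) :
    MeasurableSpace.comap (fun ω => (X ω, Y ω)) inferInstance =
      MeasurableSpace.generateFrom {s | ∃ t ∈ image2 (· ×ˢ ·) {s | MeasurableSet s}
        {t | MeasurableSet t}, (fun ω => (X ω, Y ω)) ⁻¹' t = s} := by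
  rw [← generateFrom_prod, MeasurableSpace.comap_generateFrom]
  rfl

lemma indepFun_prodMk_prodMk [IsZeroOrProbabilityMeasure P] {X₁ : Ω → α₁} {X₂ : Ω → α₂}
    {Y₁ : Ω → β₁} {Y₂ : Ω → β₂}
    (hX₁ : Measurable X₁) (hX₂ : Measurable X₂) (hY₁ : Measurable Y₁) (hY₂ : Measurable Y₂)
    (h₁ : IndepFun X₁ Y₁ P) (h₂ : IndepFun X₂ Y₂ P)
    (h : IndepFun (fun ω => (X₁ ω, Y₁ ω)) (fun ω => (X₂ ω, Y₂ ω)) P) :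
    IndepFun (fun ω => (X₁ ω, X₂ ω)) (fun ω => (Y₁ ω, Y₂ ω)) P := by
  refine (IndepFun_iff_Indep _ _ _).2 (IndepSets.indep (hX₁.prodMk hX₂).comap_le
    (hY₁.prodMk hY₂).comap_le (isPiSystem_prod.comap _) (isPiSystem_prod.comap _)
    (comap_prodMk_eq_generateFrom X₁ X₂) (comap_prodMk_eq_generateFrom Y₁ Y₂) ?_)
  refine (IndepSets_iff _ _ _).2 ?_
  rintro _ _ ⟨_, ⟨A₁, hA₁, A₂, hA₂, rfl⟩, rfl⟩ ⟨_, ⟨B₁, hB₁, B₂, hB₂, rfl⟩, rfl⟩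
  have hX := (h.comp measurable_fst measurable_fst).measure_inter_preimage_eq_mul A₁ A₂ hA₁ hA₂
  have hY := (h.comp measurable_snd measurable_snd).measure_inter_preimage_eq_mul B₁ B₂ hB₁ hB₂
  have hXY := h.measure_inter_preimage_eq_mul _ _ (hA₁.prod hB₁) (hA₂.prod hB₂)
  simp only [mk_preimage_prod] at hXY ⊢
  calc P (X₁ ⁻¹' A₁ ∩ X₂ ⁻¹' A₂ ∩ (Y₁ ⁻¹' B₁ ∩ Y₂ ⁻¹' B₂))
      = P (X₁ ⁻¹' A₁ ∩ Y₁ ⁻¹' B₁) * P (X₂ ⁻¹' A₂ ∩ Y₂ ⁻¹' B₂) := by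
        rw [inter_inter_inter_comm, hXY]
    _ = P (X₁ ⁻¹' A₁) * P (X₂ ⁻¹' A₂) * (P (Y₁ ⁻¹' B₁) * P (Y₂ ⁻¹' B₂)) := by
        rw [h₁.measure_inter_preimage_eq_mul _ _ hA₁ hB₁,
          h₂.measure_inter_preimage_eq_mul _ _ hA₂ hB₂, mul_mul_mul_comm]
    _ = P (X₁ ⁻¹' A₁ ∩ X₂ ⁻¹' A₂) * P (Y₁ ⁻¹' B₁ ∩ Y₂ ⁻¹' B₂) := congr_arg₂ _ hX.symm hY.symm

lemma ae_prodMk_notMem_of_indepFun [IsFiniteMeasure P] {X : Ω → α} {Y : Ω → β} (hX : Measurable X)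
    (hY : Measurable Y) (h : IndepFun X Y P) {N : Set (α × β)} (hN : MeasurableSet N)
    (hnull : ∀ᵐ ω ∂P, P.map Y (Prod.mk (X ω) ⁻¹' N) = 0) : ∀ᵐ ω ∂P, (X ω, Y ω) ∉ N := by
  suffices P.map (fun ω => (X ω, Y ω)) N = 0 by
    rwa [Measure.map_apply (hX.prodMk hY) hN, measure_eq_zero_iff_ae_notMem] at this
  rw [(indepFun_iff_map_prod_eq_prod_map_map hX.aemeasurable hY.aemeasurable).1 h,
    Measure.measure_prod_null hN]
  exact (ae_map_iff hX.aemeasurable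
    (measurable_measure_prodMk_left hN (measurableSet_singleton 0))).2 hnull

end Independence

section BrownianIncrements

variable {Ω : Type*} {mΩ : MeasurableSpace Ω} {P : Measure Ω}

lemma map_increments_absolutelyContinuous {W : ℝ≥0 → Ω → ℝ} (hW : IsPreBrownianReal W P) :
    P.map (fun ω => increments (W · ω)) ≪ volume := by
  have := hW.isGaussianProcess.isProbabilityMeasure
  have hmeas (k : Fin 3) : AEMeasurable (fun ω => increments (W · ω) k) P :=
    (memLp_two_increments hW k).aemeasurable
  have (k : Fin 3) := Measure.isProbabilityMeasure_map (hmeas k)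
  have hind : iIndepFun (fun (k : Fin 3) ω => increments (W · ω) k) P := by
    simpa [increments] using hW.hasIndepIncrements 3 (fun i => ((i : ℕ) : ℝ≥0))
      fun i j h => by simpa using h
  rw [(iIndepFun_iff_map_fun_eq_pi_map hmeas).1 hind, volume_pi]
  refine absolutelyContinuous_pi fun k => ?_
  change P.map (W (k.val + 1) - W k.val) ≪ volume
  rw [(hW.hasLaw_sub _ _).map_eq]
  refine gaussianReal_absolutelyContinuous _ ?_
  rw [← NNReal.coe_ne_zero, coe_nndist, Real.dist_eq]
  simp

lemma map_complexify_increments_absolutelyContinuous {W₁ W₂ : ℝ≥0 → Ω → ℝ}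
    (hW₁ : IsPreBrownianReal W₁ P) (hW₂ : IsPreBrownianReal W₂ P)
    (hind : IndepFun (fun ω t => W₁ t ω) (fun ω t => W₂ t ω) P) :
    P.map (fun ω => complexify (increments (W₁ · ω)) (increments (W₂ · ω))) ≪ volume := by
  have := hW₁.isGaussianProcess.isProbabilityMeasure
  have hmeas {W : ℝ≥0 → Ω → ℝ} (hW : IsPreBrownianReal W P) :
      AEMeasurable (fun ω => increments (W · ω)) P :=
    aemeasurable_pi_lambda _ fun k => (memLp_two_increments hW k).aemeasurable
  have hlaw := (indepFun_iff_map_prod_eq_prod_map_map (hmeas hW₁) (hmeas hW₂)).1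
    (hind.comp measurable_increments measurable_increments)
  have hac := ((map_increments_absolutelyContinuous hW₁).prod
    (map_increments_absolutelyContinuous hW₂)).map measurePreserving_complexify.measurable
  rwa [← hlaw, AEMeasurable.map_map_of_aemeasurable
    measurePreserving_complexify.measurable.aemeasurable ((hmeas hW₁).prodMk (hmeas hW₂)),
    ← Measure.volume_eq_prod, measurePreserving_complexify.map_eq] at hac

variable {V₁ V₂ : ℝ≥0 → Ω → ℝ}

lemma indepFun_remainders_increments (hV₁ : IsRegularBrownian V₁ P)
    (hV₂ : IsRegularBrownian V₂ P) (hind : IndepFun (fun ω t => V₁ t ω) (fun ω t => V₂ t ω) P) :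
    IndepFun (fun ω => (remainder (V₁ · ω), remainder (V₂ · ω)))
      (fun ω => complexify (increments (V₁ · ω)) (increments (V₂ · ω))) P := by
  have := hV₁.isPreBrownianReal.isGaussianProcess.isProbabilityMeasure
  have hpath {V : ℝ≥0 → Ω → ℝ} (hV : IsRegularBrownian V P) : Measurable fun ω t => V t ω :=
    measurable_pi_lambda _ hV.measurable
  have hsplit : Measurable fun v : ℝ≥0 → ℝ => (remainder v, increments v) :=
    measurable_remainder.prodMk measurable_increments
  exact (indepFun_prodMk_prodMk (measurable_remainder.comp (hpath hV₁))
    (measurable_remainder.comp (hpath hV₂)) (measurable_increments.comp (hpath hV₁))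
    (measurable_increments.comp (hpath hV₂)) (indepFun_remainder_increments hV₁.isPreBrownianReal)
    (indepFun_remainder_increments hV₂.isPreBrownianReal)
    (hind.comp hsplit hsplit)).comp measurable_id
    measurePreserving_complexify.measurable

end BrownianIncrements

/-! ### Absence of degenerate points -/

lemma exists_eq_zero_iff_of_denseRange {K : Type*} [TopologicalSpace K] [CompactSpace K]
    {F : K → ℝ} (hF : Continuous F) (hF₀ : ∀ x, 0 ≤ F x) {q : ℕ → K} (hq : DenseRange q) :
    (∃ x, F x = 0) ↔ ∀ m : ℕ, ∃ n, F (q n) < 1 / (m + 1) := by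
  refine ⟨fun ⟨x, hx⟩ m => hq.exists_mem_open (isOpen_lt hF continuous_const)
    ⟨x, mem_ofPred_eq ▸ hx ▸ by positivity⟩, fun h => ?_⟩
  obtain ⟨x, -, hmin⟩ := isCompact_univ.exists_isMinOn ⟨q 0, mem_univ _⟩ hF.continuousOn
  refine ⟨x, le_antisymm (le_of_forall_pos_lt_add fun ε hε => ?_) (hF₀ x)⟩
  obtain ⟨m, hm⟩ := exists_nat_one_div_lt hε
  obtain ⟨n, hn⟩ := h m
  linarith [isMinOn_iff.1 hmin (q n) (mem_univ _)]

/-- A continuous measure of how far the jet `y` is from being degenerate. -/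
noncomputable def degeneracy (y : Fin 3 → ℂ) : ℝ := ‖y 0‖ + |(starRingEnd ℂ (y 1) * y 2).im|

lemma continuous_degeneracy : Continuous degeneracy := by unfold degeneracy; fun_prop

lemma degeneracy_nonneg (y : Fin 3 → ℂ) : 0 ≤ degeneracy y := by unfold degeneracy; positivity

lemma degeneracy_eq_zero_iff {y : Fin 3 → ℂ} : degeneracy y = 0 ↔ IsDegenerate y := by
  rw [degeneracy, add_eq_zero_iff_of_nonneg (norm_nonneg _) (abs_nonneg _), norm_eq_zero,
    abs_eq_zero, IsDegenerate]

lemma Tempered.continuousOn_jets {w : ℝ → ℂ} (hw : Tempered w) :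
    ContinuousOn (fun x : ℝ × ℝ => jets w x.1 x.2) {x | 0 < x.2} :=
  continuousOn_pi.2 fun j => continuousOn_jet hw (j + 1)

/-- The jets of the path `w` along a sequence `q` of space-time points. -/
noncomputable def jetSamples (q : ℕ → ℝ × ℝ) (w : ℝ → ℂ) (n : ℕ) : Fin 3 → ℂ :=
  jets w (q n).1 (q n).2

open Matrix in
/-- The pairs `(d, g)` such that the jets `d n + A (q n) g`, with `A` the `rampMatrix`, come
arbitrarily close to being degenerate. If `d` samples the jets of a path along `q`, then
`d n + A (q n) g` samples those of its perturbation by `g`. -/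
def degenerateSamples (q : ℕ → ℝ × ℝ) : Set ((ℕ → Fin 3 → ℂ) × (Fin 3 → ℂ)) :=
  {z | ∀ m : ℕ, ∃ n, degeneracy (z.1 n +
    (rampMatrix (q n).1 (q n).2).map (algebraMap ℝ ℂ) *ᵥ z.2) < 1 / (m + 1)}

lemma measurableSet_degenerateSamples (q : ℕ → ℝ × ℝ) : MeasurableSet (degenerateSamples q) := by
  simp only [degenerateSamples, ofPred_forall, ofPred_exists]
  refine .iInter fun m => .iUnion fun n => (isOpen_lt (continuous_degeneracy.comp ?_)
    continuous_const).measurableSet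
  exact ((continuous_apply n).comp continuous_fst).add
    (continuous_const.matrix_mulVec continuous_snd)

lemma mem_degenerateSamples_iff {w : ℝ → ℂ} (hw : Tempered w) {K : Set (ℝ × ℝ)}
    (hK : IsCompact K) (hpos : ∀ x ∈ K, 0 < x.2) {q : ℕ → K} (hq : DenseRange q)
    (g : Fin 3 → ℂ) :
    (jetSamples (fun n => q n) w, g) ∈ degenerateSamples (fun n => q n) ↔
      ∃ x ∈ K, IsDegenerate (jets (perturb w g) x.1 x.2) := by
  have : CompactSpace K := isCompact_iff_compactSpace.1 hK
  have hcont : Continuous fun x : K => degeneracy (jets (perturb w g) x.1.1 x.1.2) :=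
    continuous_degeneracy.comp
      ((hw.perturb g).continuousOn_jets.mono hpos).domRestrict
  have hjets (n) := jets_perturb hw g (q n).1.1 (hpos _ (q n).2)
  have hiff := exists_eq_zero_iff_of_denseRange hcont (fun _ => degeneracy_nonneg _) hq
  simp only [degeneracy_eq_zero_iff, hjets, Subtype.exists, exists_prop] at hiff
  exact hiff.symm

section

variable {Ω : Type*} {mΩ : MeasurableSpace Ω} {P : Measure Ω} {V₁ V₂ : ℝ≥0 → Ω → ℝ}

lemma measurable_jetSamples (hc₁ : ∀ ω, Continuous (V₁ · ω)) (hc₂ : ∀ ω, Continuous (V₂ · ω))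
    (hm₁ : ∀ t, Measurable (V₁ t)) (hm₂ : ∀ t, Measurable (V₂ t)) {q : ℕ → ℝ × ℝ}
    (hq : ∀ n, 0 < (q n).2) :
    Measurable fun ω => jetSamples q (extendedPath (V₁ · ω) (V₂ · ω)) :=
  measurable_pi_lambda _ fun n => measurable_jets_extendedPath hm₁ hm₂ hc₁ hc₂ _ (hq n)

lemma indepFun_jetSamples_increments (hV₁ : IsRegularBrownian V₁ P) (hV₂ : IsRegularBrownian V₂ P)
    (hind : IndepFun (fun ω t => V₁ t ω) (fun ω t => V₂ t ω) P) {q : ℕ → ℝ × ℝ}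
    (hq : ∀ n, 0 < (q n).2) :
    IndepFun (fun ω => jetSamples q (extendedPath (remainder (V₁ · ω)) (remainder (V₂ · ω))))
      (fun ω => complexify (increments (V₁ · ω)) (increments (V₂ · ω))) P := by
  refine indepFun_of_measurable_comap
    (indepFun_remainders_increments hV₁ hV₂ hind) ?_ (comap_measurable _)
  have hfst (t) : Measurable fun r : (ℝ≥0 → ℝ) × (ℝ≥0 → ℝ) => r.1 t := by fun_prop
  have hsnd (t) : Measurable fun r : (ℝ≥0 → ℝ) × (ℝ≥0 → ℝ) => r.2 t := by fun_prop
  refine measurable_jetSamples (mΩ := .comap _ inferInstance)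
    (fun ω => continuous_remainder (hV₁.continuous ω))
    (fun ω => continuous_remainder (hV₂.continuous ω))
    (fun t => ?_) (fun t => ?_) hq
  · exact (hfst t).comp (comap_measurable _)
  · exact (hsnd t).comp (comap_measurable _)

variable [IsProbabilityMeasure P]

lemma ae_not_isDegenerate_of_isCompact (hV₁ : IsRegularBrownian V₁ P) (hV₂ : IsRegularBrownian V₂ P)
    (hind : IndepFun (fun ω t => V₁ t ω) (fun ω t => V₂ t ω) P) {K : Set (ℝ × ℝ)}
    (hK : IsCompact K) (hpos : ∀ x ∈ K, 0 < x.2) :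
    ∀ᵐ ω ∂P, ∀ x ∈ K, ¬ IsDegenerate (jets (extendedPath (V₁ · ω) (V₂ · ω)) x.1 x.2) := by
  rcases K.eq_empty_or_nonempty with rfl | hne
  · simp
  have : Nonempty K := hne.to_subtype
  obtain ⟨q, hq⟩ := TopologicalSpace.exists_dense_seq K
  have hqpos (n) : 0 < (q n).1.2 := hpos _ (q n).2
  have hR {V : ℝ≥0 → Ω → ℝ} (hV : IsRegularBrownian V P) (t) :
      Measurable fun ω => remainder (V · ω) t :=
    ((measurable_pi_apply t).comp measurable_remainder).comp (measurable_pi_lambda _ hV.measurable)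
  have hG {V : ℝ≥0 → Ω → ℝ} (hV : IsRegularBrownian V P) :
      Measurable fun ω => increments (V · ω) :=
    measurable_increments.comp (measurable_pi_lambda _ hV.measurable)
  have htempered := ae_tempered_extendedPath hV₁ hV₂
  have hac := map_complexify_increments_absolutelyContinuous hV₁.isPreBrownianReal
    hV₂.isPreBrownianReal hind
  have hnull := ae_prodMk_notMem_of_indepFun
    (measurable_jetSamples (fun ω => continuous_remainder (hV₁.continuous ω))
      (fun ω => continuous_remainder (hV₂.continuous ω)) (hR hV₁) (hR hV₂) hqpos)
    (measurePreserving_complexify.measurable.comp ((hG hV₁).prodMk (hG hV₂)))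
    (indepFun_jetSamples_increments hV₁ hV₂ hind hqpos)
    (measurableSet_degenerateSamples (fun n => q n)) ?_
  · filter_upwards [hnull, htempered] with ω hω hw x hx hdeg
    rw [extendedPath_eq_perturb_remainder] at hdeg
    exact hω ((mem_degenerateSamples_iff hw.extendedPath_remainder hK hpos hq _).2 ⟨x, hx, hdeg⟩)
  · filter_upwards [htempered] with ω hw
    refine hac (measure_mono_null
      (fun g hg => ?_) (addHaar_degenerate_eq_zero hw.extendedPath_remainder volume))
    obtain ⟨x, hx, hdeg⟩ :=
      (mem_degenerateSamples_iff hw.extendedPath_remainder hK hpos hq g).1 hg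
    exact ⟨x.1, x.2, hpos x hx, hdeg⟩

lemma ae_not_isDegenerate (hV₁ : IsRegularBrownian V₁ P)
    (hV₂ : IsRegularBrownian V₂ P) (hind : IndepFun (fun ω t => V₁ t ω) (fun ω t => V₂ t ω) P) :
    ∀ᵐ ω ∂P, ∀ p τ, 0 < τ → ¬ IsDegenerate (jets (extendedPath (V₁ · ω) (V₂ · ω)) p τ) := by
  have hopen : IsOpen {x : ℝ × ℝ | 0 < x.2} := isOpen_lt continuous_const continuous_snd
  obtain ⟨K, hK, hcover⟩ : IsSigmaCompact {x : ℝ × ℝ | 0 < x.2} := by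
    have := hopen.locallyCompactSpace
    exact isSigmaCompact_iff_sigmaCompactSpace.2 inferInstance
  have hae := ae_all_iff.2 fun n => ae_not_isDegenerate_of_isCompact hV₁ hV₂ hind
    (hK n) fun x hx => (hcover ▸ mem_iUnion_of_mem n hx : x ∈ {x : ℝ × ℝ | 0 < x.2})
  filter_upwards [hae] with ω hω p τ hτ
  obtain ⟨n, hn⟩ := mem_iUnion.1 (hcover ▸ hτ : (p, τ) ∈ ⋃ n, K n)
  exact hω n _ hn

end

end CongaLoop

theorem mainTheorem7 {Ω : Type*} [MeasurableSpace Ω] (P : Measure Ω) [IsProbabilityMeasure P]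
    (W₁ W₂ : ℝ≥0 → Ω → ℝ) (hW₁ : IsBrownianReal W₁ P) (hW₂ : IsBrownianReal W₂ P)
    (hindep : IndepFun (fun ω t => W₁ t ω) (fun ω t => W₂ t ω) P) :
    ∃ M : ℝ, 0 < M ∧ ∀ᵐ ω ∂P, ∀ f : ℝ → ℝ → ℂ,
      f = CongaLoop.heatExtension (fun t => W₁ t ω) (fun t => W₂ t ω) →
      ∀ p₀ τ₀ : ℝ, 0 < p₀ → 0 < τ₀ → CongaLoop.IsSingularity (fun p => f p τ₀) p₀ →
      CongaLoop.IsCuspSingularity (fun p => f p τ₀) p₀ ∧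
      ∃ δ : ℝ, 0 < δ ∧ δ < τ₀ ∧
        (∃ (l r : ℝ → ℝ) (L : ℝ → CongaLoop.Curve),
          (∀ τ ∈ Ico (τ₀ - δ) τ₀, 0 < l τ ∧ p₀ ∈ Ioo (l τ) (r τ) ∧
            CongaLoop.IsUniqueLoopIn (fun p => f p τ) (Icc (l τ) (r τ)) (L τ)) ∧
          MonotoneOn l (Ico (τ₀ - δ) τ₀) ∧ AntitoneOn r (Ico (τ₀ - δ) τ₀) ∧
          Tendsto l (𝓝[<] τ₀) (𝓝 p₀) ∧ Tendsto r (𝓝[<] τ₀) (𝓝 p₀) ∧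
          CongaLoop.DiesAt f (τ₀ - δ) L p₀ τ₀) ∧
        ∀ (c : ℂ) (a b : ℕ → ℝ), CongaLoop.IsNaturalFrame (fun p => f p τ₀) p₀ c a b →
          CongaLoop.IsUniqueLoopIn (CongaLoop.limitCurve (a 2) (b 3)) univ
            (CongaLoop.limitLoop (a 2) (b 3)) ∧
          ∃ Lhat : ℝ → CongaLoop.Curve,
            (∀ s ∈ Ioc 0 δ, CongaLoop.IsUniqueLoopIn (CongaLoop.rescaled f c p₀ τ₀ s)
              (Icc (-M) M) (Lhat s)) ∧
            Tendsto Lhat (𝓝[>] 0) (𝓝 (CongaLoop.limitLoop (a 2) (b 3))) := by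
  obtain ⟨V₁, hV₁, e₁⟩ := CongaLoop.exists_isRegularBrownian hW₁
  obtain ⟨V₂, hV₂, e₂⟩ := CongaLoop.exists_isRegularBrownian hW₂
  have hV : IndepFun (fun ω t => V₁ t ω) (fun ω t => V₂ t ω) P := hindep.congr e₁ e₂
  refine ⟨2, two_pos, ?_⟩
  filter_upwards [e₁, e₂, CongaLoop.ae_tempered_extendedPath hV₁ hV₂,
    CongaLoop.ae_not_isDegenerate hV₁ hV₂ hV] with ω h₁ h₂ htempered hdeg f hf p₀ τ₀ hp hτ hsing
  rw [h₁, h₂] at hf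
  have hflow : CongaLoop.IsHeatFlow f (CongaLoop.extendedPath (V₁ · ω) (V₂ · ω)) :=
    ⟨htempered, fun p τ hτ => hf ▸ CongaLoop.heatExtension_eq_jet _ _ p hτ⟩
  have hjet := hflow.jet_one_eq_zero hτ hsing
  exact hflow.cusp_formation hp hτ hsing fun hdet => hdeg p₀ τ₀ hτ ⟨hjet, hdet⟩
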